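/- Let $F$ be a non-archimedean local field, $D$ a central skewfield over $F$ of finite index $d$, $V$ a right $D$-vector space of finite dimension $m$, and $A:=\mathrm{End}_D(V)$. \textbf{Definitions.} Let $k|F$ be a finite field extension, $\Delta$ a central skewfield over $k$ of finite index $d_\Delta$, with valuation ring $o_\Delta$ and valuation ideal $\mathfrak p_\Delta$ for the unique extension of the valuation of $F$, and let $C$ be a $k$-algebra isomorphic to $\mathrm M_n(\Delta)$. A unital subring $\mathfrak c\subseteq C$ is a \emph{hereditary order} if it is a full $o_k$-lattice of $C$ whose Jacobson radical is projective as a right $\mathfrak c$-module; these orders, ordered by $\supseteq$, are the faces of the Euclidean building of $C^\times$. For a partition $n=n_1+\dots+n_r$ into positive integers, the order in standard form consists of the block matrices in $\mathrm M_n(\Delta)$ whose $(i,j)$-block has entries in $o_\Delta$ if $j\le i$ and in $\mathfrak p_\Delta$ if $i<j$; $\mathfrak c$ has \emph{rank} $r$ if, for an identification $C\cong\mathrm M_n(\Delta)$, it is conjugate to such an order. A \emph{vertex} is a face of rank $1$. Let $L$ be a maximal unramified extension of $k$ in $\Delta$ (so $[L:k]=d_\Delta$), $\pi$ a uniformizer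 of $\Delta$ normalizing $L$, and $\sigma(x):=\pi x\pi^{-1}$, which generates $\mathrm{Gal}(L|k)$. For a field $E$ with $k\subseteq E\subseteq C$, let $E_\Delta$ be the largest intermediate field of $E|k$ that is $k$-isomorphic to a subfield of $L$. Suppose that $\mathfrak c$ is a hereditary order normalised by $E^\times$. Let $\lambda=(\lambda_{i,j})$ be an $f\times r$ matrix with non-negative integer entries, with sum of entries $n$ and without zero column. The pair $(E,\mathfrak c)$ has \emph{embedding type} $\langle\lambda\rangle$ if some identification $C\cong \mathrm M_n(\Delta)$ of $k$-algebras takes $E_\Delta$ to \[\{\mathrm{diag}(M_1(x),\dots,M_r(x)) : x\in L_f\},\qquad M_j(x)=\mathrm{diag}(\sigma^0(x)I_{\lambda_{1,j}},\dots,\sigma^{f-1}(x)I_{\lambda_{f,j}}),\] where $L_f\subseteq L$ is the subfield of degree $f$ over $k$, and takes $\mathfrak c$ to the order in standard form for the partition $n_j=\sum_i\lambda_{i,j}$. For an $f\times r$ matrix $\lambda$ let $\mathrm{row}(\lambda)=(\lambda_{1,1},\dots,\lambda_{1,r},\lambda_{2,1},\dots,\lambda_{f,r})$. Two vectors are equivalent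 ($\sim$) if they differ by a cyclic permutation of the entries; two matrices of the same size are equivalent if their row vectors are. \textbf{Rank reduction lemma.} Let $E$ be a field with $F\subseteq E\subseteq A$, and let $K$ be an intermediate field of $E|F$ of degree $s=[K:F]$, where $2\le s\le m$. Let $Z_A(K)$ be the centraliser of $K$ in $A$, a central simple $K$-algebra. Let $\mathfrak a$ be a vertex of the Euclidean building of $A^\times$ normalised by $E^\times$, such that $\mathfrak a\cap Z_A(K)$ is a face of rank $s$ of the Euclidean building of $Z_A(K)^\times$ (it is normalised by $E^\times$). If $(E,\mathfrak a)$ has embedding type $\langle\lambda\rangle$ (with $k=F$, $C=A$) and $(E,\mathfrak a\cap Z_A(K))$ has embedding type $\langle\lambda'\rangle$ (with $k=K$, $C=Z_A(K)$), then \[\mathrm{row}(\lambda)\sim\mathrm{row}(\lambda'),\quad\text{i.e. } \lambda\sim \mathrm{row}(\lambda')^{T}.\] -/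

import Mathlib

/-! ## Vectors and matrices up to cyclic permutation -/

/-- The vector `row(M)` obtained by writing the rows of `M` one after the other. Two vectors are
equivalent if they differ by a cyclic permutation, i.e. `List.IsRotated`. -/
def row {f r : ℕ} (M : Matrix (Fin f) (Fin r) ℕ) : List ℕ :=
  List.ofFn fun p : Fin (f * r) => M p.divNat p.modNat

/-- The transpose of `row(M)`: a matrix with one column. -/
def rowTranspose {f r : ℕ} (M : Matrix (Fin f) (Fin r) ℕ) : Matrix (Fin (f * r)) (Fin 1) ℕ :=
  fun p _ => M p.divNat p.modNat

/-- Equivalence of matrices: they have the same size and their rows written one after the other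
differ by a cyclic permutation. -/
def MatEquiv {f r f' r' : ℕ} (M : Matrix (Fin f) (Fin r) ℕ) (N : Matrix (Fin f') (Fin r') ℕ) :
    Prop :=
  f = f' ∧ r = r' ∧ (row M).IsRotated (row N)

/-! ## Valuations on skewfields

Throughout, `F` is a non-archimedean local field, `k` is a finite field extension of `F`, and `D`
is a skewfield with centre `k`, of finite degree. -/

section Valuation

variable (F : Type*) [Field F] [ValuativeRel F]

/-- For a skewfield `X` of finite degree over `F` this is the `[X : F]`-th power of the unique
extension to `X` of the valuation of `F`. So the valuation ring of `X` consists of the `x` with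
`normVal F X x ≤ 1`, and the valuation ideal of the `x` with `normVal F X x < 1`. -/
noncomputable def normVal (X : Type*) [Ring X] [Algebra F X] (x : X) :
    ValuativeRel.ValueGroupWithZero F :=
  ValuativeRel.valuation F (Algebra.norm F x)

/-- `π` is a uniformizer of the skewfield `D`. -/
def IsUniformizer (D : Type*) [DivisionRing D] [Algebra F D] (π : D) : Prop :=
  π ≠ 0 ∧ normVal F D π < 1 ∧ ∀ y : D, normVal F D y < 1 → normVal F D y ≤ normVal F D π

/-- `L` is a maximal unramified field extension of `k` in `D`: a commutative subalgebra, with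
ramification index one over `k`, whose degree over `k` is the index of `D`. -/
structure IsMaxUnramified (k D : Type*) [Field k] [DivisionRing D] [Algebra F D] [Algebra k D]
    (L : Subalgebra k D) : Prop where
  comm : ∀ x ∈ L, ∀ y ∈ L, x * y = y * x
  unramified : ∀ x ∈ L, ∃ c : k, normVal F D x = normVal F D (algebraMap k D c)
  degree : Module.finrank k L ^ 2 = Module.finrank k D

/-- `π` is a uniformizer of `D` which normalizes `L`; the conjugation with `π` generates the Galois
group of `L` over `k`, i.e. its fixed field in `L` is `k`. -/
structure IsNormalizingUniformizer (k D : Type*) [Field k] [DivisionRing D] [Algebra F D]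
    [Algebra k D] (L : Subalgebra k D) (π : D) : Prop where
  uniformizer : IsUniformizer F D π
  normalizes : ∀ x ∈ L, π * x * π⁻¹ ∈ L
  generates : ∀ x ∈ L, π * x * π⁻¹ = x → x ∈ (algebraMap k D).range

end Valuation

/-! ## Hereditary orders -/

section Orders

variable (F : Type*) [Field F] [ValuativeRel F]
variable (k : Type*) [Field k] [Algebra F k]

/-- The unital subring `𝔞` is an `o_k`-order of `A`: it is a finitely generated `o_k`-module which
spans `A` over `k`. -/
def IsLatticeOrder {A : Type*} [Ring A] [Algebra k A] (𝔞 : Subring A) : Prop :=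
  (∃ (n : ℕ) (b : Fin n → A), ∀ x : A,
    x ∈ 𝔞 ↔ ∃ c : Fin n → k, (∀ i, normVal F k (c i) ≤ 1) ∧ x = ∑ i, c i • b i) ∧
  Submodule.span k (𝔞 : Set A) = ⊤

/-- A hereditary `o_k`-order: the Jacobson radical is a projective right module. Right modules are
modules over the opposite ring, and the Jacobson radical is left-right symmetric. -/
def IsHereditaryOrder {A : Type*} [Ring A] [Algebra k A] (𝔞 : Subring A) : Prop :=
  IsLatticeOrder F k 𝔞 ∧ Module.Projective (𝔞)ᵐᵒᵖ (Ring.jacobson (𝔞)ᵐᵒᵖ)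

/-- `(E, 𝔞)` is an embedding of the `k`-algebra `A`: `E` is a field extension of `k`, contained in
`A` via `ι`, and `𝔞` is a hereditary order of `A` normalised by `Eˣ`; that is, `𝔞` is a face of the
Euclidean building of `Aˣ` which is fixed by `Eˣ`. -/
structure IsEmbeddingPair {A : Type*} [Ring A] [Algebra k A] {E : Type*} [Field E] [Algebra k E]
    (ι : E →ₐ[k] A) (𝔞 : Subring A) : Prop where
  hereditary : IsHereditaryOrder F k 𝔞
  normalised : ∀ x : E, x ≠ 0 → ∀ a ∈ 𝔞, ι x * a * ι x⁻¹ ∈ 𝔞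

/-- The hereditary order in standard form of block matrices over `D`: the entries on and below the
block diagonal lie in `o_D`, those above it in `𝔭_D`. Here `b p` is the number of the block
in which the index `p` lies. -/
def standardOrder (D : Type*) [DivisionRing D] [Algebra F D] {I : Type*} {r : ℕ} (b : I → Fin r) :
    Set (Matrix I I D) :=
  {M | ∀ p q, (b q ≤ b p → normVal F D (M p q) ≤ 1) ∧ (b p < b q → normVal F D (M p q) < 1)}

/-- The order `𝔞` of `A ≅ M_m(D)` has (simplicial) rank `r`: it is conjugate to a hereditary order
in standard form for a partition `m = n₁ + ⋯ + n_r` into positive parts. The conjugation is part of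
the identification `φ`. -/
def HasRank (D : Type*) [DivisionRing D] [Algebra F D] [Algebra k D]
    {A : Type*} [Ring A] [Algebra k A] (𝔞 : Subring A) (r : ℕ) : Prop :=
  ∃ (n : Fin r → ℕ)
    (φ : A ≃ₐ[k] Matrix (Σ j : Fin r, Fin (n j)) (Σ j : Fin r, Fin (n j)) D),
    (∀ j, 0 < n j) ∧
    ∀ a : A, a ∈ 𝔞 ↔ φ a ∈ standardOrder F D (fun p : Σ j : Fin r, Fin (n j) => p.1)

end Orders

/-! ## Pearl embeddings and embedding types -/

/-- The index set of the matrices for the pearl embedding of `lam`: the blocks are numbered by the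
columns `j`, the `j`-th one is divided into pieces numbered by the rows `i`, and the piece `(i, j)`
has size `lam i j`. -/
abbrev PearlIndex {f r : ℕ} (lam : Matrix (Fin f) (Fin r) ℕ) : Type :=
  Σ j : Fin r, Σ i : Fin f, Fin (lam i j)

/-- The matrix `diag(M₁(x), …, M_r(x))`, where `M_j(x)` is the diagonal matrix with the entries
`σ^i(x)` repeated `lam i j` times, `i = 0, …, f - 1`, and `σ(x) = π x π⁻¹`. -/
def pearlMatrix {D : Type*} [DivisionRing D] (π : D) {f r : ℕ} (lam : Matrix (Fin f) (Fin r) ℕ)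
    (x : D) : Matrix (PearlIndex lam) (PearlIndex lam) D :=
  Matrix.diagonal fun p => π ^ (p.2.1 : ℕ) * x * (π ^ (p.2.1 : ℕ))⁻¹

/-- `M` is the largest intermediate field of `E | k` which is isomorphic, over `k`, to a subfield
of `L`. -/
def IsLargestEmbeddable {k D E : Type*} [Field k] [DivisionRing D] [Algebra k D] [Field E]
    [Algebra k E] (L : Subalgebra k D) (M : IntermediateField k E) : Prop :=
  IsGreatest {M' : IntermediateField k E | ∃ g : M' →ₐ[k] D, ∀ x, g x ∈ L} M

/-- The embedding `(E, 𝔞)` of `A ≅ M_m(D)` has the embedding type `⟨lam⟩`: the matrix `lam` has no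
zero column, and there is an identification `φ` of `A` with a matrix algebra over `D` (whose size is
the sum of the entries of `lam`) which takes `E_D` to the field and `𝔞` to the order of the pearl
embedding of `lam`. By the theorem of Skolem-Noether this is the conjugacy of `(E_D, 𝔞)` to the
pearl embedding for any fixed identification. `Lf` is the subfield of degree `f` of `L`. -/
def HasEmbeddingType (F k D : Type*) [Field F] [ValuativeRel F] [Field k] [DivisionRing D]
    [Algebra F D] [Algebra k D] {A : Type*} [Ring A] [Algebra k A] {E : Type*} [Field E]
    [Algebra k E] (ι : E →ₐ[k] A) (𝔞 : Subring A) {f r : ℕ} (lam : Matrix (Fin f) (Fin r) ℕ) :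
    Prop :=
  (∀ j, ∃ i, 0 < lam i j) ∧
  ∃ (L Lf : Subalgebra k D) (π : D) (E_D : IntermediateField k E)
    (φ : A ≃ₐ[k] Matrix (PearlIndex lam) (PearlIndex lam) D),
    IsMaxUnramified F k D L ∧
    IsNormalizingUniformizer F k D L π ∧
    IsLargestEmbeddable L E_D ∧
    Lf ≤ L ∧ Module.finrank k Lf = f ∧
    (fun x : E => φ (ι x)) '' (E_D : Set E) = pearlMatrix π lam '' (Lf : Set D) ∧
    ∀ a : A, a ∈ 𝔞 ↔ φ a ∈ standardOrder F D (fun p : PearlIndex lam => p.1)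

/-! ## Centralisers -/

section Centralizer

variable {F A E : Type*} [Field F] [Ring A] [Algebra F A] [Field E] [Algebra F E]

/-- The centraliser `Z_A(K)` of an intermediate field `K` of `E | F`, where `E` is contained in `A`
via `ι`. -/
abbrev fieldCentralizer (ι : E →ₐ[F] A) (K : IntermediateField F E) : Subalgebra F A :=
  Subalgebra.centralizer F (ι '' (K : Set E))

/-- `E` is contained in the centraliser of `K`. -/
def toCentralizer (ι : E →ₐ[F] A) (K : IntermediateField F E) : E →ₐ[F] fieldCentralizer ι K :=
  ι.codRestrict _ fun x => by
    rw [Subalgebra.mem_centralizer_iff]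
    rintro _ ⟨y, -, rfl⟩
    rw [← map_mul, ← map_mul, mul_comm]

/-- The centraliser of `K` is a `K`-algebra. -/
instance centralizerAlgebra (ι : E →ₐ[F] A) (K : IntermediateField F E) :
    Algebra K (fieldCentralizer ι K) :=
  RingHom.toAlgebra' ((toCentralizer ι K).toRingHom.comp (algebraMap K E)) fun c x =>
    Subtype.ext (Subalgebra.mem_centralizer_iff F |>.1 x.2 _ ⟨c, c.2, rfl⟩)

/-- The inclusion of `E` in the centraliser of `K`, as a map of `K`-algebras. -/
def centralizerEmbedding (ι : E →ₐ[F] A) (K : IntermediateField F E) :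
    E →ₐ[K] fieldCentralizer ι K :=
  { (toCentralizer ι K).toRingHom with commutes' := fun _ => rfl }

/-- The intersection `𝔞 ∩ Z_A(K)`, as a subring of `Z_A(K)`. -/
def interCentralizer (ι : E →ₐ[F] A) (K : IntermediateField F E) (𝔞 : Subring A) :
    Subring (fieldCentralizer ι K) :=
  𝔞.comap (fieldCentralizer ι K).val.toRingHom

end Centralizer

/-! A vertex is the stabiliser of an `o_D`-lattice `Λ` in `V`, and everything is read off from `Λ`.
Let `q` be the size of the residue field of `F`, let `d` and `δ` be the indices of `D` and `Δ`, and
let `e` be the ramification index of `Δ` over `F`.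

A face of rank `s = [K : F]` in the centraliser forces extremal invariants. Moving the diagonal
pieces of `Λ` into the image `U` of one diagonal matrix unit of `Z_A(K) ≅ M_n(Δ)` gives a chain of
lattices `π C_s ⊂ C_1 ⊂ … ⊂ C_s` in a `D`-space of dimension `u`. The double centraliser theorem
yields `s δ = u d`, and `N = [C_s : π C_s]` satisfies `N ^ e = q ^ (d² u)`. All `s` steps are strict
and each has index at least `q ^ d`, so `e ≤ δ`. The residue field of `Δ` is already that of a
subfield of degree at most `δ` over `K`, so it has at most `q ^ (s δ)` elements, and the fundamental
equality turns this into `δ ≤ e`. Hence `e = δ`, the residue field has exactly `q ^ (s δ)` elements,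
and `K | F` is unramified. The closing step `π C_s ⊂ C_1` is also at least as large as the residue
field of `Δ`, so `s δ + (s - 1) d ≤ s d`; therefore `u = 1` and `d = s δ` (`exists_chain_index`,
`residue_card_le`, `index_eq_of_chain`).

Since `u = 1`, every identification of `Z_A(K)` with a matrix algebra comes from a `D`-basis of `V`
and an embedding `Δ → D` of relative ramification index `s`. The lattice is given in this basis by
exponents `c p`, and standard form means that they are constant on blocks, strictly decreasing from
block to block, and of spread less than `s` (`exists_adapted_basis`). The number of blocks does not
depend on the identification (`card_blocks_le`), so the pearl embedding in the centraliser has `r' =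
s` blocks and its exponents are a constant minus the block number (`blocks_of_strict`). The same
argument for `D` itself, with ramification index one, gives `r = 1`.

Unramified extensions are determined by their degrees, so `E_D` and `E_Δ` are the same subset of `E`
and `f = s f'` (`largestEmbeddable_eq`). This field is generated by a root of unity `ζ` of order `q
^ f - 1`. Both pearl embeddings diagonalise `ζ` in bases adapted to `Λ`, so they give the same
eigenvalue multiplicities on the reduction of `Λ` (`card_eigenvalue_le`). Conjugation by an element
of order `n` acts on the residue field of `D` as the `n`-th power of one automorphism. The
uniformizers of the two pearl embeddings have orders `r` and `r'` in `D`, so the piece `(i, j)`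
carries the exponent `r i + j`, respectively `r' i + j`, up to a constant. On the reduction of `ζ`
this automorphism has period exactly `f`. Thus the multiplicities, indexed by residues modulo `f`,
are the entries of both row vectors up to a shift (`isRotated_row_of_pearlMatrix`). -/

/-! ## Lattices over a discrete valuation ring -/

section Lattice

variable {R : Type*} [CommRing R] [IsDomain R] [IsDiscreteValuationRing R]
variable {F : Type*} [Field F] [Algebra R F] [IsFractionRing R F]
variable {W : Type*} [AddCommGroup W] [Module F W] [Module R W] [IsScalarTower R F W]

open IsLocalRing

/-- For a finite free module `M` over a discrete valuation ring, the reduction of `M` modulo a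
uniformizer has `q ^ rank M` elements. -/
theorem card_reduction_eq_pow {M : Type*} [AddCommGroup M] [Module R M] [Module.Finite R M]
    [Module.Free R M] {ϖ : R} (hϖ : Irreducible ϖ) :
    (AddMonoidHom.range (DistribSMul.toAddMonoidHom M ϖ)).index =
      Nat.card (ResidueField R) ^ Module.finrank R M := by
  classical
  let b := Module.finBasis R M
  let n := Module.finrank R M
  -- Coordinatewise reduction; its kernel is `ϖ M`, so the index is the size of its image.
  let g : M →+ (Fin n → ResidueField R) :=
    AddMonoidHom.mk' (fun x i => residue R (b.equivFun x i)) fun x y => by ext i; simp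
  have hg : Function.Surjective g := by
    intro y
    choose c hc using fun i => residue_surjective (R := R) (y i)
    refine ⟨b.equivFun.symm c, ?_⟩
    ext i
    simp only [g, AddMonoidHom.mk'_apply, LinearEquiv.apply_symm_apply, hc]
  have hker : AddMonoidHom.range (DistribSMul.toAddMonoidHom M ϖ) = g.ker := by
    ext x
    simp only [AddMonoidHom.mem_range, AddMonoidHom.mem_ker]
    constructor
    · rintro ⟨y, rfl⟩
      ext i
      simp only [g, DistribSMul.toAddMonoidHom_apply, AddMonoidHom.mk'_apply, map_smul,
        Pi.smul_apply, smul_eq_mul, map_mul, Pi.zero_apply]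
      rw [(residue_eq_zero_iff ϖ).2 ((mem_maximalIdeal _).2 hϖ.not_isUnit), zero_mul]
    · intro h
      have h' : ∀ i, ∃ c, b.equivFun x i = ϖ * c := fun i => by
        have := congrFun h i
        simp only [g, AddMonoidHom.mk'_apply, Pi.zero_apply, residue_eq_zero_iff,
          hϖ.maximalIdeal_eq, Ideal.mem_span_singleton'] at this
        obtain ⟨c, hc⟩ := this
        exact ⟨c, by rw [← hc, mul_comm]⟩
      choose c hc using h'
      refine ⟨b.equivFun.symm c, b.equivFun.injective ?_⟩
      ext i
      rw [DistribSMul.toAddMonoidHom_apply, map_smul, LinearEquiv.apply_symm_apply, hc]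
      rfl
  rw [hker, AddSubgroup.index_ker, AddMonoidHom.range_eq_top.2 hg,
    Nat.card_congr AddSubgroup.topEquiv.toEquiv, Nat.card_pi]
  simp [n]

/-- The index of `ϖ M` in a lattice `M`. -/
theorem relIndex_smul_lattice {ϖ : R} (hϖ : Irreducible ϖ) (M : Submodule R W) (hM : M.FG)
    (N : AddSubgroup W) (hN : ∀ x, x ∈ N ↔ ∃ y ∈ M, ϖ • y = x) :
    N.relIndex M.toAddSubgroup =
      Nat.card (ResidueField R) ^ Module.finrank F (Submodule.span F (M : Set W)) := by
  have : Module.Finite R M := Module.Finite.iff_fg.2 hM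
  have : Module.IsTorsionFree R F := inferInstance
  have : Module.IsTorsionFree R W := Module.IsTorsionFree.trans_faithfulSMul R F W
  have hfree : Module.Free R M := inferInstance
  -- An `R`-basis of a lattice remains independent over the fraction field, so rank and dimension of
  -- the span agree.
  have hfin : Module.finrank F (Submodule.span F (M : Set W)) = Module.finrank R M := by
    let b := Module.finBasis R M
    have hli : LinearIndependent R (fun i => (b i : W)) :=
      b.linearIndependent.map' M.subtype (Submodule.ker_subtype _)
    have hli' := (LinearIndependent.iff_fractionRing R F).1 hli
    have hspan : Submodule.span F (M : Set W) =
        Submodule.span F (Set.range fun i => (b i : W)) := by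
      apply le_antisymm
      · rw [Submodule.span_le]
        intro x hx
        have := b.sum_repr ⟨x, hx⟩
        have h2 : x = ∑ i, b.repr ⟨x, hx⟩ i • (b i : W) := by
          conv_lhs => rw [show x = ((⟨x, hx⟩ : M) : W) from rfl, ← this]
          simp only [Submodule.coe_sum, Submodule.coe_smul]
        rw [h2]
        refine Submodule.sum_mem _ fun i _ => ?_
        rw [← algebraMap_smul F]
        exact Submodule.smul_mem _ _ (Submodule.subset_span ⟨i, rfl⟩)
      · rw [Submodule.span_le]
        rintro _ ⟨i, rfl⟩
        exact Submodule.subset_span (b i).2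
    rw [hspan, finrank_span_eq_card hli']
    simp
  rw [hfin, ← card_reduction_eq_pow (M := M) hϖ, AddSubgroup.relIndex]
  congr 1
  ext x
  simp only [AddSubgroup.mem_addSubgroupOf, hN, AddMonoidHom.mem_range]
  constructor
  · rintro ⟨y, hy, hxy⟩
    exact ⟨⟨y, hy⟩, Subtype.ext hxy⟩
  · rintro ⟨y, hy⟩
    exact ⟨y, y.2, congrArg Subtype.val hy⟩

end Lattice

/-! ## Discretely valued skewfields -/

section Ord

variable {R : Type*} [CommRing R] {X : Type*} [DivisionRing X] [Algebra R X]

open IsLocalRing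

/-- `ord` is a normalised discrete valuation of the skewfield `X` with valuation ring `O`. The value
of `ord` at zero is irrelevant. -/
structure IsOrd (O : Subalgebra R X) (ord : X → ℤ) : Prop where
  map_mul : ∀ {x y : X}, x ≠ 0 → y ≠ 0 → ord (x * y) = ord x + ord y
  mem_iff : ∀ {x : X}, x ≠ 0 → (x ∈ O ↔ 0 ≤ ord x)
  exists_uniformizer : ∃ π : X, π ≠ 0 ∧ ord π = 1

namespace IsOrd

variable {O : Subalgebra R X} {ord : X → ℤ} (h : IsOrd O ord)
include h

theorem map_one : ord 1 = 0 := by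
  have := h.map_mul (one_ne_zero (α := X)) one_ne_zero
  rw [mul_one] at this
  lia

theorem map_inv {x : X} (hx : x ≠ 0) : ord x⁻¹ = -ord x := by
  have := h.map_mul hx (inv_ne_zero hx)
  rw [mul_inv_cancel₀ hx, h.map_one] at this
  lia

theorem map_pow {x : X} (hx : x ≠ 0) (n : ℕ) : ord (x ^ n) = n * ord x := by
  induction n with
  | zero => simp [h.map_one]
  | succ n ih =>
    rw [pow_succ, h.map_mul (pow_ne_zero n hx) hx, ih]
    push_cast
    ring

theorem map_zpow {x : X} (hx : x ≠ 0) (n : ℤ) : ord (x ^ n) = n * ord x := by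
  obtain ⟨n, rfl | rfl⟩ := n.eq_nat_or_neg
  · rw [zpow_natCast, h.map_pow hx]
  · rw [zpow_neg, zpow_natCast, h.map_inv (pow_ne_zero n hx), h.map_pow hx]
    ring

theorem map_conj {x y : X} (hx : x ≠ 0) (hy : y ≠ 0) : ord (x * y * x⁻¹) = ord y := by
  rw [h.map_mul (mul_ne_zero hx hy) (inv_ne_zero hx), h.map_mul hx hy, h.map_inv hx]
  ring

/-- The ultrametric inequality follows from `O` being closed under addition: the summand `a` of
smaller order is split off, and `1 + a⁻¹ b` is integral. -/
theorem le_map_add {x y : X} {n : ℤ} (hx : x ≠ 0) (hy : y ≠ 0) (hxy : x + y ≠ 0)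
    (hxn : n ≤ ord x) (hyn : n ≤ ord y) : n ≤ ord (x + y) := by
  have key : ∀ {a b : X}, a ≠ 0 → b ≠ 0 → a + b ≠ 0 → ord a ≤ ord b → ord a ≤ ord (a + b) := by
    intro a b ha hb hab hle
    have h1 : a + b = a * (1 + a⁻¹ * b) := by
      rw [mul_add, mul_one, ← mul_assoc, mul_inv_cancel₀ ha, one_mul]
    have h2 : 1 + a⁻¹ * b ≠ 0 := by
      intro h0
      rw [h1, h0, mul_zero] at hab
      exact hab rfl
    have h3 : a⁻¹ * b ∈ O := by
      rw [h.mem_iff (mul_ne_zero (inv_ne_zero ha) hb), h.map_mul (inv_ne_zero ha) hb, h.map_inv ha]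
      lia
    have h4 := (h.mem_iff h2).1 (O.add_mem O.one_mem h3)
    rw [h1, h.map_mul ha h2]
    lia
  rcases le_total (ord x) (ord y) with hle | hle
  · exact hxn.trans (key hx hy hxy hle)
  · rw [add_comm] at hxy ⊢
    exact hyn.trans (key hy hx hxy hle)

omit h in
/-- The fractional ideal of elements of order at least `n`. -/
def ball (h : IsOrd O ord) (n : ℤ) : AddSubgroup X where
  carrier := {x | x = 0 ∨ n ≤ ord x}
  zero_mem' := Or.inl rfl
  add_mem' := by
    rintro x y hx hy
    by_cases hx0 : x = 0
    · simpa [hx0] using hy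
    by_cases hy0 : y = 0
    · simpa [hy0] using hx
    by_cases hxy : x + y = 0
    · exact Or.inl hxy
    exact Or.inr (h.le_map_add hx0 hy0 hxy (hx.resolve_left hx0) (hy.resolve_left hy0))
  neg_mem' := by
    rintro x (rfl | hx)
    · exact Or.inl neg_zero
    · by_cases hx0 : x = 0
      · exact Or.inl (by rw [hx0, neg_zero])
      refine Or.inr ?_
      have h1 : ord (-1) = 0 := by
        have h1 : (-1 : X) ≠ 0 := neg_ne_zero.2 one_ne_zero
        have := h.map_mul h1 h1
        rw [neg_one_mul, neg_neg, h.map_one] at this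
        lia
      rw [← neg_one_mul, h.map_mul (neg_ne_zero.2 one_ne_zero) hx0, h1]
      lia

omit h in
theorem mem_ball (h : IsOrd O ord) {n : ℤ} {x : X} : x ∈ h.ball n ↔ x = 0 ∨ n ≤ ord x := Iff.rfl

theorem mem_ball_iff {n : ℤ} {x : X} (hx : x ≠ 0) : x ∈ h.ball n ↔ n ≤ ord x := by
  rw [h.mem_ball, or_iff_right hx]

theorem mem_ball_zero {x : X} : x ∈ h.ball 0 ↔ x ∈ O := by
  by_cases hx : x = 0
  · simp [hx, zero_mem]
  · rw [h.mem_ball_iff hx, h.mem_iff hx]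

theorem ball_zero : h.ball 0 = (Subalgebra.toSubmodule O).toAddSubgroup := by
  ext x
  rw [h.mem_ball_zero]
  rfl

theorem ball_anti {m n : ℤ} (hmn : m ≤ n) : h.ball n ≤ h.ball m := fun _ hx =>
  hx.imp_right fun h => hmn.trans h

theorem mul_mem_ball {m n : ℤ} {x y : X} (hx : x ∈ h.ball m) (hy : y ∈ h.ball n) :
    x * y ∈ h.ball (m + n) := by
  by_cases hx0 : x = 0
  · simp [hx0, zero_mem]
  by_cases hy0 : y = 0
  · simp [hy0, zero_mem]
  rw [h.mem_ball_iff (mul_ne_zero hx0 hy0), h.map_mul hx0 hy0]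
  rw [h.mem_ball_iff hx0] at hx
  rw [h.mem_ball_iff hy0] at hy
  lia

theorem mul_mem_ball_iff_left {m : ℤ} {x y : X} (hx : x ≠ 0) :
    x * y ∈ h.ball m ↔ y ∈ h.ball (m - ord x) := by
  by_cases hy : y = 0
  · simp [hy, zero_mem]
  rw [h.mem_ball_iff (mul_ne_zero hx hy), h.mem_ball_iff hy, h.map_mul hx hy]
  constructor <;> intro <;> lia

theorem mul_mem_ball_iff_right {m : ℤ} {x y : X} (hy : y ≠ 0) :
    x * y ∈ h.ball m ↔ x ∈ h.ball (m - ord y) := by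
  by_cases hx : x = 0
  · simp [hx, zero_mem]
  rw [h.mem_ball_iff (mul_ne_zero hx hy), h.mem_ball_iff hx, h.map_mul hx hy]
  constructor <;> intro <;> lia

theorem map_mulLeft_ball {x : X} (hx : x ≠ 0) (n : ℤ) :
    (h.ball n).map (AddMonoidHom.mulLeft x) = h.ball (n + ord x) := by
  ext y
  simp only [AddSubgroup.mem_map, AddMonoidHom.coe_mulLeft]
  constructor
  · rintro ⟨z, hz, rfl⟩
    rw [h.mul_mem_ball_iff_left hx]
    simpa using hz
  · intro hy
    refine ⟨x⁻¹ * y, ?_, by rw [← mul_assoc, mul_inv_cancel₀ hx, one_mul]⟩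
    rw [h.mul_mem_ball_iff_left (inv_ne_zero hx), h.map_inv hx]
    simpa using hy

/-- Multiplication by `π ^ n` is injective and moves the layer at zero to the layer at `n`, so all
layers have the size of the residue skewfield. -/
theorem relIndex_ball_succ (n : ℤ) :
    (h.ball (n + 1)).relIndex (h.ball n) = (h.ball 1).relIndex (h.ball 0) := by
  obtain ⟨π, hπ, h1⟩ := h.exists_uniformizer
  have hp : π ^ n ≠ 0 := zpow_ne_zero n hπ
  have e : ∀ k, h.ball (k + n) = (h.ball k).map (AddMonoidHom.mulLeft (π ^ n)) := fun k => by
    rw [h.map_mulLeft_ball hp, h.map_zpow hπ, h1, mul_one]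
  rw [add_comm, e, show h.ball n = (h.ball 0).map (AddMonoidHom.mulLeft (π ^ n)) by
    rw [← e, zero_add], AddSubgroup.relIndex_map_map_of_injective]
  exact mul_right_injective₀ hp

theorem relIndex_ball_nat (n : ℕ) :
    (h.ball n).relIndex (h.ball 0) = (h.ball 1).relIndex (h.ball 0) ^ n := by
  induction n with
  | zero => simp
  | succ n ih =>
    rw [pow_succ, ← ih, mul_comm, ← h.relIndex_ball_succ n, Nat.cast_succ,
      AddSubgroup.relIndex_mul_relIndex _ _ _ (h.ball_anti (by lia)) (h.ball_anti (by lia))]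

end IsOrd

end Ord

/-! ### Ramification index and residue degree over a discrete valuation ring -/

section OrdLattice

variable {R : Type*} [CommRing R] [IsDomain R] [IsDiscreteValuationRing R]
variable (F : Type*) [Field F] [Algebra R F] [IsFractionRing R F]
variable {X : Type*} [DivisionRing X] [Algebra F X] [Algebra R X] [IsScalarTower R F X]
variable {O : Subalgebra R X} {ord : X → ℤ} {ϖ : R}

open IsLocalRing

namespace IsOrd

omit [IsDomain R] [IsDiscreteValuationRing R] in
include F in
theorem algebraMap_uniformizer_ne_zero (hϖ : Irreducible ϖ) : algebraMap R X ϖ ≠ 0 := by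
  rw [IsScalarTower.algebraMap_apply R F X]
  simpa using hϖ.ne_zero

variable (h : IsOrd O ord) [Finite (ResidueField R)]
variable (hϖ : Irreducible ϖ) (hO : (Subalgebra.toSubmodule O).FG)

include F h hϖ hO

/-- A uniformizer of the base ring has positive order. -/
theorem ord_uniformizer_pos : 0 < ord (algebraMap R X ϖ) := by
  have h0 : algebraMap R X ϖ ≠ 0 := algebraMap_uniformizer_ne_zero F hϖ
  have h1 : 0 ≤ ord (algebraMap R X ϖ) := (h.mem_iff h0).1 (O.algebraMap_mem ϖ)
  refine lt_of_le_of_ne h1 fun h2 => ?_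
  -- If `ϖ` had order zero, then `ϖ O = O` would have index one in `O`, but the lattice formula
  -- gives a positive power of `q`.
  have hN := relIndex_smul_lattice (F := F) hϖ (Subalgebra.toSubmodule O) hO (h.ball 0) fun x => by
    rw [show (0 : ℤ) = 0 + ord (algebraMap R X ϖ) by lia, ← h.map_mulLeft_ball h0]
    simp only [AddSubgroup.mem_map, h.mem_ball_zero, Subalgebra.mem_toSubmodule,
      AddMonoidHom.coe_mulLeft, Algebra.smul_def]
  rw [← h.ball_zero, AddSubgroup.relIndex_self] at hN
  have : Module.Finite R O := Module.Finite.iff_fg.2 hO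
  have hfd : FiniteDimensional F (Submodule.span F (O : Set X)) := by
    obtain ⟨S, hS⟩ := hO
    refine Module.Finite.iff_fg.2 ⟨S, ?_⟩
    apply le_antisymm
    · refine Submodule.span_mono fun x hx => ?_
      have := Submodule.subset_span (R := R) hx
      rw [hS] at this
      exact this
    · rw [Submodule.span_le]
      intro x hx
      have hx : x ∈ Subalgebra.toSubmodule O := hx
      rw [← hS] at hx
      exact Submodule.span_le_restrictScalars R F (S : Set X) hx
  have hpos : 0 < Module.finrank F (Submodule.span F (O : Set X)) := by
    rw [Module.finrank_pos_iff]
    refine ⟨⟨⟨1, Submodule.subset_span O.one_mem⟩, 0, fun h => one_ne_zero (congrArg Subtype.val h)⟩⟩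
  have h2 := Finite.one_lt_card (α := ResidueField R)
  have := Nat.one_lt_pow hpos.ne' h2
  exact absurd hN this.ne

/-- The span of the integral elements of a subspace. -/
theorem span_inf_eq (S : Submodule F X) :
    Submodule.span F ((Subalgebra.toSubmodule O ⊓ S.restrictScalars R : Submodule R X) : Set X)
      = S := by
  apply le_antisymm
  · rw [Submodule.span_le]
    exact fun x hx => hx.2
  · intro x hx
    by_cases hx0 : x = 0
    · simp [hx0]
    have h0 : algebraMap R X ϖ ≠ 0 := algebraMap_uniformizer_ne_zero F hϖ
    have hpos := h.ord_uniformizer_pos F hϖ hO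
    -- Since `ϖ` has order at least one, this power of it makes `x` integral.
    set c : F := algebraMap R F ϖ ^ (ord x).natAbs with hc
    have hc0 : c ≠ 0 := pow_ne_zero _ (by simpa using hϖ.ne_zero)
    have hcx : algebraMap F X c = algebraMap R X ϖ ^ (ord x).natAbs := by
      rw [hc, _root_.map_pow, ← IsScalarTower.algebraMap_apply]
    have hmem : c • x ∈ O := by
      rw [Algebra.smul_def, hcx, h.mem_iff (mul_ne_zero (pow_ne_zero _ h0) hx0),
        h.map_mul (pow_ne_zero _ h0) hx0, h.map_pow h0]
      have : ((ord x).natAbs : ℤ) ≤ (ord x).natAbs * ord (algebraMap R X ϖ) :=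
        le_mul_of_one_le_right (by lia) (by lia)
      lia
    rw [← inv_smul_smul₀ hc0 x]
    exact Submodule.smul_mem _ _ (Submodule.subset_span ⟨hmem, S.smul_mem _ hx⟩)

/-- The number of residue classes of a lattice of integral elements in a subspace. -/
theorem relIndex_smul_inf [FiniteDimensional F X] (S : Submodule F X) (N : AddSubgroup X)
    (hN : ∀ x, x ∈ N ↔ ∃ y ∈ O, y ∈ S ∧ algebraMap R X ϖ * y = x) :
    N.relIndex (Subalgebra.toSubmodule O ⊓ S.restrictScalars R : Submodule R X).toAddSubgroup =
      Nat.card (ResidueField R) ^ Module.finrank F S := by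
  have : IsNoetherian R (Subalgebra.toSubmodule O) :=
    have : Module.Finite R (Subalgebra.toSubmodule O) := Module.Finite.iff_fg.2 hO
    inferInstance
  have hfg : (Subalgebra.toSubmodule O ⊓ S.restrictScalars R : Submodule R X).FG :=
    Module.Finite.iff_fg.1 (Module.Finite.of_injective
      (Submodule.inclusion (inf_le_left : _ ≤ Subalgebra.toSubmodule O))
      (Submodule.inclusion_injective _))
  rw [relIndex_smul_lattice (F := F) hϖ _ hfg N, h.span_inf_eq F hϖ hO]
  intro x
  simp [hN, Algebra.smul_def, and_assoc]

/-- The fundamental equality for the ramification index and the residue degree. -/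
theorem card_pow_ramification [FiniteDimensional F X] :
    (h.ball 1).relIndex (h.ball 0) ^ (ord (algebraMap R X ϖ)).toNat =
      Nat.card (ResidueField R) ^ Module.finrank F X := by
  have h0 : algebraMap R X ϖ ≠ 0 := algebraMap_uniformizer_ne_zero F hϖ
  have hpos := h.ord_uniformizer_pos F hϖ hO
  -- The index of `ϖ O` in `O` is counted twice: by the layers between the two balls, and by the
  -- rank of `O` as a lattice.
  rw [← h.relIndex_ball_nat, Int.toNat_of_nonneg hpos.le]
  have := h.relIndex_smul_inf F hϖ hO ⊤ (h.ball (ord (algebraMap R X ϖ))) fun x => by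
    rw [show ord (algebraMap R X ϖ) = 0 + ord (algebraMap R X ϖ) by lia, ← h.map_mulLeft_ball h0]
    simp [h.mem_ball_zero]
  rw [finrank_top] at this
  rw [← this, h.ball_zero]
  congr 1
  ext x
  simp

/-- As `relIndex` is zero for an infinite index, this is the finiteness of the residue skewfield; it
follows from `card_pow_ramification`, where the exponent on the left is positive. -/
theorem relIndex_ball_ne_zero [FiniteDimensional F X] : (h.ball 1).relIndex (h.ball 0) ≠ 0 := by
  intro h0
  have := h.card_pow_ramification F hϖ hO
  have hpos := h.ord_uniformizer_pos F hϖ hO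
  rw [h0, zero_pow (by lia)] at this
  exact pow_ne_zero _ Nat.card_pos.ne' this.symm

end IsOrd

end OrdLattice

universe u

/-! ### The residue field -/

section Residue

variable {R : Type*} [CommRing R] {X : Type u} [DivisionRing X] [Algebra R X]
variable {O : Subalgebra R X} {ord : X → ℤ}

open IsLocalRing

namespace IsOrd

/-- The valuation ideal. -/
def valuationIdeal (h : IsOrd O ord) : Ideal O where
  carrier := {x | (x : X) ∈ h.ball 1}
  zero_mem' := (h.ball 1).zero_mem
  add_mem' := fun {x y} hx hy => (h.ball 1).add_mem (x := (x : X)) (y := (y : X)) hx hy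
  smul_mem' := fun c x hx => by
    have := h.mul_mem_ball (h.mem_ball_zero.2 c.2) hx
    rwa [zero_add] at this

theorem mem_valuationIdeal (h : IsOrd O ord) {x : O} :
    x ∈ h.valuationIdeal ↔ (x : X) ∈ h.ball 1 := Iff.rfl

instance (h : IsOrd O ord) : h.valuationIdeal.IsTwoSided where
  mul_mem_of_left := fun {a} b ha => by
    have := h.mul_mem_ball (h.mem_valuationIdeal.1 ha) (h.mem_ball_zero.2 b.2)
    rw [add_zero] at this
    exact this

theorem exists_inv_of_notMem (h : IsOrd O ord) {x : X} (hx : x ∈ O) (hx1 : x ∉ h.ball 1) :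
    x ≠ 0 ∧ ord x = 0 ∧ x⁻¹ ∈ O := by
  have h0 : x ≠ 0 := fun h0 => hx1 (h0 ▸ zero_mem _)
  have h1 := (h.mem_iff h0).1 hx
  rw [h.mem_ball_iff h0] at hx1
  refine ⟨h0, by lia, ?_⟩
  rw [h.mem_iff (inv_ne_zero h0), h.map_inv h0]
  lia

/-- The residue skewfield is finite, hence commutative. -/
theorem exists_residueField (h : IsOrd O ord) (hfin : (h.ball 1).relIndex (h.ball 0) ≠ 0) :
    ∃ (κ : Type u) (_ : Field κ) (_ : Finite κ) (red : O →+* κ), Function.Surjective red ∧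
      (∀ x : O, red x = 0 ↔ (x : X) ∈ h.ball 1) ∧
      Nat.card κ = (h.ball 1).relIndex (h.ball 0) := by
  have hcard : Nat.card (O ⧸ h.valuationIdeal) = (h.ball 1).relIndex (h.ball 0) := by
    let e : O ≃+ h.ball 0 :=
      { toFun := fun x => ⟨x, h.mem_ball_zero.2 x.2⟩
        invFun := fun x => ⟨x, h.mem_ball_zero.1 x.2⟩
        left_inv := fun _ => rfl
        right_inv := fun _ => rfl
        map_add' := fun _ _ => rfl }
    rw [AddSubgroup.relIndex, ← AddSubgroup.index_comap_of_surjective (f := e.toAddMonoidHom) _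
      e.surjective]
    have : AddSubgroup.comap e.toAddMonoidHom ((h.ball 1).addSubgroupOf (h.ball 0)) =
        h.valuationIdeal.toAddSubgroup := by
      ext x
      exact Iff.rfl
    rw [this]
    rfl
  have hfinite : Finite (O ⧸ h.valuationIdeal) := Nat.finite_of_card_ne_zero (hcard ▸ hfin)
  have hmk : ∀ x : O, Ideal.Quotient.mk h.valuationIdeal x = 0 ↔ (x : X) ∈ h.ball 1 := fun x =>
    Ideal.Quotient.eq_zero_iff_mem.trans h.mem_valuationIdeal
  have hnt : Nontrivial (O ⧸ h.valuationIdeal) := by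
    refine ⟨⟨Ideal.Quotient.mk h.valuationIdeal 1, 0, fun h0 => ?_⟩⟩
    have := (hmk 1).1 h0
    rw [OneMemClass.coe_one, h.mem_ball_iff one_ne_zero, h.map_one] at this
    lia
  have hinv : ∀ a : O ⧸ h.valuationIdeal, a ≠ 0 → ∃ b, a * b = 1 := by
    intro a ha
    obtain ⟨x, rfl⟩ := Ideal.Quotient.mk_surjective a
    obtain ⟨h0, -, h1⟩ := h.exists_inv_of_notMem x.2 (fun hx => ha ((hmk x).2 hx))
    refine ⟨Ideal.Quotient.mk _ ⟨(x : X)⁻¹, h1⟩, ?_⟩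
    rw [← _root_.map_mul, ← _root_.map_one (Ideal.Quotient.mk h.valuationIdeal)]
    congr 1
    exact Subtype.ext (mul_inv_cancel₀ h0)
  have hdom : IsDomain (O ⧸ h.valuationIdeal) := by
    have : NoZeroDivisors (O ⧸ h.valuationIdeal) := ⟨fun {a b} hab => by
      by_contra hne
      push Not at hne
      obtain ⟨c, hc⟩ := hinv b hne.2
      exact hne.1 (by rw [← mul_one a, ← hc, ← mul_assoc, hab, zero_mul])⟩
    exact NoZeroDivisors.to_isDomain _
  -- Wedderburn's little theorem supplies the commutativity.
  have hfield := Finite.isDomain_to_isField (O ⧸ h.valuationIdeal)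
  let : Field (O ⧸ h.valuationIdeal) := hfield.toField
  exact ⟨O ⧸ h.valuationIdeal, inferInstance, hfinite, Ideal.Quotient.mk _,
    Ideal.Quotient.mk_surjective, hmk, hcard⟩

end IsOrd

end Residue

/-! ## Dimensions of centralisers -/

section DoubleCentralizer

open scoped TensorProduct

variable {k : Type*} [Field k]

/-- The tensor product of a central skewfield and a field is simple. -/
theorem isSimpleRing_tensorProduct (D B : Type*) [DivisionRing D] [Algebra k D]
    [Algebra.IsCentral k D] [Field B] [Algebra k B] [FiniteDimensional k B] :
    IsSimpleRing (D ⊗[k] B) := by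
  classical
  rw [isSimpleRing_iff_isTwoSided_imp]
  refine ⟨inferInstance, fun I hI => ?_⟩
  by_cases hbot : I = ⊥
  · exact Or.inl hbot
  right
  let β := Module.finBasis k B
  let b := Algebra.TensorProduct.basis D β
  have hbr : ∀ i, b i = 1 ⊗ₜ β i := fun i => Algebra.TensorProduct.basis_apply ..
  have hmul : ∀ (x : D ⊗[k] B) (a : D) i, b.repr (x * (a ⊗ₜ 1)) i = b.repr x i * a := by
    intro x a i
    conv_lhs => rw [← b.sum_repr x]
    rw [Finset.sum_mul, map_sum, Finsupp.finsetSum_apply]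
    have : ∀ j, b.repr x j • b j * (a ⊗ₜ[k] (1 : B)) = (b.repr x j * a) • b j := fun j => by
      rw [hbr, TensorProduct.smul_tmul', TensorProduct.smul_tmul',
        Algebra.TensorProduct.tmul_mul_tmul]
      simp
    simp only [this, map_smul, Finsupp.smul_apply, b.repr_self, smul_eq_mul]
    simp [Finsupp.single_apply]
  have hmul' : ∀ (x : D ⊗[k] B) (a : D) i, b.repr ((a ⊗ₜ 1) * x) i = a * b.repr x i := by
    intro x a i
    have : (a ⊗ₜ[k] (1 : B)) * x = a • x := by
      rw [← one_mul x, ← smul_mul_assoc, one_mul, Algebra.TensorProduct.one_def,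
        TensorProduct.smul_tmul']
      simp
    rw [this, map_smul]
    rfl
  -- a nonzero element of the ideal with the fewest nonzero coordinates
  have hex : ∃ n, ∃ x ∈ I, x ≠ 0 ∧ (b.repr x).support.card = n := by
    obtain ⟨x, hx, hx0⟩ := Submodule.exists_mem_ne_zero_of_ne_bot hbot
    exact ⟨_, x, hx, hx0, rfl⟩
  obtain ⟨x, hxI, hx0, hxn⟩ := Nat.find_spec hex
  have hmin : ∀ y ∈ I, (b.repr y).support.card < (b.repr x).support.card → y = 0 := by
    intro y hy hlt
    by_contra hy0
    exact Nat.find_min hex (hxn ▸ hlt) ⟨y, hy, hy0, rfl⟩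
  obtain ⟨i, hi⟩ : ∃ i, b.repr x i ≠ 0 := by
    by_contra hall
    push Not at hall
    exact hx0 (b.repr.map_eq_zero_iff.1 (Finsupp.ext hall))
  -- With one coordinate equal to `1`, commutators with `D` have fewer nonzero coordinates and
  -- vanish by minimality. So all coordinates are central, `y` comes from a nonzero element of the
  -- field `B`, and it is a unit.
  set y : D ⊗[k] B := ((b.repr x i)⁻¹ ⊗ₜ 1) * x with hy
  have hyI : y ∈ I := I.mul_mem_left _ hxI
  have hyr : ∀ j, b.repr y j = (b.repr x i)⁻¹ * b.repr x j := fun j => hmul' ..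
  have hyi : b.repr y i = 1 := by rw [hyr, inv_mul_cancel₀ hi]
  have hcomm : ∀ a : D, ∀ j, a * b.repr y j = b.repr y j * a := by
    intro a
    have hz : (a ⊗ₜ 1) * y - y * (a ⊗ₜ 1) = 0 := by
      refine hmin _ (I.sub_mem (I.mul_mem_left _ hyI) (I.mul_mem_right _ hyI)) ?_
      apply Finset.card_lt_card
      rw [Finset.ssubset_iff_of_subset]
      · refine ⟨i, by simpa using hi, ?_⟩
        simp only [map_sub, Finsupp.mem_support_iff, Finsupp.sub_apply, hmul, hmul', hyi]
        simp
      · intro j hj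
        simp only [map_sub, Finsupp.mem_support_iff, Finsupp.sub_apply, hmul, hmul', hyr] at hj ⊢
        intro h0
        apply hj
        simp [h0]
    intro j
    have := congrArg (fun z => b.repr z j) hz
    simpa only [map_sub, Finsupp.sub_apply, hmul, hmul', map_zero, Finsupp.zero_apply, sub_eq_zero]
      using this
  have hcent : ∀ j, ∃ c : k, algebraMap k D c = b.repr y j := by
    intro j
    have hm : b.repr y j ∈ Subalgebra.center k D :=
      Subalgebra.mem_center_iff.2 fun a => hcomm a j
    have := Algebra.IsCentral.out (K := k) hm
    exact Algebra.mem_bot.1 this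
  choose c hc using hcent
  have hyB : y = 1 ⊗ₜ (∑ j, c j • β j) := by
    rw [← b.sum_repr y, TensorProduct.tmul_sum]
    refine Finset.sum_congr rfl fun j _ => ?_
    rw [← hc, hbr, TensorProduct.tmul_smul, algebraMap_smul]
  have hB0 : (∑ j, c j • β j) ≠ 0 := by
    intro h0
    rw [h0, TensorProduct.tmul_zero] at hyB
    rw [hyB] at hyi
    simp at hyi
  rw [Ideal.eq_top_iff_one]
  have := I.mul_mem_left (1 ⊗ₜ (∑ j, c j • β j)⁻¹) hyI
  rwa [hyB, Algebra.TensorProduct.tmul_mul_tmul, inv_mul_cancel₀ hB0, mul_one] at this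

/-- The dimension of the endomorphism ring of a module over a simple finite-dimensional algebra. -/
theorem finrank_end_mul_finrank (A V : Type*) [Ring A] [Algebra k A] [IsSimpleRing A]
    [FiniteDimensional k A] [AddCommGroup V] [Module k V] [Module A V] [IsScalarTower k A V]
    [FiniteDimensional k V] [Nontrivial V] :
    Module.finrank k (Module.End A V) * Module.finrank k A = Module.finrank k V ^ 2 := by
  have : IsArtinianRing A := IsArtinianRing.of_finite k A
  have : Module.Finite A V := Module.Finite.of_restrictScalars_finite k A V
  -- With the simple module `S`, one has `V ≅ S ^ t` and `A ≅ S ^ N`. The endomorphism rings are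
  -- matrix rings over `End S` of sizes `t` and `N`, and the second one is opposite to `A`.
  obtain ⟨t, ht, S, hS, ⟨eV⟩⟩ := (IsSimpleRing.isIsotypic A V).linearEquiv_fun
  obtain ⟨I, ⟨eI⟩⟩ := IsSemisimpleRing.exists_linearEquiv_ideal_of_isSimpleModule A S
  have hI : IsSimpleModule A I := IsSimpleModule.congr eI.symm
  obtain ⟨N, ⟨eA⟩⟩ :=
    ((IsSimpleRing.isIsotypic A A I).of_linearEquiv_type eI.symm).linearEquiv_fun
  have : FiniteDimensional k S := FiniteDimensional.of_injective (S.subtype.restrictScalars k)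
    S.subtype_injective
  have hV : Module.finrank k V = t * Module.finrank k S := by
    rw [(eV.restrictScalars k).finrank_eq, Module.finrank_pi_fintype]
    simp
  have hA : Module.finrank k A = N * Module.finrank k S := by
    rw [(eA.restrictScalars k).finrank_eq, Module.finrank_pi_fintype]
    simp
  have hEV : Module.finrank k (Module.End A V) = t * t * Module.finrank k (Module.End A S) := by
    rw [((eV.conjAlgEquiv k).trans (endVecAlgEquivMatrixEnd ..)).toLinearEquiv.finrank_eq,
      Module.finrank_matrix]
    simp
  have hEA : Module.finrank k A = N * N * Module.finrank k (Module.End A S) := by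
    rw [(MulOpposite.opLinearEquiv k (M := A)).finrank_eq,
      ((AlgEquiv.moduleEndSelf k (A := A)).trans
        ((eA.conjAlgEquiv k).trans (endVecAlgEquivMatrixEnd ..))).toLinearEquiv.finrank_eq,
      Module.finrank_matrix]
    simp
  have hN : 0 < N := by
    have : 0 < Module.finrank k A := Module.finrank_pos
    rw [hA] at this
    exact Nat.pos_of_mul_pos_right this
  have hS' : Module.finrank k S = N * Module.finrank k (Module.End A S) := by
    apply Nat.eq_of_mul_eq_mul_left hN
    rw [← hA, hEA, mul_assoc]
  rw [hEV, hA, hV, hS']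
  ring

/-- The endomorphisms which commute with the actions of `D` and `B`. -/
def commutingEnd (k D B V : Type*) [Field k] [Ring D] [Algebra k D] [Ring B] [Algebra k B]
    [AddCommGroup V] [Module k V] [Module D V] [Module B V] [IsScalarTower k D V]
    [IsScalarTower k B V] : Submodule k (Module.End k V) where
  carrier := {g | (∀ (a : D) v, g (a • v) = a • g v) ∧ ∀ (b : B) v, g (b • v) = b • g v}
  zero_mem' := ⟨fun a v => by simp, fun b v => by simp⟩
  add_mem' := fun {x y} hx hy =>
    ⟨fun a v => by rw [LinearMap.add_apply, hx.1, hy.1, LinearMap.add_apply, smul_add],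
      fun b v => by rw [LinearMap.add_apply, hx.2, hy.2, LinearMap.add_apply, smul_add]⟩
  smul_mem' := fun c x hx =>
    ⟨fun a v => by rw [LinearMap.smul_apply, hx.1, LinearMap.smul_apply, smul_comm],
      fun b v => by rw [LinearMap.smul_apply, hx.2, LinearMap.smul_apply, smul_comm]⟩

theorem mem_commutingEnd {D B V : Type*} [Ring D] [Algebra k D] [Ring B] [Algebra k B]
    [AddCommGroup V] [Module k V] [Module D V] [Module B V] [IsScalarTower k D V]
    [IsScalarTower k B V] {g : Module.End k V} : g ∈ commutingEnd k D B V ↔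
      (∀ (a : D) v, g (a • v) = a • g v) ∧ ∀ (b : B) v, g (b • v) = b • g v := Iff.rfl

/-- The double centraliser formula: a skewfield `D` with centre `k` and a field `B` act on `V`. -/
theorem finrank_end_tensorProduct (D B V : Type*) [DivisionRing D] [Algebra k D]
    [Algebra.IsCentral k D] [FiniteDimensional k D] [Field B] [Algebra k B] [FiniteDimensional k B]
    [AddCommGroup V] [Module k V] [Module D V] [Module B V] [IsScalarTower k D V]
    [IsScalarTower k B V] [SMulCommClass D B V] [FiniteDimensional k V] [Nontrivial V] :
    Module.finrank k (commutingEnd k D B V) * (Module.finrank k D * Module.finrank k B) =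
      Module.finrank k V ^ 2 := by
  have := isSimpleRing_tensorProduct (k := k) D B
  let : Module (D ⊗[k] B) V := TensorProduct.Algebra.module
  have hsm : ∀ (a : D) (b : B) (v : V), (a ⊗ₜ[k] b) • v = a • b • v :=
    fun a b v => TensorProduct.Algebra.smul_def a b v
  have : IsScalarTower k (D ⊗[k] B) V := ⟨fun c x v => by
    induction x with
    | zero => simp
    | add x y hx hy => rw [smul_add, add_smul, hx, hy, add_smul, smul_add]
    | tmul a b => rw [TensorProduct.smul_tmul', hsm, hsm, smul_assoc]⟩
  let e : Module.End (D ⊗[k] B) V ≃ₗ[k] commutingEnd k D B V :=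
    { toFun := fun g => ⟨g.restrictScalars k, mem_commutingEnd.2 ⟨fun a v => by
          have := g.map_smul (a ⊗ₜ 1) v
          rwa [hsm, hsm, one_smul, one_smul] at this, fun b v => by
          have := g.map_smul (1 ⊗ₜ b) v
          rwa [hsm, hsm, one_smul, one_smul] at this⟩⟩
      invFun := fun g =>
        { g.1 with
          map_smul' := fun x v => by
            induction x with
            | zero => simp
            | add x y hx hy =>
              rw [add_smul, RingHom.id_apply, add_smul]
              exact (map_add g.1 _ _).trans (congrArg₂ (· + ·) hx hy)
            | tmul a b =>
              obtain ⟨h1, h2⟩ := mem_commutingEnd.1 g.2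
              change g.1 _ = _ • g.1 v
              rw [RingHom.id_apply, hsm, hsm, h1, h2] }
      left_inv := fun _ => rfl
      right_inv := fun _ => rfl
      map_add' := fun _ _ => rfl
      map_smul' := fun _ _ => rfl }
  rw [← Module.finrank_tensorProduct, ← e.finrank_eq]
  exact finrank_end_mul_finrank (D ⊗[k] B) V

/-- The degree of a commutative subfield of a central skewfield is at most the index. -/
theorem finrank_sq_le_of_comm {D : Type*} [DivisionRing D] [Algebra k D]
    [Algebra.IsCentral k D] [FiniteDimensional k D] {B : Type*} [Field B] [Algebra k B]
    (j : B →ₐ[k] D) : Module.finrank k B ^ 2 ≤ Module.finrank k D := by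
  let : Module B D := Module.compHom D j.toRingHom
  have hsm : ∀ (b : B) (x : D), b • x = j b * x := fun _ _ => rfl
  have : IsScalarTower k B D := ⟨fun c b x => by
    rw [hsm, hsm, map_smul, smul_mul_assoc]⟩
  have : SMulCommClass Dᵐᵒᵖ B D := ⟨fun a b x => by
    rw [hsm, hsm, MulOpposite.smul_eq_mul_unop, MulOpposite.smul_eq_mul_unop, mul_assoc]⟩
  have : FiniteDimensional k B := FiniteDimensional.of_injective j.toLinearMap j.injective
  -- `D` is regarded as a right `D`-space with `B` acting from the left. The commuting endomorphisms
  -- have dimension `dim D / dim B` and contain `B`.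
  have key := finrank_end_tensorProduct (k := k) Dᵐᵒᵖ B D
  have hop : Module.finrank k Dᵐᵒᵖ = Module.finrank k D :=
    (MulOpposite.opLinearEquiv k (M := D)).finrank_eq.symm
  let i : B →ₗ[k] commutingEnd k Dᵐᵒᵖ B D :=
    { toFun := fun b => ⟨LinearMap.mulLeft k (j b), fun a v => by simp [mul_assoc],
        fun c v => by
          simp only [hsm, LinearMap.mulLeft_apply, ← mul_assoc, ← map_mul, mul_comm]⟩
      map_add' := fun b c => by ext; simp [add_mul]
      map_smul' := fun b c => by ext; simp }
  have hi : Function.Injective i := fun b c hbc => by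
    have := congrArg (fun g : commutingEnd k Dᵐᵒᵖ B D => g.1 1) hbc
    simp only [i, LinearMap.coe_mk, AddHom.coe_mk, LinearMap.mulLeft_apply, mul_one] at this
    exact j.injective this
  have hle := LinearMap.finrank_le_finrank_of_injective hi
  rw [hop] at key
  have hpos : 0 < Module.finrank k D := Module.finrank_pos
  have h1 : Module.finrank k (commutingEnd k Dᵐᵒᵖ B D) * Module.finrank k B = Module.finrank k D := by
    apply Nat.eq_of_mul_eq_mul_left hpos
    rw [← pow_two, ← key]
    ring
  rw [← h1, pow_two]
  exact Nat.mul_le_mul_right _ hle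

end DoubleCentralizer

/-- A commutative subalgebra of a skewfield is a field. -/
theorem exists_field_range_eq {k : Type*} [Field k] {D : Type u} [DivisionRing D] [Algebra k D]
    [FiniteDimensional k D] (L : Subalgebra k D) (hL : ∀ x ∈ L, ∀ y ∈ L, x * y = y * x) :
    ∃ (B : Type u) (_ : Field B) (_ : Algebra k B) (j : B →ₐ[k] D), j.range = L := by
  let : CommRing L := { (inferInstance : Ring L) with
    mul_comm := fun x y => Subtype.ext (hL x x.2 y y.2) }
  let : Algebra k L := L.algebra
  have hf : IsField L := by
    have : Algebra.IsIntegral k L := Algebra.IsIntegral.of_finite k L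
    exact isField_of_isIntegral_of_isField' (Field.toIsField k)
  let : Field L := hf.toField
  exact ⟨L, inferInstance, L.algebra, L.val, L.range_val⟩

/-! ### Bounds for the residue degree -/

section ResidueDegree

variable {R : Type*} [CommRing R] [IsDomain R] [IsDiscreteValuationRing R]
variable (F : Type*) [Field F] [Algebra R F] [IsFractionRing R F]
variable {X : Type u} [DivisionRing X] [Algebra F X] [Algebra R X] [IsScalarTower R F X]
variable {O : Subalgebra R X} {ord : X → ℤ} {ϖ : R}

open IsLocalRing

namespace IsOrd

variable (h : IsOrd O ord) [Finite (ResidueField R)]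
variable (hϖ : Irreducible ϖ) (hO : (Subalgebra.toSubmodule O).FG) [FiniteDimensional F X]

include F h hϖ hO

/-- The residue degree is at least the dimension of any subspace whose elements have orders in the
value group of the base field. -/
theorem card_pow_le_of_unramified (S : Submodule F X)
    (hS : ∀ x ∈ S, x ≠ 0 → ∃ n : ℤ, ord x = n * ord (algebraMap R X ϖ)) :
    Nat.card (ResidueField R) ^ Module.finrank F S ≤ (h.ball 1).relIndex (h.ball 0) := by
  have h0 : algebraMap R X ϖ ≠ 0 := algebraMap_uniformizer_ne_zero F hϖ
  have hpos := h.ord_uniformizer_pos F hϖ hO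
  set M := (Subalgebra.toSubmodule O ⊓ S.restrictScalars R : Submodule R X) with hM
  have hMO : M.toAddSubgroup ≤ h.ball 0 := fun x hx => h.mem_ball_zero.2 hx.1
  -- Orders in `S` are multiples of the order of `ϖ`, so an element of `M` of positive order is
  -- divisible by `ϖ`. Hence the reduction of `M` modulo `ϖ` embeds into the residue skewfield.
  have key := h.relIndex_smul_inf F hϖ hO S (h.ball 1 ⊓ M.toAddSubgroup) fun x => by
    constructor
    · rintro ⟨hx1, hxO, hxS⟩
      by_cases hx0 : x = 0
      · exact ⟨0, O.zero_mem, S.zero_mem, by simp [hx0]⟩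
      refine ⟨(algebraMap R X ϖ)⁻¹ * x, ?_, ?_, ?_⟩
      · obtain ⟨n, hn⟩ := hS x hxS hx0
        rw [h.mem_iff (mul_ne_zero (inv_ne_zero h0) hx0), h.map_mul (inv_ne_zero h0) hx0,
          h.map_inv h0, hn]
        have h1 : 1 ≤ ord x := (h.mem_ball_iff hx0).1 hx1
        rw [hn] at h1
        have hn : 0 < n := by
          by_contra hneg
          have := mul_nonpos_of_nonpos_of_nonneg (not_lt.1 hneg) hpos.le
          lia
        nlinarith
      · rw [IsScalarTower.algebraMap_apply R F X, ← map_inv₀, ← Algebra.smul_def]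
        exact S.smul_mem _ hxS
      · rw [← mul_assoc, mul_inv_cancel₀ h0, one_mul]
    · rintro ⟨y, hyO, hyS, rfl⟩
      refine ⟨?_, O.mul_mem (O.algebraMap_mem _) hyO, ?_⟩
      · refine (h.mul_mem_ball_iff_left h0).2 ?_
        exact h.ball_anti (by lia) (h.mem_ball_zero.2 hyO)
      · change _ ∈ S
        rw [IsScalarTower.algebraMap_apply R F X, ← Algebra.smul_def]
        exact S.smul_mem _ hyS
  rw [← hM, AddSubgroup.inf_relIndex_right] at key
  rw [← key]
  exact AddSubgroup.relIndex_le_of_le_right hMO (h.relIndex_ball_ne_zero F hϖ hO)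

/-- There is a maximal subfield of `X` with the same residue field. Hence the residue degree over
`F` is bounded by the degree of a maximal subfield, and in the case of equality the centre is
unramified. -/
theorem residue_card_le (k : Type*) [Field k] [Algebra F k] [Algebra k X] [IsScalarTower F k X]
    [Algebra.IsCentral k X] {δ : ℕ} (hδ : Module.finrank k X = δ ^ 2) :
    (h.ball 1).relIndex (h.ball 0) ≤
      Nat.card (ResidueField R) ^ (Module.finrank F k * δ) ∧
    ((h.ball 1).relIndex (h.ball 0) = Nat.card (ResidueField R) ^ (Module.finrank F k * δ) →
      ∀ c : k, c ≠ 0 → ∃ n : ℤ, ord (algebraMap k X c) = n * ord (algebraMap R X ϖ)) := by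
  have h0 : algebraMap R X ϖ ≠ 0 := algebraMap_uniformizer_ne_zero F hϖ
  have hpos := h.ord_uniformizer_pos F hϖ hO
  have hq := Finite.one_lt_card (α := ResidueField R)
  have hfin := h.relIndex_ball_ne_zero F hϖ hO
  have : FiniteDimensional k X := FiniteDimensional.right F k X
  have : FiniteDimensional F k := FiniteDimensional.left F k X
  obtain ⟨κ, _, _, red, hred, hker, hcard⟩ := h.exists_residueField hfin
  obtain ⟨g, hg⟩ := IsCyclic.exists_generator (α := κˣ)
  obtain ⟨x, hx⟩ := hred g
  -- The powers of `x` represent all nonzero residues, so this commutative subalgebra already has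
  -- the full residue field; its degree over `k` is at most `δ`.
  let S := Algebra.adjoin k {(x : X)}
  have hcomm : ∀ a ∈ S, ∀ b ∈ S, a * b = b * a := by
    intro a ha b hb
    exact Algebra.commute_of_mem_adjoin_singleton_of_commute hb
      (Algebra.commute_of_mem_adjoin_singleton_of_commute ha rfl).symm
  obtain ⟨B, _, _, j, hj⟩ := exists_field_range_eq S hcomm
  have hBS : Module.finrank k S ≤ δ := by
    have h1 := finrank_sq_le_of_comm j
    rw [hδ] at h1
    have h2 : Module.finrank k B = Module.finrank k S := by
      rw [← hj]
      exact (AlgEquiv.ofInjective j j.injective).toLinearEquiv.finrank_eq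
    rw [← h2]
    exact (Nat.pow_le_pow_iff_left two_ne_zero).1 h1
  let SF : Submodule F X := (Subalgebra.toSubmodule S).restrictScalars F
  have hSF : Module.finrank F SF = Module.finrank F k * Module.finrank k S :=
    (Module.finrank_mul_finrank F k S).symm
  set M := (Subalgebra.toSubmodule O ⊓ SF.restrictScalars R : Submodule R X) with hM
  have hMO : M.toAddSubgroup ≤ h.ball 0 := fun x hx => h.mem_ball_zero.2 hx.1
  have hfull : (h.ball 1).relIndex M.toAddSubgroup = (h.ball 1).relIndex (h.ball 0) := by
    have : h.ball 1 ⊔ M.toAddSubgroup = h.ball 0 := by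
      apply le_antisymm (sup_le (h.ball_anti (by lia)) hMO)
      intro y hy
      have hyO := h.mem_ball_zero.1 hy
      by_cases hr : red ⟨y, hyO⟩ = 0
      · exact AddSubgroup.mem_sup_left ((hker _).1 hr)
      · obtain ⟨n, hn⟩ := (mem_powers_iff_mem_zpowers).2 (hg (Units.mk0 _ hr))
        have h1 : red (⟨y, hyO⟩ - x ^ n) = 0 := by
          have := congrArg Units.val hn
          simp only [Units.val_pow_eq_pow_val, Units.val_mk0] at this
          rw [map_sub, _root_.map_pow, hx, this, sub_self]
        have h2 := (hker _).1 h1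
        have h3 : y = (y - (x : X) ^ n) + (x : X) ^ n := by abel
        rw [h3]
        refine AddSubgroup.add_mem_sup h2 ⟨O.pow_mem x.2 n, ?_⟩
        exact S.pow_mem (Algebra.subset_adjoin rfl) n
    rw [← this, sup_comm, AddSubgroup.relIndex_sup_right]
  let N : AddSubgroup X := M.toAddSubgroup.map (AddMonoidHom.mulLeft (algebraMap R X ϖ))
  have hN := h.relIndex_smul_inf F hϖ hO SF N fun y => by
    simp [N, M, and_assoc]
  rw [← hM] at hN
  have hNle : N ≤ h.ball 1 ⊓ M.toAddSubgroup := by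
    rintro _ ⟨y, ⟨hyO, hyS⟩, rfl⟩
    refine ⟨?_, O.mul_mem (O.algebraMap_mem _) hyO, ?_⟩
    · refine (h.mul_mem_ball_iff_left h0).2 ?_
      exact h.ball_anti (by lia) (h.mem_ball_zero.2 hyO)
    · change _ ∈ SF
      rw [AddMonoidHom.coe_mulLeft, IsScalarTower.algebraMap_apply R F X, ← Algebra.smul_def]
      exact SF.smul_mem _ hyS
  have hN0 : N.relIndex M.toAddSubgroup ≠ 0 := by
    rw [hN]
    exact pow_ne_zero _ (by lia)
  have hle : (h.ball 1).relIndex (h.ball 0) ≤ Nat.card (ResidueField R) ^ Module.finrank F SF := by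
    rw [← hfull, ← hN]
    exact AddSubgroup.relIndex_le_of_le_left (hNle.trans inf_le_left) hN0
  have hle2 : Module.finrank F SF ≤ Module.finrank F k * δ := by
    rw [hSF]
    exact Nat.mul_le_mul_left _ hBS
  refine ⟨hle.trans (Nat.pow_le_pow_right (by lia) hle2), fun heq c hc => ?_⟩
  -- In the case of equality `ϖ M` and the part of `M` of positive order have the same finite index
  -- in `M`, so they coincide.
  have hind : (N.relIndex (h.ball 1 ⊓ M.toAddSubgroup)) = 1 := by
    have h1 := AddSubgroup.relIndex_mul_relIndex _ _ _ hNle inf_le_right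
    rw [AddSubgroup.inf_relIndex_right, hN, hfull] at h1
    have h2 : Nat.card (ResidueField R) ^ Module.finrank F SF ≤ (h.ball 1).relIndex (h.ball 0) := by
      rw [heq]
      exact Nat.pow_le_pow_right (by lia) hle2
    rw [le_antisymm h2 hle] at h1
    exact (Nat.mul_eq_right hfin).1 h1
  have hsub := AddSubgroup.relIndex_eq_one.1 hind
  -- every integral element of positive order is divisible by the uniformizer of the base
  set e := ord (algebraMap R X ϖ) with he
  set x := algebraMap k X c with hxdef
  have hx0 : x ≠ 0 := by simpa [hxdef] using hc
  refine ⟨ord x / e, ?_⟩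
  -- The order of `y` is the remainder of that of `x` modulo `e`. If it were positive, `y` would be
  -- divisible by `ϖ` and have order at least `e`.
  set y := (algebraMap R X ϖ) ^ (-(ord x / e)) * x with hy
  have hp0 : (algebraMap R X ϖ) ^ (-(ord x / e)) ≠ 0 := zpow_ne_zero _ h0
  have hy0 : y ≠ 0 := mul_ne_zero hp0 hx0
  have hoy : ord y = ord x % e := by
    rw [hy, h.map_mul hp0 hx0, h.map_zpow h0, ← he, Int.emod_def]
    ring
  have hyS : y ∈ SF := by
    rw [hy, IsScalarTower.algebraMap_apply R F X, ← map_zpow₀, ← Algebra.smul_def]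
    exact SF.smul_mem _ (S.algebraMap_mem c)
  have hyM : y ∈ M := ⟨(h.mem_iff hy0).2 (by rw [hoy]; exact Int.emod_nonneg _ hpos.ne'), hyS⟩
  have hlt : ord y < e := by rw [hoy]; exact Int.emod_lt_of_pos _ hpos
  have hmod : ord y = 0 := by
    by_contra hne
    have h1 : 1 ≤ ord y := by
      have := (h.mem_iff hy0).1 hyM.1
      lia
    obtain ⟨z, ⟨hzO, -⟩, hz⟩ := hsub ⟨(h.mem_ball_iff hy0).2 h1, hyM⟩
    rw [AddMonoidHom.coe_mulLeft] at hz
    have hz0 : z ≠ 0 := by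
      rintro rfl
      rw [mul_zero] at hz
      exact hy0 hz.symm
    rw [← hz, h.map_mul h0 hz0, ← he] at hlt
    have := (h.mem_iff hz0).1 hzO
    lia
  rw [hoy] at hmod
  exact (Int.ediv_mul_cancel (Int.dvd_of_emod_eq_zero hmod)).symm

end IsOrd

end ResidueDegree

/-! ## Unramified extensions of a complete discretely valued field -/

section Unramified

variable {R : Type*} [CommRing R] [IsDomain R] [IsDiscreteValuationRing R]
variable {F : Type*} [Field F] [Algebra R F] [IsFractionRing R F]

open IsLocalRing Polynomial

variable (R F) in
/-- `B` is an unramified extension of `F`: it contains a subring `O`, finitely generated as a module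
over the valuation ring of `F`, such that every nonzero element is the product of an element of `F`
and a unit of `O`. -/
def IsUnramifiedExt (B : Type*) [Field B] [Algebra F B] [Algebra R B] : Prop :=
  ∃ O : Subalgebra R B, (Subalgebra.toSubmodule O).FG ∧
    ∀ x : B, x ≠ 0 → ∃ (c : F) (u : B), u ≠ 0 ∧ u ∈ O ∧ u⁻¹ ∈ O ∧ x = c • u

/-- A subfield of a discretely valued skewfield is unramified if its value group is that of `F`. -/
theorem IsOrd.isUnramifiedExt {X : Type*} [DivisionRing X] [Algebra F X] [Algebra R X]
    [IsScalarTower R F X] {O : Subalgebra R X} {ord : X → ℤ} (h : IsOrd O ord) {ϖ : R}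
    (hϖ : Irreducible ϖ) (hO : (Subalgebra.toSubmodule O).FG) {B : Type*} [Field B] [Algebra F B]
    [Algebra R B] [IsScalarTower R F B] (j : B →ₐ[F] X)
    (hj : ∀ b : B, b ≠ 0 → ∃ n : ℤ, ord (j b) = n * ord (algebraMap R X ϖ)) :
    IsUnramifiedExt R F B := by
  have h0 : algebraMap R X ϖ ≠ 0 := algebraMap_uniformizer_ne_zero F hϖ
  refine ⟨O.comap (j.restrictScalars R), ?_, fun x hx => ?_⟩
  · have : Module.Finite R (Subalgebra.toSubmodule O) := Module.Finite.iff_fg.2 hO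
    let i : Subalgebra.toSubmodule (O.comap (j.restrictScalars R)) →ₗ[R] Subalgebra.toSubmodule O :=
      ((j.restrictScalars R).toLinearMap.restrict fun x hx => hx)
    refine Module.Finite.iff_fg.1 (Module.Finite.of_injective i fun x y hxy => ?_)
    exact Subtype.ext (j.injective (congrArg Subtype.val hxy))
  · obtain ⟨n, hn⟩ := hj x hx
    set c : F := algebraMap R F ϖ ^ n with hc
    have hc0 : c ≠ 0 := zpow_ne_zero _ (by simpa using hϖ.ne_zero)
    have hjx : j x ≠ 0 := by simpa using hx
    have hcX : algebraMap F X c = algebraMap R X ϖ ^ n := by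
      rw [hc, map_zpow₀, ← IsScalarTower.algebraMap_apply]
    have hju : j (c⁻¹ • x) = (algebraMap R X ϖ ^ n)⁻¹ * j x := by
      rw [map_smul, Algebra.smul_def, map_inv₀, hcX]
    have hz := zpow_ne_zero n h0
    have hord : ord (j (c⁻¹ • x)) = 0 := by
      rw [hju, h.map_mul (inv_ne_zero hz) hjx, h.map_inv hz, h.map_zpow h0, hn]
      ring
    have hu : c⁻¹ • x ≠ 0 := smul_ne_zero (inv_ne_zero hc0) hx
    have hju0 : j (c⁻¹ • x) ≠ 0 := by simpa using ⟨hc0, hx⟩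
    refine ⟨c, c⁻¹ • x, hu, ?_, ?_, by rw [smul_inv_smul₀ hc0]⟩
    · exact (h.mem_iff hju0).2 hord.ge
    · change j _ ∈ O
      rw [map_inv₀, h.mem_iff (inv_ne_zero hju0), h.map_inv hju0, hord]
      exact le_rfl

/-- Finite modules over a complete local Noetherian ring are complete. -/
theorem isAdicComplete_of_finite {S : Type*} [CommRing S] [IsNoetherianRing S] [IsLocalRing S]
    [IsAdicComplete (maximalIdeal S) S] (M : Type*) [AddCommGroup M] [Module S M]
    [Module.Finite S M] : IsAdicComplete (maximalIdeal S) M := by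
  have hs : Function.Surjective (AdicCompletion.of (maximalIdeal S) M) := by
    intro y
    -- The completion of `M` is covered by the tensor product of `M` with the completion of `S`, and
    -- `S` is already complete.
    obtain ⟨t, rfl⟩ := AdicCompletion.ofTensorProduct_surjective_of_finite (maximalIdeal S) M y
    induction t with
    | zero => exact ⟨0, by simp⟩
    | add a b ha hb =>
      obtain ⟨x, hx⟩ := ha
      obtain ⟨z, hz⟩ := hb
      exact ⟨x + z, by rw [map_add, map_add, hx, hz]⟩
    | tmul r x =>
      obtain ⟨r, rfl⟩ := AdicCompletion.of_surjective (maximalIdeal S) S r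
      refine ⟨r • x, ?_⟩
      rw [AdicCompletion.ofTensorProduct_tmul]
      ext n
      rfl
  have : IsPrecomplete (maximalIdeal S) M := AdicCompletion.of_surjective_iff.1 hs
  exact {}

/-- Teichmüller representatives. -/
theorem exists_isPrimitiveRoot_of_isMaximal {O : Type*} [CommRing O] (I : Ideal O) [I.IsMaximal]
    [IsAdicComplete I O] [Finite (O ⧸ I)] :
    ∃ a : O, IsPrimitiveRoot a (Nat.card (O ⧸ I) - 1) ∧ ∀ x ∉ I, ∃ n : ℕ, x - a ^ n ∈ I := by
  let : Field (O ⧸ I) := Ideal.Quotient.field I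
  set Q := Nat.card (O ⧸ I) with hQ
  have hQ1 : 1 < Q := Finite.one_lt_card
  obtain ⟨g, hg⟩ := IsCyclic.exists_generator (α := (O ⧸ I)ˣ)
  have hgord : orderOf g = Q - 1 := by
    rw [orderOf_eq_card_of_forall_mem_zpowers hg, Nat.card_units]
  have hg1 : (g : O ⧸ I) ^ (Q - 1) = 1 := by
    rw [← Units.val_pow_eq_pow_val, ← hgord, pow_orderOf_eq_one, Units.val_one]
  have hQ0 : ((Q : ℕ) : O ⧸ I) = 0 := by
    have := Fintype.ofFinite (O ⧸ I)
    rw [hQ, Nat.card_eq_fintype_card]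
    exact Nat.cast_card_eq_zero _
  have hQm : ((Q - 1 : ℕ) : O ⧸ I) = -1 := by
    rw [Nat.cast_sub hQ1.le, hQ0]
    simp
  obtain ⟨a₀, ha₀⟩ := Ideal.Quotient.mk_surjective (g : O ⧸ I)
  -- Hensel's lemma applies because `Q - 1` is `-1` in the residue field, so the derivative at a
  -- lift of `g` is a unit modulo `I`.
  obtain ⟨a, ha, haa⟩ := HenselianRing.is_henselian (I := I) (X ^ (Q - 1) - 1 : O[X])
    (monic_X_pow_sub_C 1 (by lia)) a₀ (by
      rw [← Ideal.Quotient.eq_zero_iff_mem]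
      simp [ha₀, hg1]) (by
      rw [derivative_sub, derivative_X_pow, derivative_one, sub_zero, eval_mul, eval_pow, eval_X,
        eval_C, map_mul, map_natCast, hQm, map_pow, ha₀]
      exact isUnit_one.neg.mul (g.isUnit.pow _))
  have ha1 : a ^ (Q - 1) = 1 := by simpa [sub_eq_zero] using ha
  have hag : Ideal.Quotient.mk I a = g := by
    rw [← ha₀]
    exact Ideal.Quotient.eq.2 haa
  refine ⟨a, ⟨ha1, fun l hl => ?_⟩, fun x hx => ?_⟩
  · rw [← hgord]
    apply orderOf_dvd_of_pow_eq_one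
    apply Units.ext
    rw [Units.val_pow_eq_pow_val, ← hag, ← map_pow, hl, map_one, Units.val_one]
  · have hx0 : Ideal.Quotient.mk I x ≠ 0 := fun h => hx (Ideal.Quotient.eq_zero_iff_mem.1 h)
    obtain ⟨n, hn⟩ := mem_powers_iff_mem_zpowers.2 (hg (Units.mk0 _ hx0))
    refine ⟨n, ?_⟩
    rw [← Ideal.Quotient.eq_zero_iff_mem, map_sub, map_pow, hag]
    have := congrArg Units.val hn
    simp only [Units.val_pow_eq_pow_val, Units.val_mk0] at this
    rw [this, sub_self]

variable [Finite (ResidueField R)] [IsAdicComplete (maximalIdeal R) R]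
variable {B : Type*} [Field B] [Algebra F B] [Algebra R B] [IsScalarTower R F B]

/-- An unramified extension is generated by a root of unity of order prime to the residue
characteristic. -/
theorem IsUnramifiedExt.exists_isPrimitiveRoot [FiniteDimensional F B]
    (hB : IsUnramifiedExt R F B) :
    ∃ ζ : B, IsPrimitiveRoot ζ (Nat.card (ResidueField R) ^ Module.finrank F B - 1) ∧
      Algebra.adjoin F {ζ} = ⊤ := by
  obtain ⟨O, hO, hU⟩ := hB
  obtain ⟨ϖ, hϖ⟩ := IsDiscreteValuationRing.exists_irreducible R
  have hfin : Module.Finite R O := Module.Finite.iff_fg.2 hO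
  have : Module.IsTorsionFree R B := Module.IsTorsionFree.trans_faithfulSMul R F B
  set I : Ideal O := (maximalIdeal R).map (algebraMap R O) with hI
  have hcomplete : IsAdicComplete I O :=
    (IsAdicComplete.map_algebraMap_iff _ _).2 (isAdicComplete_of_finite (S := R) O)
  have hmemI : ∀ x : O, x ∈ I ↔ ∃ y, ϖ • y = x := by
    intro x
    rw [hI, hϖ.maximalIdeal_eq, Ideal.map_span, Set.image_singleton, Ideal.mem_span_singleton']
    simp only [Algebra.smul_def, mul_comm]
  have hspan : ∀ x : B, ∃ (c : F) (y : O), x = c • (y : B) := by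
    intro x
    by_cases hx : x = 0
    · exact ⟨0, 0, by simp [hx]⟩
    · obtain ⟨c, u, -, hu, -, h⟩ := hU x hx
      exact ⟨c, ⟨u, hu⟩, h⟩
  have hcardI : Nat.card (O ⧸ I) = Nat.card (ResidueField R) ^ Module.finrank F B := by
    have h1 := relIndex_smul_lattice (F := F) hϖ (Subalgebra.toSubmodule O) hO
      ((AddMonoidHom.range (DistribSMul.toAddMonoidHom O ϖ)).map
        (Subalgebra.toSubmodule O).subtype.toAddMonoidHom) fun x => by
      constructor
      · rintro ⟨_, ⟨y, rfl⟩, rfl⟩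
        exact ⟨y, y.2, rfl⟩
      · rintro ⟨y, hy, rfl⟩
        exact ⟨ϖ • ⟨y, hy⟩, ⟨⟨y, hy⟩, rfl⟩, rfl⟩
    have h2 : Submodule.span F ((Subalgebra.toSubmodule O : Submodule R B) : Set B) = ⊤ := by
      rw [eq_top_iff]
      intro x _
      obtain ⟨c, y, rfl⟩ := hspan x
      exact Submodule.smul_mem _ _ (Submodule.subset_span y.2)
    rw [h2, finrank_top] at h1
    rw [← h1, AddSubgroup.relIndex]
    have h3 : ((AddMonoidHom.range (DistribSMul.toAddMonoidHom O ϖ)).map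
        (Subalgebra.toSubmodule O).subtype.toAddMonoidHom).addSubgroupOf
          (Subalgebra.toSubmodule O).toAddSubgroup = I.toAddSubgroup := by
      ext x
      rw [AddSubgroup.mem_addSubgroupOf]
      constructor
      · rintro ⟨_, ⟨y, rfl⟩, hy⟩
        exact (hmemI x).2 ⟨y, Subtype.ext hy⟩
      · intro hx
        obtain ⟨y, hy⟩ := (hmemI x).1 hx
        exact ⟨ϖ • y, ⟨y, rfl⟩, congrArg Subtype.val hy⟩
    rw [h3]
    rfl
  set Q := Nat.card (ResidueField R) ^ Module.finrank F B with hQ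
  have hQ1 : 1 < Q := Nat.one_lt_pow Module.finrank_pos.ne' Finite.one_lt_card
  have hfiniteI : Finite (O ⧸ I) := Nat.finite_of_card_ne_zero (by lia)
  -- Such an element is `c u` with a unit `u`; then `c` is integral over `R`, hence lies in `R`, and
  -- it is a unit because `ϖ` does not divide it.
  have hunit : ∀ x : O, x ∉ I → IsUnit x := by
    intro x hx
    have hx0 : (x : B) ≠ 0 := fun h => hx (by
      have : x = 0 := Subtype.ext h
      rw [this]
      exact zero_mem _)
    obtain ⟨c, u, hu0, huO, huO', hxu⟩ := hU x hx0
    have hc : algebraMap F B c ∈ O := by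
      have h1 : algebraMap F B c = x * u⁻¹ := by
        rw [hxu, Algebra.smul_def, mul_assoc, mul_inv_cancel₀ hu0, mul_one]
      rw [h1]
      exact O.mul_mem x.2 huO'
    have hcint : IsIntegral R c := by
      have h1 : IsIntegral R (⟨_, hc⟩ : O) := Algebra.IsIntegral.isIntegral _
      have h2 : IsIntegral R (algebraMap F B c) := h1.map O.val
      exact (isIntegral_algebraMap_iff (algebraMap F B).injective).1 h2
    obtain ⟨c, rfl⟩ := IsIntegrallyClosed.isIntegral_iff.1 hcint
    have hxu' : x = c • (⟨u, huO⟩ : O) := Subtype.ext (by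
      rw [hxu, algebraMap_smul]
      rfl)
    have hcu : IsUnit c := by
      by_contra hcn
      have : c ∈ maximalIdeal R := hcn
      rw [hϖ.maximalIdeal_eq, Ideal.mem_span_singleton'] at this
      obtain ⟨a, rfl⟩ := this
      exact hx ((hmemI x).2 ⟨a • ⟨u, huO⟩, by rw [smul_smul, mul_comm ϖ, ← hxu']⟩)
    rw [hxu', Algebra.smul_def]
    refine (hcu.map _).mul (IsUnit.of_mul_eq_one ⟨u⁻¹, huO'⟩ (Subtype.ext ?_))
    exact mul_inv_cancel₀ hu0
  have hmax : I.IsMaximal := by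
    refine Ideal.isMaximal_def.2 ⟨fun htop => ?_, fun J hJ => ?_⟩
    · have : Subsingleton (O ⧸ I) := Ideal.Quotient.subsingleton_iff.2 htop
      rw [Nat.card_of_subsingleton (0 : O ⧸ I)] at hcardI
      lia
    · obtain ⟨x, hxJ, hxI⟩ := SetLike.exists_of_lt hJ
      exact J.eq_top_of_isUnit_mem hxJ (hunit x hxI)
  obtain ⟨a, hprim, hpow⟩ := exists_isPrimitiveRoot_of_isMaximal I
  rw [hcardI] at hprim
  refine ⟨a, hprim.map_of_injective (f := O.val) Subtype.val_injective, ?_⟩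
  -- Nakayama: the powers of `a` represent all nonzero classes modulo `ϖ`, so `O = R[a] + ϖ O`.
  have hN : (⊤ : Submodule R O) ≤ Subalgebra.toSubmodule (Algebra.adjoin R {a}) := by
    refine Submodule.le_of_le_smul_of_le_jacobson_bot (I := maximalIdeal R) Module.Finite.fg_top
      (IsLocalRing.maximalIdeal_le_jacobson _) fun x _ => ?_
    have hsm : ∀ y : O, ϖ • y ∈ maximalIdeal R • (⊤ : Submodule R O) := fun y =>
      Submodule.smul_mem_smul ((mem_maximalIdeal _).2 hϖ.not_isUnit) Submodule.mem_top
    by_cases hx : x ∈ I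
    · obtain ⟨y, rfl⟩ := (hmemI x).1 hx
      exact Submodule.mem_sup_right (hsm y)
    · obtain ⟨n, h1⟩ := hpow x hx
      obtain ⟨y, hy⟩ := (hmemI _).1 h1
      rw [show x = a ^ n + ϖ • y by rw [hy]; abel]
      have hpn : a ^ n ∈ Subalgebra.toSubmodule (Algebra.adjoin R {a}) :=
        (Subalgebra.mem_toSubmodule _).2 (pow_mem (Algebra.subset_adjoin (Set.mem_singleton a)) n)
      exact Submodule.add_mem_sup hpn (hsm y)
  rw [eq_top_iff]
  intro x _
  obtain ⟨c, y, rfl⟩ := hspan x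
  refine Subalgebra.smul_mem _ ?_ c
  have hy : y ∈ Algebra.adjoin R {a} := hN trivial
  have h1 : (y : B) ∈ (Algebra.adjoin R {a}).map O.val := ⟨y, hy, rfl⟩
  rw [AlgHom.map_adjoin, Set.image_singleton] at h1
  have h2 : Algebra.adjoin R {(a : B)} ≤ (Algebra.adjoin F {(a : B)}).restrictScalars R :=
    Algebra.adjoin_le (by
      rw [Subalgebra.coe_restrictScalars]
      exact Algebra.subset_adjoin)
  exact h2 h1

/-- Unramified extensions are determined by their degrees. -/
theorem IsUnramifiedExt.nonempty_algHom [FiniteDimensional F B] (hB : IsUnramifiedExt R F B)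
    {L : Type*} [Field L] [Algebra F L] [Algebra R L] [IsScalarTower R F L] [FiniteDimensional F L]
    (hL : IsUnramifiedExt R F L) (hBL : Module.finrank F B ∣ Module.finrank F L)
    (k : Type*) [Field k] [Algebra F k] [Algebra k B] [Algebra k L] [IsScalarTower F k B] :
    Nonempty (B →ₐ[k] L) := by
  obtain ⟨ζ, hζ, hadj⟩ := hB.exists_isPrimitiveRoot
  obtain ⟨η, hη, -⟩ := hL.exists_isPrimitiveRoot
  have hq : 1 < Nat.card (ResidueField R) := Finite.one_lt_card
  set q := Nat.card (ResidueField R)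
  -- By this divisibility `L` contains a primitive root of unity of the order of `ζ`, so the minimal
  -- polynomial of `ζ` over `k` splits in `L`.
  have hdvd : q ^ Module.finrank F B - 1 ∣ q ^ Module.finrank F L - 1 :=
    Nat.pow_sub_one_dvd_pow_sub_one _ hBL
  obtain ⟨t, ht⟩ := hdvd
  have hLpos : 0 < q ^ Module.finrank F L - 1 :=
    Nat.sub_pos_of_lt (Nat.one_lt_pow Module.finrank_pos.ne' hq)
  have hη' := hη.pow hLpos (ht.trans (mul_comm _ _))
  have hBpos : 0 < q ^ Module.finrank F B - 1 :=
    Nat.sub_pos_of_lt (Nat.one_lt_pow Module.finrank_pos.ne' hq)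
  have hint : IsIntegral k ζ := (IsIntegral.of_finite F ζ).tower_top
  have hadj' : IntermediateField.adjoin k {ζ} = ⊤ := by
    rw [eq_top_iff]
    intro x _
    have hx : x ∈ Algebra.adjoin F {ζ} := hadj ▸ trivial
    have h2 : Algebra.adjoin F {ζ} ≤
        ((IntermediateField.adjoin k {ζ}).toSubalgebra).restrictScalars F :=
      Algebra.adjoin_le (IntermediateField.subset_adjoin k {ζ})
    exact h2 hx
  refine IntermediateField.nonempty_algHom_of_adjoin_splits (S := {ζ}) (fun s hs => ?_) hadj'
  rw [Set.mem_singleton_iff.1 hs]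
  refine ⟨hint, ?_⟩
  have hsplit : ((X ^ (q ^ Module.finrank F B - 1) - 1 : k[X]).map (algebraMap k L)).Splits := by
    rw [Polynomial.map_sub, Polynomial.map_pow, map_X, Polynomial.map_one]
    exact X_pow_sub_one_splits hη'
  refine hsplit.of_dvd ?_ (Polynomial.map_dvd _ (minpoly.dvd k ζ (by simp [hζ.pow_eq_one])))
  rw [Polynomial.map_ne_zero_iff (algebraMap k L).injective]
  exact X_pow_sub_C_ne_zero hBpos 1

end Unramified

/-! ## Matrix rings acting on vector spaces -/

section MatrixAction

open MulOpposite Matrix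

variable {F : Type*} [Field F] {D : Type*} [DivisionRing D] [Algebra F D]
variable {V : Type*} [AddCommGroup V] [Module Dᵐᵒᵖ V] [Module F V] [IsScalarTower F Dᵐᵒᵖ V]
variable {Δ : Type*} [DivisionRing Δ] [Algebra F Δ]
variable {I : Type*} [Fintype I] [DecidableEq I]
variable (ρ : Matrix I I Δ →ₐ[F] Module.End Dᵐᵒᵖ V)

theorem map_single_apply_single (p q r : I) (x y : Δ) (v : V) :
    ρ (single p q x) (ρ (single q r y) v) = ρ (single p r (x * y)) v := by
  rw [← Module.End.mul_apply, ← map_mul, single_mul_single_same]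

theorem sum_map_single (v : V) : ∑ p, ρ (single p p 1) v = v := by
  rw [← LinearMap.sum_apply, ← map_sum]
  have : ∑ p : I, single p p (1 : Δ) = 1 := by
    ext i j
    simp only [Matrix.sum_apply, single_apply, one_apply]
    by_cases h : i = j
    · subst h
      simp
    · rw [if_neg h]
      refine Finset.sum_eq_zero fun x _ => if_neg ?_
      rintro ⟨rfl, rfl⟩
      exact h rfl
  rw [this, map_one, Module.End.one_apply]

/-- The decomposition of a module over a matrix ring into copies of the image of an idempotent. -/
noncomputable def matrixActionEquiv (p₀ : I) :
    V ≃ₗ[Dᵐᵒᵖ] (I → LinearMap.range (ρ (single p₀ p₀ 1))) where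
  toFun v p := ⟨ρ (single p₀ p 1) v, ρ (single p₀ p 1) v, by
    rw [map_single_apply_single, one_mul]⟩
  map_add' v w := by ext p; simp
  map_smul' a v := by ext p; simp
  invFun y := ∑ p, ρ (single p p₀ 1) (y p)
  left_inv v := by
    simp only [map_single_apply_single, one_mul]
    exact sum_map_single ρ v
  right_inv y := by
    ext p
    simp only [map_sum]
    rw [Finset.sum_eq_single p]
    · obtain ⟨v, hv⟩ := (y p).2
      rw [map_single_apply_single, one_mul, ← hv, map_single_apply_single, one_mul]
    · intro q _ hq
      rw [← Module.End.mul_apply, ← map_mul, single_mul_single_of_ne _ _ _ _ (Ne.symm hq), map_zero,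
        LinearMap.zero_apply]
    · simp

theorem finrank_eq_card_mul (p₀ : I) [FiniteDimensional Dᵐᵒᵖ V] :
    Module.finrank Dᵐᵒᵖ V =
      Fintype.card I * Module.finrank Dᵐᵒᵖ (LinearMap.range (ρ (single p₀ p₀ 1))) := by
  rw [(matrixActionEquiv ρ p₀).finrank_eq, Module.finrank_pi_fintype]
  simp

/-- An action of a matrix ring of full size is given, in some basis, by a homomorphism of the
coefficient rings. -/
theorem exists_basis_of_card_eq [FiniteDimensional Dᵐᵒᵖ V] [Nonempty I]
    (hcard : Module.finrank Dᵐᵒᵖ V = Fintype.card I) :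
    ∃ (w : Module.Basis I Dᵐᵒᵖ V) (θ : Δ →ₐ[F] D),
      ∀ N q, ρ N (w q) = ∑ p, op (θ (N p q)) • w p := by
  obtain ⟨p₀⟩ := ‹Nonempty I›
  set U := LinearMap.range (ρ (single p₀ p₀ 1)) with hU
  -- `V` consists of one copy of `U` for every index, so equality of sizes makes `U` a line. The
  -- entries of the corner act on a generator `u` through `θ`, and `u` is moved by matrix units to
  -- give the basis.
  have hU1 : Module.finrank Dᵐᵒᵖ U = 1 := by
    have h1 := finrank_eq_card_mul ρ p₀
    rw [hcard] at h1
    exact (Nat.mul_eq_left (Fintype.card_pos_iff.2 ⟨p₀⟩).ne').1 h1.symm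
  obtain ⟨u, hu0, hu⟩ := finrank_eq_one_iff'.1 hU1
  have hu0' : (u : V) ≠ 0 := fun h => hu0 (Subtype.ext h)
  have hex : ∀ x : Δ, ∃ y : D, ρ (single p₀ p₀ x) u = op y • (u : V) := fun x => by
    obtain ⟨c, hc⟩ := hu ⟨ρ (single p₀ p₀ x) u, ρ (single p₀ p₀ x) u, by
      rw [map_single_apply_single, one_mul]⟩
    exact ⟨unop c, (congrArg Subtype.val hc).symm⟩
  choose θ hθ using hex
  have hinj : ∀ {a b : D}, op a • (u : V) = op b • (u : V) → a = b := fun {a b} h =>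
    op_injective (smul_left_injective _ hu0' h)
  have hεu : ρ (single p₀ p₀ 1) (u : V) = u := by
    obtain ⟨v, hv⟩ := u.2
    rw [← hv, map_single_apply_single, one_mul]
  have hFsmul : ∀ (c : F) (v : V), c • v = op (algebraMap F D c) • v := fun c v => by
    rw [← algebraMap_smul Dᵐᵒᵖ c v]
    rfl
  let Θ : Δ →ₐ[F] D :=
    { toFun := θ
      map_one' := hinj (by rw [← hθ, hεu, op_one, one_smul])
      map_mul' := fun x y => hinj (by
        rw [← hθ, ← map_single_apply_single ρ p₀ p₀ p₀ x y, hθ y, map_smul, hθ x, smul_smul,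
          ← op_mul])
      map_zero' := hinj (by rw [← hθ, single_zero, map_zero]; simp)
      map_add' := fun x y => hinj (by
        rw [← hθ, single_add, map_add, LinearMap.add_apply, hθ, hθ, op_add, add_smul])
      commutes' := fun c => hinj (by
        rw [← hθ]
        have : single p₀ p₀ (algebraMap F Δ c) = c • single p₀ p₀ (1 : Δ) := by
          rw [smul_single, Algebra.algebraMap_eq_smul_one]
        rw [this, map_smul, LinearMap.smul_apply, hεu, hFsmul]) }
  let eu : Dᵐᵒᵖ ≃ₗ[Dᵐᵒᵖ] U := LinearEquiv.ofBijective (LinearMap.toSpanSingleton Dᵐᵒᵖ U u)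
    ⟨fun a b h => smul_left_injective _ hu0 h, fun y => hu y⟩
  let e : V ≃ₗ[Dᵐᵒᵖ] (I → Dᵐᵒᵖ) :=
    (matrixActionEquiv ρ p₀).trans (LinearEquiv.piCongrRight fun _ => eu.symm)
  let w : Module.Basis I Dᵐᵒᵖ V := Module.Basis.ofEquivFun e
  have hw : ∀ p, w p = ρ (single p p₀ 1) u := by
    intro p
    have h1 : e (ρ (single p p₀ 1) u) = Pi.single p 1 := by
      have h2 : ∀ q, (matrixActionEquiv ρ p₀) (ρ (single p p₀ 1) u) q =
          if q = p then u else 0 := fun q => by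
        apply Subtype.ext
        change ρ (single p₀ q 1) (ρ (single p p₀ 1) u) = _
        by_cases hq : q = p
        · subst hq
          rw [map_single_apply_single, one_mul, hεu, if_pos rfl]
        · rw [← Module.End.mul_apply, ← map_mul, single_mul_single_of_ne _ _ _ _ hq, map_zero,
            if_neg hq]
          rfl
      ext q
      simp only [e, LinearEquiv.trans_apply, LinearEquiv.piCongrRight_apply, h2]
      by_cases hq : q = p
      · subst hq
        rw [if_pos rfl, Pi.single_eq_same]
        rw [LinearEquiv.symm_apply_eq]
        exact (one_smul Dᵐᵒᵖ u).symm
      · rw [if_neg hq, Pi.single_eq_of_ne hq, map_zero]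
    rw [Module.Basis.coe_ofEquivFun]
    exact (LinearEquiv.symm_apply_eq e).2 h1.symm
  refine ⟨w, Θ, fun N q => ?_⟩
  have h3 : N * single q p₀ 1 = ∑ p, single p p₀ (N p q) := by
    ext i j
    rw [Matrix.sum_apply]
    by_cases hj : p₀ = j
    · subst hj
      simp [single_apply]
    · simp [hj, mul_single_apply_of_ne (hbj := Ne.symm hj)]
  rw [hw, ← Module.End.mul_apply, ← map_mul, h3, map_sum, LinearMap.sum_apply]
  refine Finset.sum_congr rfl fun p _ => ?_
  rw [hw, ← map_smul]
  change _ = ρ (single p p₀ 1) (op (θ (N p q)) • (u : V))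
  rw [← hθ, map_single_apply_single, one_mul]

/-- If a matrix ring over a skewfield is the full endomorphism ring, its size is the dimension. -/
theorem finrank_eq_card_of_surjective [FiniteDimensional Dᵐᵒᵖ V] [Nontrivial V] [Nonempty I]
    (hρ : Function.Bijective ρ) : Module.finrank Dᵐᵒᵖ V = Fintype.card I := by
  obtain ⟨p₀⟩ := ‹Nonempty I›
  set ε := ρ (single p₀ p₀ 1) with hε
  have hεε : ∀ v, ε (ε v) = ε v := fun v => by rw [hε, map_single_apply_single, one_mul]
  have hUpos : LinearMap.range ε ≠ ⊥ := by
    intro h0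
    have h1 := finrank_eq_card_mul ρ p₀
    rw [← hε, h0, finrank_bot, mul_zero] at h1
    exact (Module.finrank_pos (R := Dᵐᵒᵖ) (M := V)).ne' h1
  obtain ⟨u, hu, hu0⟩ := Submodule.exists_mem_ne_zero_of_ne_bot hUpos
  have hεu : ε u = u := by
    obtain ⟨v, rfl⟩ := hu
    exact hεε v
  obtain ⟨f, hf⟩ : ∃ f : V →ₗ[Dᵐᵒᵖ] Dᵐᵒᵖ, f u = 1 := by
    obtain ⟨g, hg⟩ := LinearMap.exists_leftInverse_of_injective
      (LinearMap.toSpanSingleton Dᵐᵒᵖ V u)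
      (LinearMap.ker_eq_bot.2 fun a b h => smul_left_injective _ hu0 h)
    exact ⟨g, by simpa using LinearMap.congr_fun hg 1⟩
  -- An idempotent of rank one in the corner `ε End(V) ε`. This corner is a copy of the skewfield
  -- `Δ`, whose only nonzero idempotent is `1`, so `a = ε` and `ε` has rank one.
  let a : Module.End Dᵐᵒᵖ V := (LinearMap.toSpanSingleton Dᵐᵒᵖ V u).comp (f.comp ε)
  have ha : ∀ v, a v = f (ε v) • u := fun v => rfl
  obtain ⟨N, hN⟩ := hρ.2 a
  have hεa : ε * a * ε = a := by
    ext v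
    simp only [Module.End.mul_apply, ha, map_smul, hεu, hεε]
  have haa : a * a = a := by
    ext v
    simp only [Module.End.mul_apply, ha, map_smul, hεu, hf, smul_eq_mul, mul_one]
  have hNs : N = single p₀ p₀ (N p₀ p₀) := by
    apply hρ.1
    rw [hN, ← hεa, hε, ← hN, ← map_mul, ← map_mul]
    congr 1
    rw [single_mul_mul_single, one_mul, mul_one]
  have hNN : N * N = N := hρ.1 (by rw [map_mul, hN, haa])
  have hy : N p₀ p₀ * N p₀ p₀ = N p₀ p₀ := by
    rw [hNs, single_mul_single_same] at hNN
    simpa using congrFun (congrFun hNN p₀) p₀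
  have hy0 : N p₀ p₀ ≠ 0 := by
    intro h0
    rw [h0, single_zero] at hNs
    rw [hNs, map_zero] at hN
    have := ha u
    rw [← hN, hεu, hf, one_smul, LinearMap.zero_apply] at this
    exact hu0 this.symm
  have hy1 : N p₀ p₀ = 1 := mul_left_cancel₀ hy0 (by rw [hy, mul_one])
  have hεa' : ε = a := by rw [hε, ← hN, hNs, hy1]
  have hU1 : Module.finrank Dᵐᵒᵖ (LinearMap.range ε) = 1 := by
    have : LinearMap.range ε = Submodule.span Dᵐᵒᵖ {u} := by
      apply le_antisymm
      · rintro _ ⟨v, rfl⟩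
        rw [hεa', ha]
        exact Submodule.smul_mem _ _ (Submodule.mem_span_singleton_self u)
      · rw [Submodule.span_singleton_le_iff_mem]
        exact hu
    rw [this, finrank_span_singleton hu0]
  rw [finrank_eq_card_mul ρ p₀, ← hε, hU1, mul_one]

end MatrixAction

/-! ## Lattices with an adapted basis -/

section AdaptedLattice

open MulOpposite Matrix IsLocalRing

variable {R : Type*} [CommRing R] {D : Type*} [DivisionRing D] [Algebra R D]
variable {O : Subalgebra R D} {ord : D → ℤ} (h : IsOrd O ord)
variable {V : Type*} [AddCommGroup V] [Module Dᵐᵒᵖ V]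
variable {I : Type*}

namespace IsOrd

/-- The lattice of the vectors whose `p`-th coordinate has order at least `c p`. -/
def lattice (w : Module.Basis I Dᵐᵒᵖ V) (c : I → ℤ) : AddSubgroup V where
  carrier := {v | ∀ p, unop (w.repr v p) ∈ h.ball (c p)}
  zero_mem' p := by simp [zero_mem]
  add_mem' := fun {u v} hu hv p => by
    rw [map_add, Finsupp.add_apply, unop_add]
    exact add_mem (hu p) (hv p)
  neg_mem' := fun {u} hu p => by
    rw [map_neg, Finsupp.neg_apply, unop_neg]
    exact neg_mem (hu p)

theorem mem_lattice {w : Module.Basis I Dᵐᵒᵖ V} {c : I → ℤ} {v : V} :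
    v ∈ h.lattice w c ↔ ∀ p, unop (w.repr v p) ∈ h.ball (c p) := Iff.rfl

theorem smul_mem_lattice {w : Module.Basis I Dᵐᵒᵖ V} {c : I → ℤ} {v : V} {x : D} {n : ℤ}
    (hv : v ∈ h.lattice w c) (hx : x ∈ h.ball n) :
    op x • v ∈ h.lattice w (fun p => c p + n) := fun p => by
  rw [map_smul, Finsupp.smul_apply, smul_eq_mul, unop_mul, unop_op]
  exact h.mul_mem_ball (hv p) hx

theorem smul_mem_lattice_of_mem {w : Module.Basis I Dᵐᵒᵖ V} {c : I → ℤ} {v : V} {x : D}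
    (hv : v ∈ h.lattice w c) (hx : x ∈ O) : op x • v ∈ h.lattice w c := by
  simpa using h.smul_mem_lattice hv (h.mem_ball_zero.2 hx)

theorem smul_basis_mem_lattice [DecidableEq I] {w : Module.Basis I Dᵐᵒᵖ V} {c : I → ℤ} {x : D}
    {p : I} : op x • w p ∈ h.lattice w c ↔ x ∈ h.ball (c p) := by
  rw [mem_lattice]
  constructor
  · intro hx
    simpa using hx p
  · intro hx q
    rw [map_smul, w.repr_self, Finsupp.smul_single, smul_eq_mul, mul_one, Finsupp.single_apply]
    split_ifs with hpq
    · subst hpq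
      exact hx
    · simp [zero_mem]

/-- The endomorphisms which preserve a lattice, in terms of their matrices. -/
theorem map_lattice_le_iff [Fintype I] [DecidableEq I] {w : Module.Basis I Dᵐᵒᵖ V} {c : I → ℤ}
    {a : Module.End Dᵐᵒᵖ V} {m : I → I → D} (ha : ∀ q, a (w q) = ∑ p, op (m p q) • w p) :
    (∀ v ∈ h.lattice w c, a v ∈ h.lattice w c) ↔ ∀ p q, m p q ∈ h.ball (c p - c q) := by
  have hrepr : ∀ v p, w.repr (a v) p = ∑ q, w.repr v q * op (m p q) := by
    intro v p
    conv_lhs => rw [← w.sum_repr v]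
    simp only [map_sum, map_smul, ha, Finsupp.finsetSum_apply, Finsupp.smul_apply, w.repr_self,
      smul_eq_mul]
    refine Finset.sum_congr rfl fun q _ => ?_
    simp [Finsupp.single_apply]
  constructor
  · intro H p q
    obtain ⟨π, hπ, hπ1⟩ := h.exists_uniformizer
    have hπc : π ^ c q ≠ 0 := zpow_ne_zero _ hπ
    have ho : ord (π ^ c q) = c q := by rw [h.map_zpow hπ, hπ1, mul_one]
    have h1 : op (π ^ c q) • w q ∈ h.lattice w c := by
      rw [h.smul_basis_mem_lattice, h.mem_ball_iff hπc, ho]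
    have h2 := H _ h1 p
    rw [hrepr, Finset.sum_eq_single q] at h2
    · simp only [map_smul, w.repr_self, Finsupp.smul_single, smul_eq_mul, mul_one,
        Finsupp.single_eq_same, unop_mul, unop_op] at h2
      rwa [h.mul_mem_ball_iff_right hπc, ho] at h2
    · intro r _ hr
      simp [hr.symm]
    · simp
  · intro H v hv p
    rw [hrepr, ← opAddEquiv_symm_apply, map_sum]
    refine sum_mem fun q _ => ?_
    have := h.mul_mem_ball (H p q) (hv q)
    rw [sub_add_cancel] at this
    simpa using this

/-- The orders in `J` are bounded below, and an element of least order generates `J` as a right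
ideal. -/
theorem exists_eq_ball {J : AddSubgroup D} (hJ : ∀ x ∈ J, ∀ y ∈ O, x * y ∈ J) (hne : J ≠ ⊥) {n : ℤ}
    (hle : J ≤ h.ball n) : ∃ c, J = h.ball c := by
  obtain ⟨⟨x, hx⟩, hxne⟩ := AddSubgroup.ne_bot_iff_exists_ne_zero.1 hne
  have hx0 : x ≠ 0 := fun h0 => hxne (Subtype.ext h0)
  have hbdd : ∃ b : ℤ, ∀ z : ℤ, (∃ y ∈ J, y ≠ 0 ∧ ord y = z) → b ≤ z := by
    refine ⟨n, ?_⟩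
    rintro _ ⟨y, hy, hy0, rfl⟩
    exact (h.mem_ball_iff hy0).1 (hle hy)
  obtain ⟨c, ⟨y, hy, hy0, hyc⟩, hmin⟩ :=
    Int.exists_least_of_bdd hbdd ⟨ord x, x, hx, hx0, rfl⟩
  refine ⟨c, le_antisymm (fun z hz => ?_) fun z hz => ?_⟩
  · by_cases hz0 : z = 0
    · rw [hz0]
      exact zero_mem _
    · exact (h.mem_ball_iff hz0).2 (hmin _ ⟨z, hz, hz0, rfl⟩)
  · have h1 : z = y * (y⁻¹ * z) := by rw [← mul_assoc, mul_inv_cancel₀ hy0, one_mul]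
    rw [h1]
    refine hJ y hy _ (h.mem_ball_zero.1 ?_)
    rw [h.mul_mem_ball_iff_left (inv_ne_zero hy0), h.map_inv hy0, hyc]
    simpa using hz

/-- A lattice which is stable under the projections to the lines spanned by the vectors of a
basis has this basis as an adapted basis. -/
theorem exists_lattice_eq [Fintype I] [DecidableEq I] {I' : Type*} [Fintype I'] [DecidableEq I']
    (w : Module.Basis I Dᵐᵒᵖ V) (v : Module.Basis I' Dᵐᵒᵖ V)
    (hw : ∀ x ∈ h.lattice v 0, ∀ p, w.repr x p • w p ∈ h.lattice v 0) :
    ∃ c : I → ℤ, h.lattice v 0 = h.lattice w c := by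
  obtain ⟨π, hπ, hπ1⟩ := h.exists_uniformizer
  -- The coefficients which bring `w p` into the lattice form a nonzero bounded right `O`-module,
  -- hence a ball.
  have hex : ∀ p, ∃ c, ∀ x, op x • w p ∈ h.lattice v 0 ↔ x ∈ h.ball c := by
    intro p
    let J : AddSubgroup D :=
      { carrier := {x | op x • w p ∈ h.lattice v 0}
        zero_mem' := by simp [zero_mem]
        add_mem' := fun {x y} hx hy => by
          change op (x + y) • w p ∈ h.lattice v 0
          rw [op_add, add_smul]
          exact add_mem hx hy
        neg_mem' := fun {x} hx => by
          change op (-x) • w p ∈ h.lattice v 0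
          rw [op_neg, neg_smul]
          exact neg_mem hx }
    have hJmem : ∀ x, x ∈ J ↔ op x • w p ∈ h.lattice v 0 := fun _ => Iff.rfl
    have hJ : ∀ x ∈ J, ∀ y ∈ O, x * y ∈ J := fun x hx y hy => by
      rw [hJmem, op_mul, mul_smul]
      exact h.smul_mem_lattice_of_mem hx hy
    have hrepr : ∀ x q, unop (v.repr (op x • w p) q) = unop (v.repr (w p) q) * x := by
      intro x q
      rw [map_smul, Finsupp.smul_apply, smul_eq_mul, unop_mul, unop_op]
    obtain ⟨q, hq⟩ : ∃ q, unop (v.repr (w p) q) ≠ 0 := by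
      by_contra hall
      push Not at hall
      refine w.ne_zero p (v.repr.map_eq_zero_iff.1 (Finsupp.ext fun q => ?_))
      exact unop_injective (hall q)
    have hle : J ≤ h.ball (-ord (unop (v.repr (w p) q))) := fun x hx => by
      have := hx q
      rw [hrepr, h.mul_mem_ball_iff_left hq] at this
      simpa using this
    have hne : J ≠ ⊥ := by
      -- A power of `π` large enough to make all coordinates of `w p` integral at once.
      let n : ℤ := ∑ q, |ord (unop (v.repr (w p) q))|
      have hmem : π ^ n ∈ J := fun q => by
        rw [hrepr]
        by_cases h0 : unop (v.repr (w p) q) = 0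
        · rw [h0, zero_mul]
          exact zero_mem _
        · rw [h.mul_mem_ball_iff_left h0, h.mem_ball_iff (zpow_ne_zero _ hπ), h.map_zpow hπ, hπ1]
          have h1 : |ord (unop (v.repr (w p) q))| ≤ n :=
            Finset.single_le_sum (f := fun q => |ord (unop (v.repr (w p) q))|)
              (fun _ _ => abs_nonneg _) (Finset.mem_univ q)
          have h2 := neg_abs_le (ord (unop (v.repr (w p) q)))
          simp only [Pi.zero_apply]
          lia
      intro h0
      rw [h0, AddSubgroup.mem_bot] at hmem
      exact zpow_ne_zero _ hπ hmem
    obtain ⟨c, hc⟩ := h.exists_eq_ball hJ hne hle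
    exact ⟨c, fun x => by rw [← hJmem, hc]⟩
  choose c hc using hex
  refine ⟨c, ?_⟩
  ext x
  constructor
  · intro hx p
    rw [← hc p, op_unop]
    exact hw x hx p
  · intro hx
    rw [← w.sum_repr x]
    refine sum_mem fun p _ => ?_
    rw [← op_unop (w.repr x p), hc]
    exact hx p

end IsOrd

end AdaptedLattice

/-! ## Chains of lattices -/

section Chain

open MulOpposite Matrix IsLocalRing

/-- The index of two lattices is at least the size of a residue field whose ring of integers acts
on them. -/
theorem IsOrd.le_relIndex {R : Type*} [CommRing R] {X : Type*} [DivisionRing X] [Algebra R X]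
    {O : Subalgebra R X} {ord : X → ℤ} (h : IsOrd O ord) {V : Type*} [AddCommGroup V] (f : X →+ V)
    {H K : AddSubgroup V} (hK : ∀ x ∈ O, f x ∈ K) (hH : ∀ x ∈ O, ord x = 0 → x ≠ 0 → f x ∉ H)
    (hHK : H.relIndex K ≠ 0) : (h.ball 1).relIndex (h.ball 0) ≤ H.relIndex K := by
  have h1 : (h.ball 0).map f ≤ K := by
    rintro _ ⟨x, hx, rfl⟩
    exact hK x (h.mem_ball_zero.1 hx)
  have h2 : H.relIndex ((h.ball 0).map f) ≤ H.relIndex K :=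
    AddSubgroup.relIndex_le_of_le_right h1 hHK
  have h3 : H.relIndex ((h.ball 0).map f) ≠ 0 := fun h0 =>
    hHK (AddSubgroup.relIndex_eq_zero_of_le_right h1 h0)
  rw [← AddSubgroup.relIndex_comap, ← AddSubgroup.inf_relIndex_right] at h2 h3
  refine le_trans (AddSubgroup.relIndex_le_of_le_left ?_ h3) h2
  rintro x ⟨hxH, hx0⟩
  by_contra hx1
  obtain ⟨hne, hord, -⟩ := h.exists_inv_of_notMem (h.mem_ball_zero.1 hx0) hx1
  exact hH x (h.mem_ball_zero.1 hx0) hord hne hxH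

theorem AddSubgroup.relIndex_ne_zero_of_le {G : Type*} [AddGroup G] {A B C D : AddSubgroup G}
    (hAB : A ≤ B) (hBC : B ≤ C) (hCD : C ≤ D) (h : A.relIndex D ≠ 0) : B.relIndex C ≠ 0 := by
  rw [← AddSubgroup.relIndex_mul_relIndex A B D hAB (hBC.trans hCD),
    ← AddSubgroup.relIndex_mul_relIndex B C D hBC hCD] at h
  exact left_ne_zero_of_mul (right_ne_zero_of_mul h)

variable {R : Type*} [CommRing R] [IsDomain R] [IsDiscreteValuationRing R]
variable {F : Type*} [Field F] [Algebra R F] [IsFractionRing R F]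
variable {D : Type*} [DivisionRing D] [Algebra F D] [Algebra R D] [IsScalarTower R F D]
variable {O : Subalgebra R D} {ord : D → ℤ} (hD : IsOrd O ord)
variable {V : Type*} [AddCommGroup V] [Module Dᵐᵒᵖ V] [Module F V] [IsScalarTower F Dᵐᵒᵖ V]
variable [Module R V] [IsScalarTower R F V]

omit [IsDomain R] [IsDiscreteValuationRing R] [IsFractionRing R F] in
include F in
theorem smul_eq_op_algebraMap_smul (r : R) (v : V) : r • v = op (algebraMap R D r) • v := by
  rw [← algebraMap_smul F r v, ← algebraMap_smul Dᵐᵒᵖ, IsScalarTower.algebraMap_apply R F D]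
  rfl

/-- The lattice with adapted basis `v` is finitely generated and of full rank. -/
theorem IsOrd.exists_submodule_eq_lattice [Finite (ResidueField R)] {ϖ : R} (hϖ : Irreducible ϖ)
    (hO : (Subalgebra.toSubmodule O).FG) {I' : Type*} [Fintype I'] [DecidableEq I']
    (v : Module.Basis I' Dᵐᵒᵖ V) :
    ∃ M : Submodule R V, M.FG ∧ M.toAddSubgroup = hD.lattice v 0 ∧
      Submodule.span F (M : Set V) = ⊤ := by
  have : Module.Finite R O := Module.Finite.iff_fg.2 hO
  let g : (I' → O) →ₗ[R] V :=
    { toFun := fun y => ∑ p, op (y p : D) • v p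
      map_add' := fun y z => by simp [add_smul, Finset.sum_add_distrib]
      map_smul' := fun r y => by
        rw [RingHom.id_apply, Finset.smul_sum]
        refine Finset.sum_congr rfl fun p _ => ?_
        rw [smul_eq_op_algebraMap_smul (F := F) (D := D) r (op (y p : D) • v p), smul_smul,
          ← op_mul, ← Algebra.commutes, ← Algebra.smul_def]
        rfl }
  have hg : ∀ y p, v.repr (g y) p = op (y p : D) := fun y p => by
    change v.repr (∑ p, op (y p : D) • v p) p = _
    simp [Finsupp.single_apply]
  have hmem : ∀ x, x ∈ LinearMap.range g ↔ x ∈ hD.lattice v 0 := by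
    intro x
    constructor
    · rintro ⟨y, rfl⟩ p
      rw [hg, unop_op, Pi.zero_apply, hD.mem_ball_zero]
      exact (y p).2
    · intro hx
      refine ⟨fun p => ⟨unop (v.repr x p), hD.mem_ball_zero.1 (hx p)⟩, ?_⟩
      conv_rhs => rw [← v.sum_repr x]
      rfl
  refine ⟨LinearMap.range g, ?_, ?_, ?_⟩
  · exact Module.Finite.iff_fg.1 inferInstance
  · ext x
    exact hmem x
  · rw [eq_top_iff]
    intro x _
    rw [← v.sum_repr x]
    refine Submodule.sum_mem _ fun p _ => ?_
    let t : D →ₗ[F] V :=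
      { toFun := fun y => op y • v p
        map_add' := fun y z => by rw [op_add, add_smul]
        map_smul' := fun c y => by
          rw [RingHom.id_apply, op_smul, smul_assoc] }
    have h1 : unop (v.repr x p) ∈ Submodule.span F
        ((Subalgebra.toSubmodule O ⊓ (⊤ : Submodule F D).restrictScalars R : Submodule R D) :
          Set D) := by
      rw [hD.span_inf_eq F hϖ hO]
      trivial
    have h2 := Submodule.mem_map_of_mem (f := t) h1
    rw [Submodule.map_span] at h2
    refine Submodule.span_mono ?_ h2
    rintro _ ⟨y, ⟨hy, -⟩, rfl⟩
    change op y • v p ∈ LinearMap.range g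
    rw [hmem, hD.smul_basis_mem_lattice, Pi.zero_apply, hD.mem_ball_zero]
    exact hy

variable {Δ : Type*} [DivisionRing Δ] [Algebra F Δ] [Algebra R Δ] [IsScalarTower R F Δ]
variable {OΔ : Subalgebra R Δ} {ordΔ : Δ → ℤ} (hΔ : IsOrd OΔ ordΔ)
variable {I : Type*} [Fintype I] [DecidableEq I]

/-- If a standard hereditary order with `s` blocks is the intersection of a matrix algebra over `Δ`
with the stabiliser of a lattice in a `D`-vector space, the blocks give rise to a strictly
increasing chain of lattices. We estimate the indices in this chain. -/
theorem exists_chain_index [Finite (ResidueField R)] [FiniteDimensional F V]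
    {ϖ : R} (hϖ : Irreducible ϖ)
    (hO : (Subalgebra.toSubmodule O).FG) (hOΔ : (Subalgebra.toSubmodule OΔ).FG)
    {I' : Type*} [Fintype I'] [DecidableEq I'] (v : Module.Basis I' Dᵐᵒᵖ V)
    (ρ : Matrix I I Δ →ₐ[F] Module.End Dᵐᵒᵖ V) {t : ℕ} (p : Fin (t + 1) → I)
    (hρ : ∀ i j x, (∀ u ∈ hD.lattice v 0, ρ (single (p j) (p i) x) u ∈ hD.lattice v 0) ↔
      x ∈ hΔ.ball (if j < i then 1 else 0)) (p₀ : I) :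
    ∃ N : ℕ, N ^ (ordΔ (algebraMap R Δ ϖ)).toNat =
        Nat.card (ResidueField R) ^ Module.finrank F (LinearMap.range (ρ (single p₀ p₀ 1))) ∧
      (hD.ball 1).relIndex (hD.ball 0) * (hD.ball 1).relIndex (hD.ball 0) ^ t ≤ N ∧
      (hΔ.ball 1).relIndex (hΔ.ball 0) * (hD.ball 1).relIndex (hD.ball 0) ^ t ≤ N := by
  obtain ⟨M, hM, hMΛ, hMspan⟩ := hD.exists_submodule_eq_lattice (F := F) (V := V) hϖ hO v
  set Λ := hD.lattice v 0 with hΛ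
  have h0 : algebraMap R Δ ϖ ≠ 0 := IsOrd.algebraMap_uniformizer_ne_zero F hϖ
  have hpos := hΔ.ord_uniformizer_pos F hϖ hOΔ
  obtain ⟨π, hπ, hπ1⟩ := hΔ.exists_uniformizer
  let T : Δ → V →+ V := fun x => (ρ (diagonal fun _ => x)).toAddMonoidHom
  have hT : ∀ x y u, T x (T y u) = T (x * y) u := fun x y u => by
    change ρ _ (ρ _ u) = ρ _ u
    rw [← Module.End.mul_apply, ← map_mul, diagonal_mul_diagonal]
  have hT1 : ∀ u, T 1 u = u := fun u => by
    change ρ (diagonal fun _ => 1) u = u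
    rw [diagonal_one, map_one, Module.End.one_apply]
  have hTinj : ∀ x, x ≠ 0 → Function.Injective (T x) := fun x hx a b hab => by
    have := congrArg (T x⁻¹) hab
    rwa [hT, hT, inv_mul_cancel₀ hx, hT1, hT1] at this
  have hTs : ∀ x q u, T x (ρ (single p₀ q 1) u) = ρ (single p₀ q x) u := fun x q u => by
    change ρ _ (ρ _ u) = ρ _ u
    rw [← Module.End.mul_apply, ← map_mul]
    congr 2
    ext i j
    rw [diagonal_mul, single_apply, single_apply]
    split_ifs <;> simp
  have hTϖ : ∀ u, T (algebraMap R Δ ϖ) u = ϖ • u := fun u => by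
    change ρ (diagonal fun _ => algebraMap R Δ ϖ) u = ϖ • u
    have : (diagonal fun _ : I => algebraMap R Δ ϖ) =
        algebraMap F (Matrix I I Δ) (algebraMap R F ϖ) := by
      rw [Matrix.algebraMap_eq_diagonal, IsScalarTower.algebraMap_apply R F Δ]
      rfl
    rw [this, AlgHom.commutes, Module.algebraMap_end_apply, algebraMap_smul]
  -- The piece of the lattice at `p i` is moved to the common space at `p₀`. The standard form then
  -- says exactly which scalars `x` map `C i` into `C j`; this is `key`.
  let C : Fin (t + 1) → AddSubgroup V := fun i =>
    Λ.map (ρ (single p₀ (p i) 1)).toAddMonoidHom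
  have hC : ∀ i u, u ∈ C i ↔ ∃ y ∈ Λ, ρ (single p₀ (p i) 1) y = u := fun i u => Iff.rfl
  have key : ∀ i j x, (∀ u ∈ C i, T x u ∈ C j) ↔ x ∈ hΔ.ball (if j < i then 1 else 0) := by
    intro i j x
    rw [← hρ]
    constructor
    · intro H u hu
      obtain ⟨y, hy, hyu⟩ := (hC j _).1 (H _ ((hC i _).2 ⟨u, hu, rfl⟩))
      rw [hTs] at hyu
      have := congrArg (ρ (single (p j) p₀ 1)) hyu
      rw [map_single_apply_single, map_single_apply_single, one_mul, one_mul] at this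
      rw [← this]
      exact (hρ j j 1).2 (by
        rw [if_neg (lt_irrefl _), hΔ.mem_ball_zero]
        exact OΔ.one_mem) y hy
    · rintro H _ ⟨u, hu, rfl⟩
      refine ⟨_, H u hu, ?_⟩
      change ρ _ (ρ _ u) = T x (ρ _ u)
      rw [hTs, map_single_apply_single, one_mul]
  have hmono : ∀ {i j}, i ≤ j → C i ≤ C j := fun {i j} hij u hu => by
    rw [← hT1 u]
    refine (key i j 1).2 ?_ u hu
    rw [if_neg (not_lt.2 hij), hΔ.mem_ball_zero]
    exact OΔ.one_mem
  have hTC : ∀ i x, x ∈ OΔ → ∀ u ∈ C i, T x u ∈ C i := fun i x hx => (key i i x).2 (by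
    rw [if_neg (lt_irrefl _), hΔ.mem_ball_zero]
    exact hx)
  have hCO : ∀ i, ∀ u ∈ C i, ∀ x ∈ O, op x • u ∈ C i := by
    rintro i _ ⟨u, hu, rfl⟩ x hx
    refine ⟨op x • u, hD.smul_mem_lattice_of_mem hu hx, ?_⟩
    exact map_smul (ρ (single p₀ (p i) 1)) _ _
  set l := Fin.last t with hl
  let B : AddSubgroup V := (C l).map (T π)
  have hB0 : B ≤ C 0 := by
    rintro _ ⟨u, hu, rfl⟩
    refine (key l 0 π).2 ?_ u hu
    rw [hΔ.mem_ball_iff hπ, hπ1]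
    split_ifs <;> simp
  have h0l : C 0 ≤ C l := hmono (Fin.zero_le _)
  -- the powers of the uniformizer
  have hpow : ∀ n : ℕ, ((C l).map (T (π ^ n))).relIndex (C l) = B.relIndex (C l) ^ n := by
    intro n
    induction n with
    | zero =>
      have : (C l).map (T (π ^ 0)) = C l := by
        ext u
        rw [pow_zero]
        constructor
        · rintro ⟨y, hy, rfl⟩
          rw [hT1]
          exact hy
        · intro hu
          exact ⟨u, hu, hT1 u⟩
      rw [this, AddSubgroup.relIndex_self, pow_zero]
    | succ n ih =>
      have e : (C l).map (T (π ^ (n + 1))) = B.map (T (π ^ n)) := by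
        have : T (π ^ (n + 1)) = (T (π ^ n)).comp (T π) := by
          ext u
          rw [AddMonoidHom.comp_apply, hT, pow_succ]
        rw [this]
        exact (AddSubgroup.map_map (C l) (T (π ^ n)) (T π)).symm
      have hle1 : (C l).map (T (π ^ (n + 1))) ≤ (C l).map (T (π ^ n)) := by
        rw [e]
        exact AddSubgroup.map_mono (hB0.trans h0l)
      have hle2 : (C l).map (T (π ^ n)) ≤ C l := by
        rintro _ ⟨u, hu, rfl⟩
        refine hTC l _ (OΔ.pow_mem ?_ n) u hu
        rw [hΔ.mem_iff hπ, hπ1]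
        exact zero_le_one
      rw [← AddSubgroup.relIndex_mul_relIndex _ _ _ hle1 hle2, ih, e,
        AddSubgroup.relIndex_map_map_of_injective _ _ (hTinj _ (pow_ne_zero n hπ)), pow_succ,
        mul_comm]
  set e := ordΔ (algebraMap R Δ ϖ) with he
  -- `π ^ e` and `ϖ` differ by units of the valuation ring, which preserve `C l`. So the `e`-th
  -- power of the index is the index of `ϖ C l`, and the lattice formula computes it.
  have hNe : B.relIndex (C l) ^ e.toNat = Nat.card (ResidueField R) ^
      Module.finrank F (LinearMap.range (ρ (single p₀ p₀ 1))) := by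
    let ML : Submodule R V := M.map (((ρ (single p₀ (p l) 1)).restrictScalars F).restrictScalars R)
    have hML : ML.toAddSubgroup = C l := by
      ext u
      rw [hC, ← hMΛ]
      rfl
    have hspan : Submodule.span F (ML : Set V) =
        (LinearMap.range (ρ (single p₀ p₀ 1))).restrictScalars F := by
      have h1 : (ML : Set V) = ((ρ (single p₀ (p l) 1)).restrictScalars F) '' (M : Set V) := rfl
      rw [h1, ← Submodule.map_span, hMspan]
      ext u
      constructor
      · rintro ⟨y, -, rfl⟩
        refine ⟨ρ (single p₀ (p l) 1) y, ?_⟩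
        rw [map_single_apply_single, one_mul]
        rfl
      · rintro ⟨y, rfl⟩
        refine ⟨ρ (single (p l) p₀ 1) y, trivial, ?_⟩
        change ρ _ (ρ _ y) = _
        rw [map_single_apply_single, one_mul]
    rw [← hpow, ← hML, relIndex_smul_lattice (F := F) hϖ ML (hM.map _), hspan]
    · rfl
    intro x
    change x ∈ AddSubgroup.map (T (π ^ e.toNat)) ML.toAddSubgroup ↔ ∃ y ∈ ML.toAddSubgroup, _
    rw [hML]
    have hpe : π ^ e.toNat ≠ 0 := pow_ne_zero _ hπ
    have hoe : ordΔ (π ^ e.toNat) = e := by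
      rw [hΔ.map_pow hπ, hπ1, Int.toNat_of_nonneg hpos.le, mul_one]
    constructor
    · rintro ⟨y, hy, rfl⟩
      refine ⟨T ((algebraMap R Δ ϖ)⁻¹ * π ^ e.toNat) y, hTC l _ ?_ y hy, ?_⟩
      · rw [hΔ.mem_iff (mul_ne_zero (inv_ne_zero h0) hpe), hΔ.map_mul (inv_ne_zero h0) hpe,
          hΔ.map_inv h0, hoe]
        lia
      · rw [← hTϖ, hT, ← mul_assoc, mul_inv_cancel₀ h0, one_mul]
    · rintro ⟨y, hy, rfl⟩
      refine ⟨T ((π ^ e.toNat)⁻¹ * algebraMap R Δ ϖ) y, hTC l _ ?_ y hy, ?_⟩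
      · rw [hΔ.mem_iff (mul_ne_zero (inv_ne_zero hpe) h0), hΔ.map_mul (inv_ne_zero hpe) h0,
          hΔ.map_inv hpe, hoe]
        lia
      · rw [← hTϖ, hT, ← mul_assoc, mul_inv_cancel₀ hpe, one_mul]
  have hN0 : B.relIndex (C l) ≠ 0 := by
    intro hzero
    rw [hzero, zero_pow (by lia)] at hNe
    exact pow_ne_zero _ Nat.card_pos.ne' hNe.symm
  -- A strict inclusion of `O`-stable lattices has index at least the residue cardinality of `D`: a
  -- vector outside `H` remains outside after multiplication by a unit.
  have hstepD : ∀ {H K : AddSubgroup V} {u : V}, u ∈ K → u ∉ H →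
      (∀ u ∈ H, ∀ x ∈ O, op x • u ∈ H) → (∀ u ∈ K, ∀ x ∈ O, op x • u ∈ K) →
      H.relIndex K ≠ 0 → (hD.ball 1).relIndex (hD.ball 0) ≤ H.relIndex K := by
    intro H K u huK huH hHO hKO hHK
    let f : D →+ V := AddMonoidHom.mk' (fun x => op x • u) fun x y => by rw [op_add, add_smul]
    refine hD.le_relIndex f (fun x hx => hKO u huK x hx) (fun x hx hx0 hne hmem => huH ?_) hHK
    have hinv : x⁻¹ ∈ O := by
      rw [hD.mem_iff (inv_ne_zero hne), hD.map_inv hne, hx0, neg_zero]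
    have := hHO _ hmem _ hinv
    change op x⁻¹ • op x • u ∈ H at this
    rwa [smul_smul, ← op_mul, mul_inv_cancel₀ hne, op_one, one_smul] at this
  -- the steps inside the chain
  have hsteps : ∀ i (hi : i < t + 1), (hD.ball 1).relIndex (hD.ball 0) ^ i ≤
      (C 0).relIndex (C ⟨i, hi⟩) := by
    intro i
    induction i with
    | zero => intro hi; simp
    | succ i ih =>
      intro hi
      have hi' : i < t + 1 := by lia
      have hlt : (⟨i, hi'⟩ : Fin (t + 1)) < ⟨i + 1, hi⟩ := Fin.mk_lt_mk.2 (by lia)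
      have hle0 : C 0 ≤ C ⟨i, hi'⟩ := hmono (Fin.zero_le _)
      have hle1 := hmono hlt.le
      have hle2 : C ⟨i + 1, hi⟩ ≤ C l := hmono (Fin.le_last _)
      obtain ⟨u, huK, huH⟩ : ∃ u ∈ C ⟨i + 1, hi⟩, u ∉ C ⟨i, hi'⟩ := by
        by_contra hall
        push Not at hall
        have := (key ⟨i + 1, hi⟩ ⟨i, hi'⟩ 1).1 fun u hu => by
          rw [hT1]
          exact hall u hu
        rw [if_pos hlt, hΔ.mem_ball_iff one_ne_zero, hΔ.map_one] at this
        lia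
      have hstep := hstepD huK huH (hCO _) (hCO _)
        (AddSubgroup.relIndex_ne_zero_of_le (hB0.trans hle0) hle1 hle2 hN0)
      rw [← AddSubgroup.relIndex_mul_relIndex _ _ _ hle0 hle1, pow_succ]
      exact Nat.mul_le_mul (ih hi') hstep
  -- the last step
  obtain ⟨u, hu0, huB⟩ : ∃ u ∈ C 0, u ∉ B := by
    by_contra hall
    push Not at hall
    have := (key 0 l π⁻¹).1 fun u hu => by
      obtain ⟨y, hy, rfl⟩ := hall u hu
      rwa [hT, inv_mul_cancel₀ hπ, hT1]
    rw [hΔ.mem_ball_iff (inv_ne_zero hπ), hΔ.map_inv hπ, hπ1] at this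
    simp at this
  have hB00 : B.relIndex (C 0) ≠ 0 := AddSubgroup.relIndex_ne_zero_of_le le_rfl hB0 h0l hN0
  have hlastD : (hD.ball 1).relIndex (hD.ball 0) ≤ B.relIndex (C 0) := by
    refine hstepD hu0 huB ?_ (hCO 0) hB00
    rintro _ ⟨y, hy, rfl⟩ x hx
    refine ⟨op x • y, hCO l y hy x hx, ?_⟩
    exact map_smul (ρ (diagonal fun _ => π)) _ _
  -- `B` is stable under the units of `Δ` because conjugation by `π` preserves the valuation ring.
  -- So the same argument works with the residue field of `Δ` in the closing step.
  have hlastΔ : (hΔ.ball 1).relIndex (hΔ.ball 0) ≤ B.relIndex (C 0) := by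
    let f : Δ →+ V := AddMonoidHom.mk' (fun x => T x u) fun x y => by
      change ρ _ u = ρ _ u + ρ _ u
      rw [← LinearMap.add_apply, ← map_add, diagonal_add]
    refine hΔ.le_relIndex f (fun x hx => hTC 0 x hx u hu0) (fun x hx hx0 hne hmem => huB ?_) hB00
    obtain ⟨y, hy, hyx⟩ := hmem
    refine ⟨T (π⁻¹ * x⁻¹ * π) y, hTC l _ ?_ y hy, ?_⟩
    · have h1 : π⁻¹ * x⁻¹ ≠ 0 := mul_ne_zero (inv_ne_zero hπ) (inv_ne_zero hne)
      rw [hΔ.mem_iff (mul_ne_zero h1 hπ), hΔ.map_mul h1 hπ,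
        hΔ.map_mul (inv_ne_zero hπ) (inv_ne_zero hne), hΔ.map_inv hπ, hΔ.map_inv hne, hx0]
      lia
    · have h1 : π * (π⁻¹ * x⁻¹ * π) = x⁻¹ * π := by
        rw [mul_assoc, mul_inv_cancel_left₀ hπ]
      rw [hT, h1, ← hT, hyx]
      change T _ (T x u) = u
      rw [hT, inv_mul_cancel₀ hne, hT1]
  refine ⟨B.relIndex (C l), hNe, ?_, ?_⟩ <;>
    rw [← AddSubgroup.relIndex_mul_relIndex _ _ _ hB0 h0l]
  · exact Nat.mul_le_mul hlastD (hsteps t (Nat.lt_succ_self t))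
  · exact Nat.mul_le_mul hlastΔ (hsteps t (Nat.lt_succ_self t))

end Chain

/-! ## The valuation of a skewfield over a local field -/

section NormVal

open ValuativeRel

variable {F : Type*} [Field F] [ValuativeRel F]

theorem normVal_self (c : F) : normVal F F c = valuation F c := by
  rw [normVal, Algebra.norm_self]
  rfl

variable {X : Type*} [DivisionRing X] [Algebra F X] [FiniteDimensional F X]

omit [FiniteDimensional F X] in
theorem normVal_mul (x y : X) : normVal F X (x * y) = normVal F X x * normVal F X y := by
  rw [normVal, map_mul, map_mul]
  rfl

theorem normVal_zero : normVal F X 0 = 0 := by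
  rw [normVal, Algebra.norm_zero, map_zero]

omit [FiniteDimensional F X] in
theorem normVal_ne_zero {x : X} (hx : x ≠ 0) : normVal F X x ≠ 0 := by
  intro h0
  have h1 : normVal F X (x * x⁻¹) = 1 := by
    rw [mul_inv_cancel₀ hx, normVal, map_one, map_one]
  rw [normVal_mul, h0, zero_mul] at h1
  exact zero_ne_one h1

theorem normVal_algebraMap_le_one {c : F} (hc : valuation F c ≤ 1) :
    normVal F X (algebraMap F X c) ≤ 1 := by
  rw [normVal, Algebra.norm_algebraMap, map_pow]
  exact pow_le_one' hc _

variable [TopologicalSpace F] [IsNonarchimedeanLocalField F]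

/-- If the integral elements of a skewfield of finite degree over a local field form a ring, the
skewfield is discretely valued. -/
theorem exists_isOrd (hadd : ∀ x y : X, normVal F X x ≤ 1 → normVal F X y ≤ 1 →
    normVal F X (x + y) ≤ 1) {π : X} (hπ : IsUniformizer F X π) :
    ∃ (O : Subalgebra 𝒪[F] X) (ord : X → ℤ) (h : IsOrd O ord),
      (∀ x, x ∈ h.ball 0 ↔ normVal F X x ≤ 1) ∧ (∀ x, x ∈ h.ball 1 ↔ normVal F X x < 1) ∧
      (∀ x y, x ≠ 0 → y ≠ 0 → (ord x = ord y ↔ normVal F X x = normVal F X y)) ∧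
      ∀ π', IsUniformizer F X π' → ord π' = 1 := by
  let j := IsNonarchimedeanLocalField.valueGroupWithZeroIsoInt F
  let val : X → ℤ := fun x => -(j (normVal F X x)).log
  have hj0 : ∀ {x : X}, x ≠ 0 → j (normVal F X x) ≠ 0 := fun hx =>
    (map_ne_zero_iff j j.injective).2 (normVal_ne_zero hx)
  have hval_mul : ∀ {x y : X}, x ≠ 0 → y ≠ 0 → val (x * y) = val x + val y := by
    intro x y hx hy
    simp only [val]
    rw [normVal_mul, map_mul, WithZero.log_mul (hj0 hx) (hj0 hy), neg_add]
  have hval_le : ∀ {x y : X}, x ≠ 0 → y ≠ 0 →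
      (val x ≤ val y ↔ normVal F X y ≤ normVal F X x) := by
    intro x y hx hy
    simp only [val]
    rw [neg_le_neg_iff, WithZero.log_le_log (hj0 hy) (hj0 hx)]
    exact map_le_map_iff j
  have hone : normVal F X 1 = 1 := by rw [normVal, map_one, map_one]
  have hval_one : val 1 = 0 := by
    simp only [val]
    rw [hone, map_one, WithZero.log_one, neg_zero]
  have hval_inv : ∀ {x : X}, x ≠ 0 → val x⁻¹ = -val x := by
    intro x hx
    have := hval_mul hx (inv_ne_zero hx)
    rw [mul_inv_cancel₀ hx, hval_one] at this
    lia
  have hval_zpow : ∀ {x : X}, x ≠ 0 → ∀ n : ℤ, val (x ^ n) = n * val x := by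
    intro x hx n
    induction n using Int.induction_on with
    | zero => rw [zpow_zero, hval_one, zero_mul]
    | succ n ih => rw [zpow_add_one₀ hx, hval_mul (zpow_ne_zero _ hx) hx, ih]; ring
    | pred n ih =>
      rw [zpow_sub_one₀ hx, hval_mul (zpow_ne_zero _ hx) (inv_ne_zero hx), ih, hval_inv hx]; ring
  have hval_nonneg : ∀ {x : X}, x ≠ 0 → (0 ≤ val x ↔ normVal F X x ≤ 1) := by
    intro x hx
    rw [← hval_one, hval_le one_ne_zero hx, hone]
  have hval_pos : ∀ {x : X}, x ≠ 0 → (0 < val x ↔ normVal F X x < 1) := by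
    intro x hx
    rw [← not_le, ← hval_one, hval_le hx one_ne_zero, hone, not_le]
  set g := val π with hg
  have hgpos : 0 < g := (hval_pos hπ.1).2 hπ.2.1
  -- Division with remainder by a power of `π`: a positive remainder would be a value below that of
  -- the uniformizer. Division by `g` then normalises the valuation.
  have hdvd : ∀ {x : X}, x ≠ 0 → g ∣ val x := by
    intro x hx
    have hy : x * π ^ (-(val x / g)) ≠ 0 := mul_ne_zero hx (zpow_ne_zero _ hπ.1)
    have hvy : val (x * π ^ (-(val x / g))) = val x % g := by
      rw [hval_mul hx (zpow_ne_zero _ hπ.1), hval_zpow hπ.1, ← hg]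
      have := Int.emod_add_mul_ediv (val x) g
      linarith
    rw [Int.dvd_iff_emod_eq_zero, ← hvy]
    have hnn : 0 ≤ val (x * π ^ (-(val x / g))) := by
      rw [hvy]
      exact Int.emod_nonneg _ hgpos.ne'
    by_contra hne
    have hlt := lt_of_le_of_ne hnn (Ne.symm hne)
    have h1 := hπ.2.2 _ ((hval_pos hy).1 hlt)
    rw [← hval_le hπ.1 hy, hvy] at h1
    exact absurd (Int.emod_lt_of_pos (val x) hgpos) (not_lt.2 h1)
  let O : Subalgebra 𝒪[F] X :=
    { carrier := {x | normVal F X x ≤ 1}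
      mul_mem' := fun {x y} hx hy => by
        change normVal F X (x * y) ≤ 1
        rw [normVal_mul]
        exact mul_le_one' hx hy
      add_mem' := fun {x y} hx hy => hadd x y hx hy
      algebraMap_mem' := fun c => normVal_algebraMap_le_one c.2 }
  have hvg : ∀ {x : X}, x ≠ 0 → g * (val x / g) = val x := fun hx => Int.mul_ediv_cancel' (hdvd hx)
  have h : IsOrd O (fun x => val x / g) :=
    { map_mul := fun {x y} hx hy => by
        rw [hval_mul hx hy, Int.add_ediv_of_dvd_left (hdvd hx)]
      mem_iff := fun {x} hx => by
        change normVal F X x ≤ 1 ↔ _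
        rw [← hval_nonneg hx, Int.ediv_nonneg_iff_of_pos hgpos]
      exists_uniformizer := ⟨π, hπ.1, Int.ediv_self hgpos.ne'⟩ }
  refine ⟨O, _, h, fun x => ?_, fun x => ?_, fun x y hx hy => ?_, fun π' hπ' => ?_⟩
  · rw [h.mem_ball_zero]
    rfl
  · rcases eq_or_ne x 0 with rfl | hx
    · rw [normVal_zero]
      simp [zero_mem]
    · rw [h.mem_ball_iff hx, ← hval_pos hx]
      have := hvg hx
      constructor
      · intro h1
        nlinarith
      · intro h1
        by_contra h2
        nlinarith
  · have h1 : val x / g = val y / g ↔ val x = val y :=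
      ⟨fun e => by rw [← hvg hx, ← hvg hy, e], fun e => by rw [e]⟩
    rw [h1]
    constructor
    · intro e
      exact le_antisymm ((hval_le hy hx).1 e.ge) ((hval_le hx hy).1 e.le)
    · intro e
      simp only [val, e]
  · have h1 : normVal F X π' = normVal F X π :=
      le_antisymm (hπ.2.2 _ hπ'.2.1) (hπ'.2.2 _ hπ.2.1)
    have h2 : val π' = g := by simp only [hg, val, h1]
    simp only [h2, Int.ediv_self hgpos.ne']

-- Through `t` the module `N` embeds into a finitely generated module over the Noetherian ring
-- `𝒪[F]`. This gives the finiteness of the valuation rings of `D` and `Δ`.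
omit [TopologicalSpace F] [IsNonarchimedeanLocalField F] [FiniteDimensional F X] in
theorem IsLatticeOrder.fg_of_injective [IsNoetherianRing 𝒪[F]] {A : Type*} [Ring A] [Algebra F A]
    {𝔞 : Subring A} (h𝔞 : IsLatticeOrder F F 𝔞) (t : X →ₗ[F] A) (ht : Function.Injective t)
    (N : Submodule 𝒪[F] X) (hN : ∀ x ∈ N, t x ∈ 𝔞) : N.FG := by
  obtain ⟨⟨n, b, hb⟩, -⟩ := h𝔞
  let t' : N →ₗ[𝒪[F]] A := (t.restrictScalars 𝒪[F]).comp N.subtype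
  have hmem : ∀ x : N, t' x ∈ Submodule.span 𝒪[F] (Set.range b) := by
    intro x
    obtain ⟨c, hc, hx⟩ := (hb _).1 (hN x x.2)
    change t x ∈ _
    rw [hx]
    refine Submodule.sum_mem _ fun i _ => ?_
    have : c i • b i = (⟨c i, by rw [Valuation.mem_integer_iff, ← normVal_self]; exact hc i⟩ :
      𝒪[F]) • b i := rfl
    rw [this]
    exact Submodule.smul_mem _ _ (Submodule.subset_span ⟨i, rfl⟩)
  have : IsNoetherian 𝒪[F] (Submodule.span 𝒪[F] (Set.range b)) :=
    isNoetherian_span_of_finite _ (Set.finite_range b)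
  have : IsNoetherian 𝒪[F] N := isNoetherian_of_injective
    (t'.codRestrict _ hmem) fun x y hxy => Subtype.ext (ht (congrArg Subtype.val hxy))
  exact Module.Finite.iff_fg.1 inferInstance

end NormVal

/-! ## The index of the centraliser -/

section CentralizerIndex

open MulOpposite Matrix IsLocalRing

variable {F : Type*} [Field F]
variable {D : Type*} [DivisionRing D] [Algebra F D] [Algebra.IsCentral F D] [FiniteDimensional F D]
variable {V : Type*} [AddCommGroup V] [Module Dᵐᵒᵖ V] [Module F V] [IsScalarTower F Dᵐᵒᵖ V]
variable [FiniteDimensional Dᵐᵒᵖ V] [Nontrivial V]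
variable {K : Type*} [Field K] [Algebra F K] [FiniteDimensional F K]
variable {Δ : Type*} [DivisionRing Δ] [Algebra F Δ] [Algebra K Δ] [IsScalarTower F K Δ]
variable {I : Type*} [Fintype I] [DecidableEq I]
variable (j : K →ₐ[F] Module.End Dᵐᵒᵖ V) (ρ : Matrix I I Δ →ₐ[F] Module.End Dᵐᵒᵖ V)

omit [Algebra.IsCentral F D] [FiniteDimensional Dᵐᵒᵖ V] [Nontrivial V] in
theorem finrank_eq_mul_finrank_op (W : Submodule Dᵐᵒᵖ V) :
    Module.finrank F W = Module.finrank F D * Module.finrank Dᵐᵒᵖ W := by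
  rw [(opLinearEquiv F : D ≃ₗ[F] Dᵐᵒᵖ).finrank_eq, Module.finrank_mul_finrank]

/-- The size of the centraliser of a subfield of `End_D(V)`. -/
theorem card_mul_eq_of_range_eq_centralizer (hinj : Function.Injective ρ)
    (hrange : ∀ a, a ∈ ρ.range ↔ ∀ c, j c * a = a * j c) {d δ : ℕ}
    (hd : Module.finrank F D = d ^ 2) (hδ : Module.finrank K Δ = δ ^ 2) :
    Fintype.card I * (Module.finrank F K * δ) = Module.finrank Dᵐᵒᵖ V * d := by
  have : FiniteDimensional F Dᵐᵒᵖ :=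
    Module.Finite.equiv (opLinearEquiv F : D ≃ₗ[F] Dᵐᵒᵖ)
  have : FiniteDimensional F V := Module.Finite.trans Dᵐᵒᵖ V
  let : Module K V := Module.compHom V j.toRingHom
  have hsm : ∀ (c : K) (v : V), c • v = j c v := fun _ _ => rfl
  have : IsScalarTower F K V := ⟨fun c b v => by rw [hsm, hsm, map_smul, LinearMap.smul_apply]⟩
  have : SMulCommClass Dᵐᵒᵖ K V := ⟨fun a c v => by rw [hsm, hsm, map_smul]⟩
  let g : Matrix I I Δ →ₗ[F] commutingEnd F Dᵐᵒᵖ K V :=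
    { toFun := fun N => ⟨(ρ N).restrictScalars F, mem_commutingEnd.2
        ⟨fun a v => map_smul (ρ N) a v, fun c v => by
          have := LinearMap.congr_fun ((hrange (ρ N)).1 ⟨N, rfl⟩ c) v
          exact this.symm⟩⟩
      map_add' := fun N N' => by ext; simp
      map_smul' := fun c N => by ext; simp }
  have hg : Function.Bijective g := by
    constructor
    · intro N N' hN
      refine hinj (LinearMap.ext fun v => ?_)
      exact LinearMap.congr_fun (congrArg Subtype.val hN) v
    · rintro ⟨a, ha⟩
      obtain ⟨h1, h2⟩ := mem_commutingEnd.1 ha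
      let a' : Module.End Dᵐᵒᵖ V := { a with map_smul' := h1 }
      obtain ⟨N, hN⟩ := (hrange a').2 fun c => LinearMap.ext fun v => (h2 c v).symm
      refine ⟨N, Subtype.ext (LinearMap.ext fun v => ?_)⟩
      exact LinearMap.congr_fun hN v
  have hop : Module.finrank F Dᵐᵒᵖ = Module.finrank F D :=
    (opLinearEquiv F : D ≃ₗ[F] Dᵐᵒᵖ).finrank_eq.symm
  -- The endomorphisms commuting with `D` and `K` are exactly the matrix algebra. The resulting
  -- dimension formula is an identity of squares, whose square root is taken at the end.
  have key := finrank_end_tensorProduct (k := F) Dᵐᵒᵖ K V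
  have hV : Module.finrank F V = d ^ 2 * Module.finrank Dᵐᵒᵖ V := by
    rw [← hd, ← hop, Module.finrank_mul_finrank]
  have hdpos : 0 < d := by
    rcases Nat.eq_zero_or_pos d with rfl | h
    · have := Module.finrank_pos (R := F) (M := D)
      rw [hd] at this
      simp at this
    · exact h
  rw [← (LinearEquiv.ofBijective g hg).finrank_eq, Module.finrank_matrix, hop, hd, hV,
    ← Module.finrank_mul_finrank F K Δ, hδ] at key
  have h2 : (Fintype.card I * (Module.finrank F K * δ) * d) ^ 2 =
      (Module.finrank Dᵐᵒᵖ V * d * d) ^ 2 := by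
    linear_combination key
  exact Nat.eq_of_mul_eq_mul_right hdpos (Nat.pow_left_injective two_ne_zero h2)

variable {R : Type*} [CommRing R] [IsDomain R] [IsDiscreteValuationRing R]
variable [Algebra R F] [IsFractionRing R F] [Finite (ResidueField R)]
variable [Algebra R D] [IsScalarTower R F D]
variable {OD : Subalgebra R D} {ordD : D → ℤ} (hD : IsOrd OD ordD)
variable {ϖ : R} (hϖ : Irreducible ϖ) (hOD : (Subalgebra.toSubmodule OD).FG)

omit [FiniteDimensional Dᵐᵒᵖ V] [Nontrivial V] in
include hϖ hOD in
/-- The residue degree and the ramification index of a skewfield with a maximal unramified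
subfield. -/
theorem IsOrd.residue_card_eq {d : ℕ} (hd : Module.finrank F D = d ^ 2)
    (S : Submodule F D) (hS : Module.finrank F S = d)
    (hur : ∀ x ∈ S, x ≠ 0 → ∃ n : ℤ, ordD x = n * ordD (algebraMap R D ϖ)) :
    (hD.ball 1).relIndex (hD.ball 0) = Nat.card (ResidueField R) ^ d ∧
      ordD (algebraMap R D ϖ) = d := by
  have hq := Finite.one_lt_card (α := ResidueField R)
  -- `S` bounds the residue degree from below by `d`, and `residue_card_le` with base `F` bounds it
  -- from above by `d`. The fundamental equality then gives the ramification index.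
  have h1 := hD.card_pow_le_of_unramified F hϖ hOD S hur
  have h2 := (hD.residue_card_le F hϖ hOD F hd).1
  rw [Module.finrank_self, one_mul] at h2
  rw [hS] at h1
  have h3 := le_antisymm h2 h1
  refine ⟨h3, ?_⟩
  have h4 := hD.card_pow_ramification F hϖ hOD
  have hpos := hD.ord_uniformizer_pos F hϖ hOD
  rw [h3, ← pow_mul, hd, pow_two] at h4
  have h5 := Nat.pow_right_injective hq h4
  have hdpos : 0 < d := by
    rcases Nat.eq_zero_or_pos d with rfl | h
    · have := Module.finrank_pos (R := F) (M := D)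
      rw [hd] at this
      simp at this
    · exact h
  have h6 := Nat.eq_of_mul_eq_mul_left hdpos h5
  lia

variable [Algebra R Δ] [IsScalarTower R F Δ] [Algebra.IsCentral K Δ] [FiniteDimensional K Δ]
variable {OΔ : Subalgebra R Δ} {ordΔ : Δ → ℤ} (hΔ : IsOrd OΔ ordΔ)
variable (hOΔ : (Subalgebra.toSubmodule OΔ).FG)
variable [Module R V] [IsScalarTower R F V]

include hϖ hOD hOΔ in
/-- If a vertex of the building of `End_D(V)` meets the centraliser of a field of degree `s` in a
face of rank `s`, the centraliser has the smallest possible index and the field is unramified. -/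
theorem index_eq_of_chain (hinj : Function.Injective ρ)
    (hrange : ∀ a, a ∈ ρ.range ↔ ∀ c, j c * a = a * j c) {d δ t : ℕ}
    (hd : Module.finrank F D = d ^ 2) (hδ : Module.finrank K Δ = δ ^ 2)
    (hs : Module.finrank F K = t + 1)
    (hQ : (hD.ball 1).relIndex (hD.ball 0) = Nat.card (ResidueField R) ^ d)
    {I' : Type*} [Fintype I'] [DecidableEq I'] (v : Module.Basis I' Dᵐᵒᵖ V)
    (p : Fin (t + 1) → I)
    (hρ : ∀ i j x, (∀ u ∈ hD.lattice v 0, ρ (single (p j) (p i) x) u ∈ hD.lattice v 0) ↔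
      x ∈ hΔ.ball (if j < i then 1 else 0)) :
    d = (t + 1) * δ ∧ ordΔ (algebraMap R Δ ϖ) = δ ∧
      (hΔ.ball 1).relIndex (hΔ.ball 0) = Nat.card (ResidueField R) ^ ((t + 1) * δ) := by
  have hq := Finite.one_lt_card (α := ResidueField R)
  have : FiniteDimensional F Dᵐᵒᵖ :=
    Module.Finite.equiv (opLinearEquiv F : D ≃ₗ[F] Dᵐᵒᵖ)
  have : FiniteDimensional F V := Module.Finite.trans Dᵐᵒᵖ V
  have : FiniteDimensional F Δ := Module.Finite.trans K Δ
  obtain ⟨N, hN, hN1, hN2⟩ := exists_chain_index (F := F) hD hΔ hϖ hOD hOΔ v ρ p hρ (p 0)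
  set U := LinearMap.range (ρ (single (p 0) (p 0) 1)) with hU
  have hpos := hΔ.ord_uniformizer_pos F hϖ hOΔ
  have hcard := card_mul_eq_of_range_eq_centralizer j ρ hinj hrange hd hδ
  have hdim := finrank_eq_card_mul ρ (p 0)
  have hram := hΔ.card_pow_ramification F hϖ hOΔ
  have hle := (hΔ.residue_card_le F hϖ hOΔ K hδ).1
  rw [finrank_eq_mul_finrank_op, hd] at hN
  rw [← Module.finrank_mul_finrank F K Δ, hδ] at hram
  rw [hs] at hcard hle hram
  rw [← hU] at hdim
  set u := Module.finrank Dᵐᵒᵖ U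
  set q := Nat.card (ResidueField R)
  set Q := (hΔ.ball 1).relIndex (hΔ.ball 0)
  obtain ⟨e, he⟩ : ∃ e : ℕ, ordΔ (algebraMap R Δ ϖ) = e := ⟨_, (Int.toNat_of_nonneg hpos.le).symm⟩
  rw [he, Int.toNat_natCast] at hN hram
  have hepos : 0 < e := by lia
  have hIpos : 0 < Fintype.card I := Fintype.card_pos_iff.2 ⟨p 0⟩
  have hdpos : 0 < d := by
    rcases Nat.eq_zero_or_pos d with rfl | h
    · have := Module.finrank_pos (R := F) (M := D)
      rw [hd] at this
      simp at this
    · exact h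
  have hδpos : 0 < δ := by
    rcases Nat.eq_zero_or_pos δ with rfl | h
    · have := Module.finrank_pos (R := K) (M := Δ)
      rw [hδ] at this
      simp at this
    · exact h
  have hVpos : 0 < Module.finrank Dᵐᵒᵖ V := Module.finrank_pos
  rw [hdim, mul_assoc] at hcard
  -- The dimension of `V` over `D` is computed from the centraliser and from the decomposition into
  -- copies of `U`.
  have hud : (t + 1) * δ = u * d := Nat.eq_of_mul_eq_mul_left hIpos hcard
  have hupos : 0 < u := by
    rcases Nat.eq_zero_or_pos u with h | h
    · rw [hdim, h] at hVpos
      simp at hVpos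
    · exact h
  -- `δ ≤ e`
  have h1 : δ ≤ e := by
    have := Nat.pow_le_pow_left hle e
    rw [hram, ← pow_mul, Nat.pow_le_pow_iff_right hq] at this
    have h' : (t + 1) * δ * δ ≤ (t + 1) * δ * e := by
      calc _ = (t + 1) * δ ^ 2 := by ring
        _ ≤ _ := this
    exact Nat.le_of_mul_le_mul_left h' (by positivity)
  -- `e ≤ δ`
  have h2 : e ≤ δ := by
    have := Nat.pow_le_pow_left hN1 e
    rw [hQ, hN, ← pow_succ', ← pow_mul, ← pow_mul, Nat.pow_le_pow_iff_right hq] at this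
    have h' : d * (t + 1) * e ≤ d * (t + 1) * δ := by
      calc _ = d * ((t + 1) * e) := by ring
        _ ≤ d ^ 2 * u := this
        _ = d * (u * d) := by ring
        _ = _ := by rw [← hud]; ring
    exact Nat.le_of_mul_le_mul_left h' (by positivity)
  have heδ : e = δ := le_antisymm h2 h1
  subst heδ
  have hQΔ : Q = q ^ ((t + 1) * e) := by
    refine Nat.pow_left_injective hepos.ne' ?_
    change Q ^ e = (q ^ ((t + 1) * e)) ^ e
    rw [hram, ← pow_mul]
    ring_nf
  have hNeq : N = q ^ (d * (t + 1)) := by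
    refine Nat.pow_left_injective hepos.ne' ?_
    change N ^ e = (q ^ (d * (t + 1))) ^ e
    rw [hN, ← pow_mul]
    congr 1
    calc d ^ 2 * u = d * (u * d) := by ring
      _ = d * (t + 1) * e := by rw [← hud]; ring
  -- Only the sharper bound for the closing step excludes `u > 1`: it reads `(t + 1) δ + d t ≤ d (t
  -- + 1)`.
  rw [hQ, hQΔ, hNeq, ← pow_mul, ← pow_add, Nat.pow_le_pow_iff_right hq] at hN2
  have h3 : u * d ≤ d := by
    rw [← hud]
    lia
  have hu1 : u = 1 := by nlinarith
  refine ⟨?_, he, hQΔ⟩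
  rw [hud, hu1, one_mul]

end CentralizerIndex

/-! ## Adapted bases -/

section AdaptedFrame

open MulOpposite Matrix IsLocalRing

variable {R : Type*} [CommRing R] [IsDomain R] [IsDiscreteValuationRing R]
variable {F : Type*} [Field F] [Algebra R F] [IsFractionRing R F] [Finite (ResidueField R)]
variable {D : Type*} [DivisionRing D] [Algebra F D] [Algebra R D] [IsScalarTower R F D]
variable {O : Subalgebra R D} {ord : D → ℤ} (hD : IsOrd O ord)
variable {V : Type*} [AddCommGroup V] [Module Dᵐᵒᵖ V] [Module F V] [IsScalarTower F Dᵐᵒᵖ V]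
variable {Δ : Type*} [DivisionRing Δ] [Algebra F Δ] [Algebra R Δ] [IsScalarTower R F Δ]
variable {OΔ : Subalgebra R Δ} {ordΔ : Δ → ℤ} (hΔ : IsOrd OΔ ordΔ)
variable {I I' : Type*} [Fintype I] [DecidableEq I] [Fintype I'] [DecidableEq I']

include hD hΔ in
/-- A homomorphism which respects the valuation rings multiplies the orders with the ramification
index. -/
theorem ord_algHom_apply {ϖ : R} (hϖ : Irreducible ϖ) (hOΔ : (Subalgebra.toSubmodule OΔ).FG)
    (θ : Δ →ₐ[F] D) (hθ : ∀ x, x ∈ OΔ ↔ θ x ∈ O) {e : ℤ}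
    (he : ord (algebraMap R D ϖ) = e * ordΔ (algebraMap R Δ ϖ)) {x : Δ} (hx : x ≠ 0) :
    ord (θ x) = e * ordΔ x := by
  have hθ0 : ∀ {y : Δ}, y ≠ 0 → θ y ≠ 0 := fun hy => (map_ne_zero_iff θ θ.toRingHom.injective).2 hy
  have hunit : ∀ {y : Δ}, y ≠ 0 → ordΔ y = 0 → ord (θ y) = 0 := by
    intro y hy hy0
    have h1 : y ∈ OΔ := (hΔ.mem_iff hy).2 hy0.ge
    have h2 : y⁻¹ ∈ OΔ := by
      rw [hΔ.mem_iff (inv_ne_zero hy), hΔ.map_inv hy, hy0, neg_zero]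
    rw [hθ, hD.mem_iff (hθ0 hy)] at h1
    rw [hθ, map_inv₀, hD.mem_iff (inv_ne_zero (hθ0 hy)), hD.map_inv (hθ0 hy)] at h2
    lia
  obtain ⟨π, hπ, hπ1⟩ := hΔ.exists_uniformizer
  -- Units go to units, so the order of `θ y` depends only on that of `y` and is a fixed multiple of
  -- it. The multiple is determined at `ϖ`.
  have key : ∀ {y : Δ}, y ≠ 0 → ord (θ y) = ord (θ π) * ordΔ y := by
    intro y hy
    have hz := zpow_ne_zero (-ordΔ y) hπ
    have := hunit (mul_ne_zero hy hz) (by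
      rw [hΔ.map_mul hy hz, hΔ.map_zpow hπ, hπ1]; ring)
    rw [map_mul, map_zpow₀, hD.map_mul (hθ0 hy) (zpow_ne_zero _ (hθ0 hπ)),
      hD.map_zpow (hθ0 hπ)] at this
    linarith
  have hpos := hΔ.ord_uniformizer_pos F hϖ hOΔ
  have h0 : algebraMap R Δ ϖ ≠ 0 := IsOrd.algebraMap_uniformizer_ne_zero F hϖ
  have h1 := key h0
  rw [IsScalarTower.algebraMap_apply R F Δ, AlgHom.commutes, ← IsScalarTower.algebraMap_apply,
    ← IsScalarTower.algebraMap_apply, he] at h1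
  rw [key hx, mul_right_cancel₀ hpos.ne' h1]

/-- A matrix algebra whose intersection with the stabiliser of a lattice is in standard form has a
basis adapted to the lattice. -/
theorem exists_adapted_basis [FiniteDimensional Dᵐᵒᵖ V] [Nonempty I] {ϖ : R} (hϖ : Irreducible ϖ)
    (hOΔ : (Subalgebra.toSubmodule OΔ).FG) (v : Module.Basis I' Dᵐᵒᵖ V)
    (ρ : Matrix I I Δ →ₐ[F] Module.End Dᵐᵒᵖ V)
    (hcard : Module.finrank Dᵐᵒᵖ V = Fintype.card I) {r : ℕ} (b : I → Fin r)
    (hρ : ∀ N, (∀ u ∈ hD.lattice v 0, ρ N u ∈ hD.lattice v 0) ↔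
      ∀ p q, N p q ∈ hΔ.ball (if b p < b q then 1 else 0)) {e : ℤ}
    (he : ord (algebraMap R D ϖ) = e * ordΔ (algebraMap R Δ ϖ)) :
    ∃ (w : Module.Basis I Dᵐᵒᵖ V) (θ : Δ →ₐ[F] D) (c : I → ℤ),
      hD.lattice v 0 = hD.lattice w c ∧ (∀ N q, ρ N (w q) = ∑ p, op (θ (N p q)) • w p) ∧
      (∀ x, x ≠ 0 → ord (θ x) = e * ordΔ x) ∧ (∀ p q, b p = b q → c p = c q) ∧
      (∀ p q, b p < b q → c q < c p) ∧ ∀ p q, c p - c q < e := by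
  obtain ⟨w, θ, hw⟩ := exists_basis_of_card_eq ρ hcard
  have hsingle : ∀ p q x, (∀ u ∈ hD.lattice v 0, ρ (single p q x) u ∈ hD.lattice v 0) ↔
      x ∈ hΔ.ball (if b p < b q then 1 else 0) := by
    intro p q x
    rw [hρ]
    constructor
    · intro h
      simpa using h p q
    · intro h p' q'
      rw [single_apply]
      by_cases h1 : p = p' ∧ q = q'
      · rw [if_pos h1, ← h1.1, ← h1.2]
        exact h
      · rw [if_neg h1]
        exact zero_mem _
  -- The diagonal matrix units belong to the order, so the coordinate projections of `w` preserve
  -- the lattice.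
  obtain ⟨c, hc⟩ := hD.exists_lattice_eq w v (by
    intro x hx p
    have h1 : w.repr x p • w p = ρ (single p p 1) x := by
      conv_rhs => rw [← w.sum_repr x]
      rw [map_sum]
      rw [Finset.sum_eq_single p]
      · rw [map_smul, hw, Finset.sum_eq_single p]
        · simp
        · intro q _ hq
          simp [hq.symm]
        · simp
      · intro q _ hq
        rw [map_smul, hw]
        simp [hq.symm]
      · simp
    rw [h1]
    refine (hsingle p p 1).2 ?_ x hx
    rw [if_neg (lt_irrefl _), hΔ.mem_ball_zero]
    exact OΔ.one_mem)
  have key : ∀ p q x, x ∈ hΔ.ball (if b p < b q then 1 else 0) ↔ θ x ∈ hD.ball (c p - c q) := by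
    intro p q x
    rw [← hsingle, hc, hD.map_lattice_le_iff (hw _)]
    constructor
    · intro h
      simpa using h p q
    · intro h p' q'
      rw [single_apply]
      split_ifs with h1
      · rwa [← h1.1, ← h1.2]
      · rw [map_zero]
        exact zero_mem _
  have hθ : ∀ x, x ∈ OΔ ↔ θ x ∈ O := by
    intro x
    obtain ⟨p⟩ := ‹Nonempty I›
    have := key p p x
    rwa [if_neg (lt_irrefl _), sub_self, hΔ.mem_ball_zero, hD.mem_ball_zero] at this
  have hord : ∀ x, x ≠ 0 → ord (θ x) = e * ordΔ x := fun x hx =>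
    ord_algHom_apply hD hΔ hϖ hOΔ θ hθ he hx
  have hθ0 : ∀ {y : Δ}, y ≠ 0 → θ y ≠ 0 := fun hy => (map_ne_zero_iff θ θ.toRingHom.injective).2 hy
  obtain ⟨π, hπ, hπ1⟩ := hΔ.exists_uniformizer
  -- Testing with `π ^ n` turns the standard form into inequalities. The case `n = 0` gives the
  -- monotonicity of the exponents and `n = -1` gives the bound on their spread.
  have key2 : ∀ p q, ∀ n : ℤ, (if b p < b q then 1 else 0) ≤ n ↔ c p - c q ≤ e * n := by
    intro p q n
    have hz := zpow_ne_zero n hπ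
    have := key p q (π ^ n)
    rwa [hΔ.mem_ball_iff hz, hD.mem_ball_iff (hθ0 hz), hord _ hz, hΔ.map_zpow hπ, hπ1,
      mul_one] at this
  have hle : ∀ p q, b q ≤ b p → c p ≤ c q := fun p q h => by
    have := (key2 p q 0).1 (by rw [if_neg (not_lt.2 h)])
    linarith
  have hlt : ∀ p q, b p < b q → c q < c p := fun p q h => by
    by_contra hcon
    have := (key2 p q 0).2 (by linarith)
    rw [if_pos h] at this
    lia
  refine ⟨w, θ, c, hc, hw, hord, fun p q h => le_antisymm (hle p q h.ge) (hle q p h.le), hlt,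
    fun p q => ?_⟩
  rcases lt_or_ge (b p) (b q) with h | h
  · by_contra hcon
    have := (key2 q p (-1)).2 (by linarith)
    rw [if_neg (not_lt.2 h.le)] at this
    lia
  · have h1 := hle p q h
    -- The diagonal case with `n = -1` says that `e` is positive.
    have h2 : ¬ c p - c p ≤ e * (-1) := by
      rw [← key2, if_neg (lt_irrefl _)]
      lia
    linarith

variable {w : Module.Basis I Dᵐᵒᵖ V} {w' : Module.Basis I' Dᵐᵒᵖ V} {c : I → ℤ} {c' : I' → ℤ}

omit [Fintype I] [DecidableEq I] [Fintype I'] [IsDomain R] [IsDiscreteValuationRing R] in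
theorem IsOrd.repr_mem_ball (hc : hD.lattice w c = hD.lattice w' c') (p : I) (q : I') :
    unop (w.repr (w' q) p) ∈ hD.ball (c p - c' q) := by
  obtain ⟨π, hπ, hπ1⟩ := hD.exists_uniformizer
  have hz := zpow_ne_zero (c' q) hπ
  have h1 : op (π ^ c' q) • w' q ∈ hD.lattice w c := by
    rw [hc, hD.smul_basis_mem_lattice, hD.mem_ball_iff hz, hD.map_zpow hπ, hπ1, mul_one]
  have h2 := h1 p
  rwa [map_smul, Finsupp.smul_apply, smul_eq_mul, unop_mul, unop_op, hD.mul_mem_ball_iff_right hz,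
    hD.map_zpow hπ, hπ1, mul_one] at h2

omit [DecidableEq I'] [Fintype I] in
theorem sum_repr_mul_repr (w : Module.Basis I Dᵐᵒᵖ V) (w' : Module.Basis I' Dᵐᵒᵖ V) (p p₂ : I) :
    ∑ q, unop (w.repr (w' q) p) * unop (w'.repr (w p₂) q) = if p = p₂ then 1 else 0 := by
  have h := congrArg (fun u => unop (w.repr u p)) (w'.sum_repr (w p₂))
  simp only [map_sum, map_smul, Finsupp.finsetSum_apply, Finsupp.smul_apply, smul_eq_mul,
    Finset.unop_sum, unop_mul, w.repr_self, Finsupp.single_apply] at h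
  rw [h]
  simp only [eq_comm (a := p)]
  split_ifs <;> simp

omit [Fintype I] [IsDomain R] [IsDiscreteValuationRing R] in
/-- Some pair of corresponding coordinates of two adapted bases consists of units. -/
theorem IsOrd.exists_ord_repr_eq (hc : hD.lattice w c = hD.lattice w' c') (p : I) :
    ∃ q, unop (w.repr (w' q) p) ≠ 0 ∧ unop (w'.repr (w p) q) ≠ 0 ∧
      ord (unop (w.repr (w' q) p)) = c p - c' q ∧ ord (unop (w'.repr (w p) q)) = c' q - c p := by
  have hsum := sum_repr_mul_repr w w' p p
  rw [if_pos rfl] at hsum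
  -- These products sum to `1`, so they cannot all have positive order. For one outside the ball,
  -- both lower bounds for the factors are attained.
  obtain ⟨q, hq⟩ : ∃ q, unop (w.repr (w' q) p) * unop (w'.repr (w p) q) ∉ hD.ball 1 := by
    by_contra hall
    push Not at hall
    have := sum_mem (S := hD.ball 1) fun q (_ : q ∈ Finset.univ) => hall q
    rw [hsum, hD.mem_ball_iff one_ne_zero, hD.map_one] at this
    lia
  have h1 := hD.repr_mem_ball hc p q
  have h2 := hD.repr_mem_ball hc.symm q p
  have hg : unop (w.repr (w' q) p) ≠ 0 := by
    intro h0
    rw [h0, zero_mul] at hq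
    exact hq (zero_mem _)
  have hh : unop (w'.repr (w p) q) ≠ 0 := by
    intro h0
    rw [h0, mul_zero] at hq
    exact hq (zero_mem _)
  rw [hD.mem_ball_iff (mul_ne_zero hg hh), hD.map_mul hg hh] at hq
  rw [hD.mem_ball_iff hg] at h1
  rw [hD.mem_ball_iff hh] at h2
  exact ⟨q, hg, hh, by lia, by lia⟩

omit [IsDomain R] [IsDiscreteValuationRing R] [Finite (ResidueField R)] [Algebra R F]
  [IsFractionRing R F] [IsScalarTower R F D] [Algebra R Δ] [IsScalarTower R F Δ] in
/-- The number of blocks of an order in standard form does not depend on the identification with a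
matrix algebra. -/
theorem card_blocks_le {ρ : Matrix I I Δ →ₐ[F] Module.End Dᵐᵒᵖ V}
    {ρ' : Matrix I' I' Δ →ₐ[F] Module.End Dᵐᵒᵖ V} (hρρ' : ∀ N', ∃ N, ρ N = ρ' N')
    (hc : hD.lattice w c = hD.lattice w' c') {θ θ' : Δ →ₐ[F] D}
    (hw : ∀ N q, ρ N (w q) = ∑ p, op (θ (N p q)) • w p)
    (hw' : ∀ N q, ρ' N (w' q) = ∑ p, op (θ' (N p q)) • w' p) {e : ℤ}
    (hθ : ∀ x, x ≠ 0 → ord (θ x) = e * ordΔ x) {r r' : ℕ} (b : I → Fin r) (b' : I' → Fin r')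
    (hb : Function.Surjective b) (hlt : ∀ p q, b p < b q → c q < c p)
    (hce : ∀ p q, c p - c q < e) (hb' : ∀ p q, b' p = b' q → c' p = c' q) : r ≤ r' := by
  choose Q hg hh hog hoh using hD.exists_ord_repr_eq hc
  obtain ⟨g, hgb⟩ := hb.hasRightInverse
  -- If the partners `Q p` and `Q p₂` lie in the same block, the matrix unit joining them has, in
  -- the basis `w`, an entry of order `c p - c p₂`. This entry comes from `Δ`, so `e` divides the
  -- difference; the spread is less than `e`, hence `p` and `p₂` lie in the same block.
  have hinj : Function.Injective fun i => b' (Q (g i)) := by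
    intro i j hij
    obtain ⟨N, hN⟩ := hρρ' (single (Q (g i)) (Q (g j)) 1)
    set p := g i
    set p₂ := g j
    have h1 : θ (N p p₂) = unop (w.repr (w' (Q p)) p) * unop (w'.repr (w p₂) (Q p₂)) := by
      have h2 : w.repr (ρ N (w p₂)) p = op (θ (N p p₂)) := by
        rw [hw]
        simp [Finsupp.single_apply]
      have h3 : ρ N (w p₂) = w'.repr (w p₂) (Q p₂) • w' (Q p) := by
        rw [hN]
        conv_lhs => rw [← w'.sum_repr (w p₂)]
        rw [map_sum, Finset.sum_eq_single (Q p₂)]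
        · rw [map_smul, hw', Finset.sum_eq_single (Q p)]
          · simp
          · intro q _ hq
            simp [hq.symm]
          · simp
        · intro q _ hq
          rw [map_smul, hw']
          simp [hq.symm]
        · simp
      rw [h3, map_smul, Finsupp.smul_apply, smul_eq_mul] at h2
      rw [← unop_mul, h2, unop_op]
    have hN0 : N p p₂ ≠ 0 := by
      intro h0
      rw [h0, map_zero] at h1
      exact mul_ne_zero (hg p) (hh p₂) h1.symm
    have h2 := hθ _ hN0
    rw [h1, hD.map_mul (hg p) (hh p₂), hog, hoh, hb' _ _ hij] at h2
    have hdvd : e ∣ c p - c p₂ := ⟨ordΔ (N p p₂), by linarith⟩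
    have h3 : c p - c p₂ = 0 := by
      refine Int.eq_zero_of_abs_lt_dvd hdvd ?_
      rw [abs_lt]
      have := hce p p₂
      have := hce p₂ p
      constructor <;> linarith
    have h4 : b p = b p₂ := by
      rcases lt_trichotomy (b p) (b p₂) with h | h | h
      · have := hlt _ _ h
        lia
      · exact h
      · have := hlt _ _ h
        lia
    rwa [hgb, hgb] at h4
  simpa using Fintype.card_le_of_injective _ hinj

end AdaptedFrame

/-! ## Reduction of the eigenvalues -/

section Eigenvalues

open MulOpposite Matrix

/-- An invertible matrix which respects colourings of the indices. -/
theorem card_le_of_mul_eq_one {κ : Type*} [Field κ] {I I' C : Type*} [Fintype I] [DecidableEq I]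
    [Fintype I'] {M : Matrix I I' κ} {N : Matrix I' I κ} (hMN : M * N = 1)
    {col : I → C} {col' : I' → C} (hM : ∀ p q, M p q ≠ 0 → col p = col' q) (k : C) :
    Nat.card {p // col p = k} ≤ Nat.card {q // col' q = k} := by
  classical
  let M' : Matrix {p // col p = k} {q // col' q = k} κ := fun p q => M p q
  let N' : Matrix {q // col' q = k} {p // col p = k} κ := fun q p => N q p
  -- Entries of `M` between different colours vanish, so restricting the sum to one colour loses
  -- nothing. The rank of the identity then bounds the number of rows by the number of columns.
  have h1 : M' * N' = 1 := by
    ext p p₂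
    have h2 := congrFun (congrFun hMN p) p₂
    rw [mul_apply, one_apply] at h2
    rw [mul_apply, one_apply]
    simp only [Subtype.ext_iff]
    rw [← h2]
    refine Finset.sum_bij_ne_zero (fun q _ _ => (q : I')) (fun _ _ _ => Finset.mem_univ _)
      (fun q _ _ q' _ _ h => Subtype.ext h) (fun q _ hq => ?_) fun _ _ _ => rfl
    have h3 : M p q ≠ 0 := left_ne_zero_of_mul hq
    exact ⟨⟨q, by rw [← hM _ _ h3, p.2]⟩, Finset.mem_univ _, hq, rfl⟩
  have h3 : (M' * N').rank ≤ M'.rank := rank_mul_le_left M' N'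
  rw [h1, rank_one] at h3
  rw [Nat.card_eq_fintype_card, Nat.card_eq_fintype_card]
  exact h3.trans (rank_le_card_width M')

variable {R : Type*} [CommRing R] {D : Type*} [DivisionRing D] [Algebra R D]
variable {O : Subalgebra R D} {ord : D → ℤ} (h : IsOrd O ord)

namespace IsOrd

/-- Conjugation on the valuation ring. -/
def conjHom (a : Dˣ) : O →+* O where
  toFun x := ⟨a * x * (a⁻¹ : Dˣ), by
    by_cases hx : (x : D) = 0
    · rw [hx, mul_zero, zero_mul]
      exact O.zero_mem
    · rw [Units.val_inv_eq_inv_val, h.mem_iff (mul_ne_zero (mul_ne_zero a.ne_zero hx)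
        (inv_ne_zero a.ne_zero)), h.map_conj a.ne_zero hx, ← h.mem_iff hx]
      exact x.2⟩
  map_one' := Subtype.ext (by simp)
  map_mul' x y := Subtype.ext (by simp [mul_assoc])
  map_zero' := Subtype.ext (by simp)
  map_add' x y := Subtype.ext (by simp [mul_add, add_mul])

theorem coe_conjHom (a : Dˣ) (x : O) : (h.conjHom a x : D) = a * x * (a⁻¹ : Dˣ) := rfl

theorem conjHom_mul (a b : Dˣ) (x : O) : h.conjHom (a * b) x = h.conjHom a (h.conjHom b x) :=
  Subtype.ext (by simp [coe_conjHom, mul_assoc])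

theorem conjHom_one (x : O) : h.conjHom 1 x = x := Subtype.ext (by simp [coe_conjHom])

variable {κ : Type*} [Field κ] {red : O →+* κ}
  (hker : ∀ x : O, red x = 0 ↔ (x : D) ∈ h.ball 1)

/-- Two units of `D` of the same order differ by a unit of `O`, and conjugation by the latter is
trivial on a commutative residue field. -/
theorem red_conjHom_eq_of_ord_eq {a b : Dˣ} (hab : ord a = ord b) (x : O) :
    red (h.conjHom a x) = red (h.conjHom b x) := by
  obtain ⟨g, rfl⟩ : ∃ g, a = g * b := ⟨a * b⁻¹, by simp⟩
  have hg : ord g = 0 := by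
    rw [Units.val_mul, h.map_mul g.ne_zero b.ne_zero] at hab
    lia
  have hgO : (g : D) ∈ O := (h.mem_iff g.ne_zero).2 hg.ge
  have hgO' : ((g⁻¹ : Dˣ) : D) ∈ O := by
    rw [Units.val_inv_eq_inv_val, h.mem_iff (inv_ne_zero g.ne_zero), h.map_inv g.ne_zero, hg,
      neg_zero]
  rw [h.conjHom_mul]
  set y := h.conjHom b x
  have h1 : h.conjHom g y = ⟨g, hgO⟩ * y * ⟨_, hgO'⟩ := rfl
  have h2 : (⟨g, hgO⟩ : O) * ⟨_, hgO'⟩ = 1 := Subtype.ext (by simp)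
  rw [h1, _root_.map_mul, _root_.map_mul, mul_right_comm, ← _root_.map_mul, h2, _root_.map_one,
    one_mul]

include hker

/-- Conjugation preserves the valuation ideal and so descends to the residue field. -/
theorem red_conjHom_congr (a : Dˣ) {x y : O} (hxy : red x = red y) :
    red (h.conjHom a x) = red (h.conjHom a y) := by
  rw [← sub_eq_zero, ← _root_.map_sub, hker] at hxy
  rw [← sub_eq_zero, ← _root_.map_sub, ← _root_.map_sub, hker, coe_conjHom]
  by_cases h0 : ((x - y : O) : D) = 0
  · rw [h0, mul_zero, zero_mul]
    exact zero_mem _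
  · rw [h.mem_ball_iff h0] at hxy
    rwa [Units.val_inv_eq_inv_val, h.mem_ball_iff (mul_ne_zero (mul_ne_zero a.ne_zero h0)
        (inv_ne_zero a.ne_zero)), h.map_conj a.ne_zero h0]

variable {V : Type*} [AddCommGroup V] [Module Dᵐᵒᵖ V]
variable {I I' : Type*} [Fintype I] [DecidableEq I] [Fintype I'] [DecidableEq I']
variable {w : Module.Basis I Dᵐᵒᵖ V} {w' : Module.Basis I' Dᵐᵒᵖ V} {c : I → ℤ} {c' : I' → ℤ}

omit hker in
/-- The eigenvalues of an endomorphism on the reduction of a lattice, with multiplicities, can be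
computed with any adapted basis of eigenvectors. -/
theorem card_eigenvalue_le (hc : h.lattice w c = h.lattice w' c') {u : Dˣ} (hu : ord u = 1)
    {a : Module.End Dᵐᵒᵖ V} {α : I → O} {α' : I' → O} (hα : ∀ p, a (w p) = op (α p : D) • w p)
    (hα' : ∀ q, a (w' q) = op (α' q : D) • w' q) (k : κ) :
    Nat.card {p // red (h.conjHom (u ^ (-c p)) (α p)) = k} ≤
      Nat.card {q // red (h.conjHom (u ^ (-c' q)) (α' q)) = k} := by
  have hou : ∀ n : ℤ, ord ((u ^ n : Dˣ) : D) = n := fun n => by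
    rw [Units.val_zpow_eq_zpow_val, h.map_zpow u.ne_zero, hu, mul_one]
  have hmem : ∀ {x : D} {m n : ℤ}, x ∈ h.ball (m - n) →
      ((u ^ (-m) : Dˣ) : D) * x * ((u ^ n : Dˣ) : D) ∈ O := by
    intro x m n hx
    rw [← h.mem_ball_zero, h.mul_mem_ball_iff_right (Units.ne_zero _),
      h.mul_mem_ball_iff_left (Units.ne_zero _), hou, hou]
    convert hx using 2
    ring
  -- `G` and `H` are the base changes between the normalised bases `w p u ^ c p` and `w' q u ^ c' q`
  -- of the same lattice; they have integral entries and are inverse to each other.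
  let G : I → I' → O := fun p q => ⟨_, hmem (h.repr_mem_ball hc p q)⟩
  let H : I' → I → O := fun q p => ⟨_, hmem (h.repr_mem_ball hc.symm q p)⟩
  have hGH : ∀ p p₂, ∑ q, G p q * H q p₂ = if p = p₂ then 1 else 0 := by
    intro p p₂
    apply Subtype.ext
    have h1 := sum_repr_mul_repr w w' p p₂
    have h2 : ((∑ q, G p q * H q p₂ : O) : D) = ((u ^ (-c p) : Dˣ) : D) *
        (∑ q, unop (w.repr (w' q) p) * unop (w'.repr (w p₂) q)) * ((u ^ c p₂ : Dˣ) : D) := by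
      rw [AddSubmonoidClass.coe_finsetSum, Finset.mul_sum, Finset.sum_mul]
      refine Finset.sum_congr rfl fun q _ => ?_
      change (((u ^ (-c p) : Dˣ) : D) * _ * ((u ^ c' q : Dˣ) : D)) *
        (((u ^ (-c' q) : Dˣ) : D) * _ * ((u ^ c p₂ : Dˣ) : D)) = _
      have h3 : ((u ^ c' q : Dˣ) : D) * ((u ^ (-c' q) : Dˣ) : D) = 1 := by
        rw [← Units.val_mul, ← _root_.zpow_add, add_neg_cancel, zpow_zero, Units.val_one]
      simp only [mul_assoc]
      rw [← mul_assoc ((u ^ c' q : Dˣ) : D), h3, one_mul]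
    rw [h2, h1]
    split_ifs with hp
    · subst hp
      rw [mul_one, ← Units.val_mul, ← _root_.zpow_add, neg_add_cancel, zpow_zero]
      rfl
    · simp
  -- The endomorphism is diagonal in both bases, so `G` intertwines the eigenvalues. After reduction
  -- a nonzero entry of `G` forces them to be equal, and the reduced eigenvalues serve as colours.
  have hcomm : ∀ p q, h.conjHom (u ^ (-c p)) (α p) * G p q =
      G p q * h.conjHom (u ^ (-c' q)) (α' q) := by
    intro p q
    apply Subtype.ext
    have h1 : (α p : D) * unop (w.repr (w' q) p) = unop (w.repr (w' q) p) * α' q := by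
      have h2 : w.repr (a (w' q)) p = w.repr (w' q) p * op (α p : D) := by
        conv_lhs => rw [← w.sum_repr (w' q)]
        simp only [map_sum, map_smul, hα, Finsupp.finsetSum_apply, Finsupp.smul_apply,
          w.repr_self, Finsupp.single_apply, smul_eq_mul]
        rw [Finset.sum_eq_single p]
        · simp
        · intro p₂ _ hp
          simp [hp]
        · simp
      rw [hα', map_smul, Finsupp.smul_apply, smul_eq_mul] at h2
      have h3 := congrArg unop h2
      rwa [unop_mul, unop_mul, unop_op, unop_op, eq_comm] at h3
    change ((u ^ (-c p) : Dˣ) : D) * α p * ((u ^ (-c p))⁻¹ : Dˣ) *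
      (((u ^ (-c p) : Dˣ) : D) * _ * ((u ^ c' q : Dˣ) : D)) =
      (((u ^ (-c p) : Dˣ) : D) * _ * ((u ^ c' q : Dˣ) : D)) *
      (((u ^ (-c' q) : Dˣ) : D) * α' q * ((u ^ (-c' q))⁻¹ : Dˣ))
    have h4 : (((u ^ (-c p))⁻¹ : Dˣ) : D) * ((u ^ (-c p) : Dˣ) : D) = 1 := Units.inv_mul _
    have h5 : ((u ^ c' q : Dˣ) : D) * ((u ^ (-c' q) : Dˣ) : D) = 1 := by
      rw [← Units.val_mul, ← _root_.zpow_add, add_neg_cancel, zpow_zero, Units.val_one]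
    have h6 : (u ^ (-c' q))⁻¹ = u ^ c' q := by rw [_root_.zpow_neg, inv_inv]
    simp only [mul_assoc]
    rw [← mul_assoc (((u ^ (-c p))⁻¹ : Dˣ) : D), h4, one_mul,
      ← mul_assoc ((u ^ c' q : Dˣ) : D), h5, one_mul, h6, ← mul_assoc (α p : D), h1, mul_assoc]
  refine card_le_of_mul_eq_one (M := Matrix.of fun p q => red (G p q))
    (N := Matrix.of fun q p => red (H q p)) ?_ ?_ k
  · ext p p₂
    rw [mul_apply, one_apply]
    simp only [of_apply, ← _root_.map_mul]
    rw [← _root_.map_sum, hGH]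
    split_ifs <;> simp
  · intro p q hne
    have := congrArg red (hcomm p q)
    rw [_root_.map_mul, _root_.map_mul, mul_comm] at this
    exact mul_left_cancel₀ hne this

end IsOrd

end Eigenvalues

/-! ## Roots of unity in a skewfield -/

section RootsOfUnity

open Polynomial

theorem zpow_apply_eq_self_iff {F B : Type*} [Field F] [Field B] [Algebra F B] (σ : B ≃ₐ[F] B)
    (b : B) (k : ℤ) : (σ ^ k) b = b ↔ (Function.minimalPeriod σ b : ℤ) ∣ k :=
  MulAction.zpow_smul_eq_iff_minimalPeriod_dvd (a := σ) (b := b)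

/-- The product of the linear factors for an orbit has coefficients in the fixed field. -/
theorem exists_map_eq_prod_orbit {F B : Type*} [Field F] [Field B] [Algebra F B] (σ : B ≃ₐ[F] B)
    (hσ : ∀ x, σ x = x → x ∈ (algebraMap F B).range) (b : B) {N : ℕ} (hN : (σ ^ N) b = b) :
    ∃ P : F[X], P.natDegree = N ∧ P.Monic ∧
      P.map (algebraMap F B) = ∏ k ∈ Finset.range N, (X - C ((σ ^ k) b)) := by
  set g : ℕ → B[X] := fun k => X - C ((σ ^ k) b) with hg
  set P := ∏ k ∈ Finset.range N, g k with hP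
  have hmonic : P.Monic := monic_prod_of_monic _ _ fun k _ => monic_X_sub_C _
  have hdeg : P.natDegree = N := by
    rw [hP, natDegree_prod_of_monic _ _ fun k _ => monic_X_sub_C _]
    simp [hg]
  -- Applying `σ` shifts the factors cyclically. It is enough that `σ ^ N` fixes `b`; `N` need not
  -- be the least period.
  have hinv : P.map (σ : B →+* B) = P := by
    have h1 : P.map (σ : B →+* B) = ∏ k ∈ Finset.range N, g (k + 1) := by
      rw [hP, Polynomial.map_prod]
      refine Finset.prod_congr rfl fun k _ => ?_
      change (X - C ((σ ^ k) b)).map (σ : B →+* B) = X - C ((σ ^ (k + 1)) b)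
      rw [pow_succ', AlgEquiv.mul_apply, Polynomial.map_sub, map_X, map_C]
      rfl
    have h2 : (∏ k ∈ Finset.range N, g (k + 1)) * g 0 = P * g N := by
      rw [← Finset.prod_range_succ', Finset.prod_range_succ]
    have h3 : g N = g 0 := by
      change X - C ((σ ^ N) b) = X - C ((σ ^ 0) b)
      rw [hN]
      rfl
    rw [h3] at h2
    rw [h1]
    exact mul_right_cancel₀ (monic_X_sub_C _).ne_zero h2
  have hlift : P ∈ lifts (algebraMap F B) := by
    rw [lifts_iff_coeff_lifts]
    intro k
    have h1 := congrArg (fun p => p.coeff k) hinv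
    simp only [coeff_map] at h1
    exact hσ _ h1
  obtain ⟨P₀, h1, h2, h3⟩ := lifts_and_natDegree_eq_and_monic hlift hmonic
  exact ⟨P₀, by rw [h2, hdeg], h3, h1⟩

/-- The points of an orbit are distinct roots of the minimal polynomial; conversely the orbit
polynomial has coefficients in `F` and vanishes at `b`. -/
theorem minimalPeriod_eq_natDegree_minpoly {F B : Type*} [Field F] [Field B] [Algebra F B]
    [FiniteDimensional F B] (σ : B ≃ₐ[F] B)
    (hσ : ∀ x, σ x = x → x ∈ (algebraMap F B).range) (b : B) :
    Function.minimalPeriod σ b = (minpoly F b).natDegree := by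
  classical
  have hint : IsIntegral F b := Algebra.IsIntegral.isIntegral b
  set N := Function.minimalPeriod σ b with hN
  have hpow : ∀ k : ℕ, (σ ^ k) b = σ^[k] b := fun k => by
    rw [AlgEquiv.coe_pow]
  apply le_antisymm
  · have hsub : (Finset.range N).image (fun k => σ^[k] b) ⊆
        ((minpoly F b).aroots B).toFinset := by
      intro x hx
      obtain ⟨k, -, rfl⟩ := Finset.mem_image.1 hx
      rw [Multiset.mem_toFinset, mem_aroots]
      refine ⟨minpoly.ne_zero hint, ?_⟩
      rw [← hpow, ← AlgEquiv.coe_toAlgHom, aeval_algHom_apply, minpoly.aeval, map_zero]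
    have h1 := Finset.card_le_card hsub
    rw [Finset.card_image_of_injOn, Finset.card_range] at h1
    · refine h1.trans ((Multiset.toFinset_card_le _).trans ?_)
      refine (card_roots' _).trans ?_
      rw [natDegree_map]
    · intro k hk l hl hkl
      exact Function.iterate_injOn_Iio_minimalPeriod (by simpa using hk) (by simpa using hl) hkl
  · have hfin : IsOfFinOrder σ := isOfFinOrder_of_finite σ
    have hpos : 0 < N := by
      rw [hN, Function.minimalPeriod_pos_iff_mem_periodicPts]
      refine ⟨orderOf σ, hfin.orderOf_pos, ?_⟩
      rw [Function.IsPeriodicPt, Function.IsFixedPt, ← hpow, pow_orderOf_eq_one]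
      rfl
    obtain ⟨P, hdeg, hmonic, hP⟩ := exists_map_eq_prod_orbit σ hσ b (N := N) (by
      rw [hpow, hN, Function.iterate_minimalPeriod])
    rw [← hdeg]
    refine natDegree_le_of_dvd (minpoly.dvd F b ?_) hmonic.ne_zero
    rw [← eval_map_algebraMap, hP, eval_prod]
    exact Finset.prod_eq_zero (Finset.mem_range.2 hpos) (by simp)

variable {R : Type*} [CommRing R] {F : Type*} [Field F]
variable {D : Type*} [DivisionRing D] [Algebra F D] [Algebra R D]
variable {O : Subalgebra R D} {ord : D → ℤ} (h : IsOrd O ord)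
variable {κ : Type*} [Field κ] {red : O →+* κ} (hker : ∀ x : O, red x = 0 ↔ (x : D) ∈ h.ball 1)

/-- Roots of unity of order prime to the residue characteristic are determined by their
reductions. -/
theorem eq_one_of_red_eq_one {x : O} {n : ℕ} (hx : x ^ n = 1) (hn : (n : κ) ≠ 0)
    (hred : red x = 1) : x = 1 := by
  -- The geometric sum reduces to `n`, which is nonzero in `κ`, so the other factor vanishes.
  have h1 : (∑ k ∈ Finset.range n, x ^ k) * (x - 1) = 0 := by
    rw [geom_sum_mul, hx, sub_self]
  rcases mul_eq_zero.1 h1 with h2 | h2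
  · have h3 := congrArg red h2
    simp only [map_sum, map_pow, hred, one_pow, Finset.sum_const, Finset.card_range, nsmul_eq_mul,
      mul_one, map_zero] at h3
    exact absurd h3 hn
  · exact sub_eq_zero.1 h2

variable {B : Type*} [Field B] [Algebra F B] [FiniteDimensional F B] (j : B →ₐ[F] D) {u : Dˣ}
variable (hnorm : ∀ x, ∃ y, j y = u * j x * (u⁻¹ : Dˣ))
variable (hgen : ∀ x, u * j x * (u⁻¹ : Dˣ) = j x → x ∈ (algebraMap F B).range)

include hnorm in
omit [Algebra R D] in
/-- The automorphism of a normalised subfield. -/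
theorem exists_algEquiv_conj :
    ∃ σ : B ≃ₐ[F] B, ∀ (k : ℤ) x, j ((σ ^ k) x) = (u ^ k : Dˣ) * j x * ((u ^ k)⁻¹ : Dˣ) := by
  choose s hs using hnorm
  have hj := j.toRingHom.injective
  let s' : B →ₐ[F] B :=
    { toFun := s
      map_one' := hj (by simp [hs])
      map_mul' := fun x y => hj (by simp [hs, mul_assoc])
      map_zero' := hj (by simp [hs])
      map_add' := fun x y => hj (by simp [hs, mul_add, add_mul])
      commutes' := fun c => hj (by
        have := Algebra.commutes c (u : D)
        simp [hs, ← this]) }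
  let σ : B ≃ₐ[F] B := AlgEquiv.ofBijective s' s'.bijective
  have hσ : ∀ x, j (σ x) = u * j x * (u⁻¹ : Dˣ) := hs
  have hσ' : ∀ x, j (σ⁻¹ x) = (u⁻¹ : Dˣ) * j x * u := by
    intro x
    obtain ⟨y, rfl⟩ := σ.surjective x
    rw [hσ]
    simp [mul_assoc]
  refine ⟨σ, fun k => ?_⟩
  induction k using Int.induction_on with
  | zero => intro x; simp
  | succ n ih =>
    intro x
    rw [zpow_add_one, zpow_add_one, AlgEquiv.mul_apply, ih, hσ]
    simp [mul_assoc]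
  | pred n ih =>
    intro x
    rw [zpow_sub_one, zpow_sub_one, AlgEquiv.mul_apply, ih, hσ']
    simp [mul_assoc]

include hker hnorm hgen in
/-- The action of a uniformizer on the reduction of a root of unity. -/
theorem red_conjHom_zpow_eq_iff {b : B} {a : O} (ha : (a : D) = j b) {n : ℕ} (hn0 : n ≠ 0)
    (hb : b ^ n = 1) (hn : (n : κ) ≠ 0) (m k : ℤ) :
    red (h.conjHom (u ^ m) a) = red (h.conjHom (u ^ k) a) ↔
      ((minpoly F b).natDegree : ℤ) ∣ m - k := by
  obtain ⟨σ, hσ⟩ := exists_algEquiv_conj j hnorm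
  have hfix : ∀ x, σ x = x → x ∈ (algebraMap F B).range := fun x hx => hgen x (by
    have := hσ 1 x
    rw [zpow_one, zpow_one, hx] at this
    exact this.symm)
  have hj := j.toRingHom.injective
  have key : ∀ k : ℤ, red (h.conjHom (u ^ k) a) = red a ↔ (σ ^ k) b = b := by
    intro k
    have hcoe : (h.conjHom (u ^ k) a : D) = j ((σ ^ k) b) := by
      rw [h.coe_conjHom, ha, hσ]
    constructor
    · intro hred
      have hbn : b ^ (n - 1) * b = 1 := by
        rw [← pow_succ, Nat.sub_add_cancel (Nat.one_le_iff_ne_zero.2 hn0), hb]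
      -- The quotient of the conjugate by `a`, written with `a ^ (n - 1)` as inverse, is an `n`-th
      -- root of unity with reduction `1`.
      have hx : (h.conjHom (u ^ k) a * a ^ (n - 1)) = 1 := by
        refine eq_one_of_red_eq_one (red := red) (n := n) ?_ hn ?_
        · apply Subtype.ext
          simp only [SubmonoidClass.coe_pow, MulMemClass.coe_mul, hcoe, ha, ← map_pow, ← map_mul,
            mul_pow]
          rw [← pow_mul, mul_comm (n - 1), pow_mul, hb, one_pow]
          simp
        · rw [map_mul, hred, ← map_mul, ← pow_succ', Nat.sub_add_cancel
            (Nat.one_le_iff_ne_zero.2 hn0)]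
          have : a ^ n = 1 := Subtype.ext (by
            rw [SubmonoidClass.coe_pow, ha, ← map_pow, hb, map_one]
            rfl)
          rw [this, map_one]
      have hx' := congrArg (Subtype.val) hx
      simp only [SubmonoidClass.coe_pow, MulMemClass.coe_mul, hcoe, ha, ← map_pow,
        ← map_mul] at hx'
      have hx'' : (σ ^ k) b * b ^ (n - 1) = 1 := hj (by
        change j _ = j _
        rw [hx', map_one]
        rfl)
      calc (σ ^ k) b = (σ ^ k) b * (b ^ (n - 1) * b) := by rw [hbn, mul_one]
        _ = b := by rw [← mul_assoc, hx'', one_mul]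
    · intro hk
      have : h.conjHom (u ^ k) a = a := Subtype.ext (by rw [hcoe, hk, ha])
      rw [this]
  rw [← minimalPeriod_eq_natDegree_minpoly σ hfix, ← zpow_apply_eq_self_iff, ← key]
  constructor
  · intro e
    have := h.red_conjHom_congr hker (u ^ (-k)) e
    rwa [← h.conjHom_mul, ← h.conjHom_mul, ← zpow_add, ← zpow_add, neg_add_cancel, zpow_zero,
      h.conjHom_one, neg_add_eq_sub] at this
  · intro e
    have := h.red_conjHom_congr hker (u ^ k) e
    rwa [← h.conjHom_mul, ← zpow_add, add_sub_cancel] at this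

include hnorm hgen in
/-- The reductions of the conjugates of an integral element are permuted transitively by the
uniformizer. -/
theorem exists_red_eq_red_conjHom {b : B} {a : O} (ha : (a : D) = j b) {a' : O}
    (ha' : aeval (a' : D) (minpoly F b) = 0) :
    ∃ t : ℤ, red a' = red (h.conjHom (u ^ t) a) := by
  obtain ⟨σ, hσ⟩ := exists_algEquiv_conj j hnorm
  have hfix : ∀ x, σ x = x → x ∈ (algebraMap F B).range := fun x hx => hgen x (by
    have := hσ 1 x
    rw [zpow_one, zpow_one, hx] at this
    exact this.symm)
  have hj := j.toRingHom.injective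
  have hfin : IsOfFinOrder σ := isOfFinOrder_of_finite σ
  set N := orderOf σ with hN
  have hpos : 0 < N := hfin.orderOf_pos
  -- The orbit polynomial of `b` is a multiple of its minimal polynomial, hence vanishes at `a'`.
  -- Reducing its linear factors shows that the reduction of `a'` is that of a conjugate of `a`.
  obtain ⟨P, hdeg, hmonic, hP⟩ := exists_map_eq_prod_orbit σ hfix b (N := N) (by
    rw [hN, pow_orderOf_eq_one]
    rfl)
  let S : Subring B := O.toSubring.comap j.toRingHom
  have hcoe : ∀ k : ℕ, j ((σ ^ k) b) = h.conjHom (u ^ (k : ℤ)) a := fun k => by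
    rw [h.coe_conjHom, ha, ← hσ, zpow_natCast]
  let y : ℕ → S := fun k => ⟨(σ ^ k) b, by
    change j _ ∈ O
    rw [hcoe]
    exact Subtype.property _⟩
  -- The factorisation is formed over the commutative ring `S` of integral elements of `B`, from
  -- which reduction to `κ` is a homomorphism.
  let jS : S →+* O := j.toRingHom.restrict S O.toSubring fun x hx => hx
  have hjS : ∀ x, (jS x : D) = j x := fun x => rfl
  let PS : S[X] := ∏ k ∈ Finset.range N, (X - C (y k))
  have hPS : PS.map S.subtype = P.map (algebraMap F B) := by
    rw [hP, Polynomial.map_prod]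
    refine Finset.prod_congr rfl fun k _ => ?_
    simp [y]
  have hPdvd : aeval (a' : D) P = 0 := by
    have : minpoly F b ∣ P := minpoly.dvd F b (by
      rw [← eval_map_algebraMap, hP, eval_prod]
      exact Finset.prod_eq_zero (Finset.mem_range.2 hpos) (by simp))
    obtain ⟨T, hT⟩ := this
    rw [hT, map_mul, ha', zero_mul]
  have hdegS : PS.natDegree < N + 1 := by
    rw [← natDegree_map_eq_of_injective (f := S.subtype) Subtype.val_injective, hPS, natDegree_map,
      hdeg]
    exact Nat.lt_succ_self N
  have hsum : ∑ i ∈ Finset.range (N + 1), jS (PS.coeff i) * a' ^ i = 0 := by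
    apply Subtype.ext
    rw [aeval_eq_sum_range' (hdeg.trans_lt (Nat.lt_succ_self N))] at hPdvd
    rw [AddSubmonoidClass.coe_finsetSum]
    refine Eq.trans (Finset.sum_congr rfl fun i _ => ?_) hPdvd
    have h1 := congrArg (fun p => p.coeff i) hPS
    simp only [coeff_map] at h1
    have h2 : (jS (PS.coeff i) : D) = algebraMap F D (P.coeff i) := by
      rw [hjS, ← j.commutes, ← h1]
      rfl
    rw [MulMemClass.coe_mul, h2, SubmonoidClass.coe_pow, Algebra.smul_def]
  have heval : eval₂ (red.comp jS) (red a') PS = 0 := by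
    rw [eval₂_eq_sum_range' _ hdegS, ← map_zero red, ← hsum, map_sum]
    refine Finset.sum_congr rfl fun i _ => ?_
    rw [map_mul, map_pow]
    rfl
  rw [eval₂_finsetProd, Finset.prod_eq_zero_iff] at heval
  obtain ⟨k, -, hk⟩ := heval
  rw [eval₂_sub, eval₂_X, eval₂_C, sub_eq_zero] at hk
  refine ⟨k, hk.trans ?_⟩
  rw [RingHom.comp_apply]
  congr 1
  exact Subtype.ext (hcoe k)

end RootsOfUnity

/-! ## The largest embeddable subfield -/

section LargestEmbeddable

open IsLocalRing

theorem finrank_dvd_of_algHom {k B B' : Type*} [Field k] [Field B] [Field B'] [Algebra k B]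
    [Algebra k B'] (g : B →ₐ[k] B') : Module.finrank k B ∣ Module.finrank k B' := by
  let : Algebra B B' := g.toRingHom.toAlgebra
  have : IsScalarTower k B B' := IsScalarTower.of_algHom g
  exact ⟨_, (Module.finrank_mul_finrank k B B').symm⟩

theorem exists_algHom_comp_eq {k B D M : Type*} [Field k] [Field B] [Algebra k B] [DivisionRing D]
    [Algebra k D] [Field M] [Algebra k M] (j : B →ₐ[k] D) (g : M →ₐ[k] D)
    (hg : ∀ x, g x ∈ j.range) : ∃ g' : M →ₐ[k] B, ∀ x, j (g' x) = g x := by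
  let e := AlgEquiv.ofInjective j j.toRingHom.injective
  refine ⟨e.symm.toAlgHom.comp (g.codRestrict j.range hg), fun x => ?_⟩
  exact congrArg Subtype.val (e.apply_symm_apply (g.codRestrict j.range hg x))

theorem finrank_eq_of_range_eq {k B D : Type*} [Field k] [Field B] [Algebra k B] [DivisionRing D]
    [Algebra k D] (j : B →ₐ[k] D) {L : Subalgebra k D} (hj : j.range = L) :
    Module.finrank k B = Module.finrank k L := by
  subst hj
  exact (AlgEquiv.ofInjective j j.toRingHom.injective).toLinearEquiv.finrank_eq

variable {R : Type*} [CommRing R] [IsDomain R] [IsDiscreteValuationRing R]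
variable [IsAdicComplete (maximalIdeal R) R] [Finite (ResidueField R)]
variable {F : Type*} [Field F] [Algebra R F] [IsFractionRing R F]
variable {E : Type*} [Field E] [Algebra F E] [Algebra R E] [IsScalarTower R F E]
variable {D : Type*} [DivisionRing D] [Algebra F D] [Algebra R D] [IsScalarTower R F D]
variable [FiniteDimensional F D]
variable {OD : Subalgebra R D} {ordD : D → ℤ} (hD : IsOrd OD ordD)
variable {ϖ : R} (hϖ : Irreducible ϖ) (hOD : (Subalgebra.toSubmodule OD).FG)
variable {K : IntermediateField F E} [FiniteDimensional F K]
variable {Δ : Type*} [DivisionRing Δ] [Algebra F Δ] [Algebra K Δ] [IsScalarTower F K Δ]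
variable [FiniteDimensional K Δ] [Algebra R Δ] [IsScalarTower R F Δ]
variable {OΔ : Subalgebra R Δ} {ordΔ : Δ → ℤ} (hΔ : IsOrd OΔ ordΔ)
variable (hOΔ : (Subalgebra.toSubmodule OΔ).FG)

include hD hϖ hOD hΔ hOΔ in
/-- The largest subfield of `E` which embeds in a maximal unramified extension does not change if
the base field is replaced by an unramified extension. -/
theorem largestEmbeddable_eq
    {L : Subalgebra F D} (hLcomm : ∀ x ∈ L, ∀ y ∈ L, x * y = y * x)
    (hLur : ∀ x ∈ L, x ≠ 0 → ∃ n : ℤ, ordD x = n * ordD (algebraMap R D ϖ))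
    {L' : Subalgebra K Δ} (hLcomm' : ∀ x ∈ L', ∀ y ∈ L', x * y = y * x)
    (hLur' : ∀ x ∈ L', x ≠ 0 → ∃ n : ℤ, ordΔ x = n * ordΔ (algebraMap R Δ ϖ))
    (hdeg : Module.finrank F L = Module.finrank F K * Module.finrank K L')
    {E_D : IntermediateField F E} (hED : IsLargestEmbeddable L E_D)
    {E_Δ : IntermediateField K E} (hEΔ : IsLargestEmbeddable L' E_Δ) :
    IsUnramifiedExt R F E_D ∧ FiniteDimensional F E_D ∧ (E_D : Set E) = E_Δ := by
  obtain ⟨B, _, _, j, hj⟩ := exists_field_range_eq L hLcomm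
  obtain ⟨B', _, _, j', hj'⟩ := exists_field_range_eq L' hLcomm'
  let : Algebra R B := ((algebraMap F B).comp (algebraMap R F)).toAlgebra
  have : IsScalarTower R F B := IsScalarTower.of_algebraMap_eq' rfl
  let : Algebra F B' := ((algebraMap K B').comp (algebraMap F K)).toAlgebra
  have : IsScalarTower F K B' := IsScalarTower.of_algebraMap_eq' rfl
  let : Algebra R B' := ((algebraMap F B').comp (algebraMap R F)).toAlgebra
  have : IsScalarTower R F B' := IsScalarTower.of_algebraMap_eq' rfl
  have : FiniteDimensional F Δ := Module.Finite.trans K Δ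
  have : FiniteDimensional F B :=
    FiniteDimensional.of_injective j.toLinearMap j.toRingHom.injective
  have : FiniteDimensional K B' :=
    FiniteDimensional.of_injective j'.toLinearMap j'.toRingHom.injective
  have : FiniteDimensional F B' := Module.Finite.trans K B'
  have hjL : ∀ x, j x ∈ L := fun x => hj ▸ j.mem_range_self x
  have hjL' : ∀ x, j' x ∈ L' := fun x => hj' ▸ j'.mem_range_self x
  have hBur : IsUnramifiedExt R F B := hD.isUnramifiedExt hϖ hOD j fun b hb =>
    hLur _ (hjL b) ((map_ne_zero_iff j j.toRingHom.injective).2 hb)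
  have hBur' : IsUnramifiedExt R F B' := hΔ.isUnramifiedExt hϖ hOΔ (j'.restrictScalars F)
    fun b hb => hLur' _ (hjL' b) ((map_ne_zero_iff j' j'.toRingHom.injective).2 hb)
  have hfB : Module.finrank F B = Module.finrank F L := finrank_eq_of_range_eq j hj
  have hfB' : Module.finrank K B' = Module.finrank K L' := finrank_eq_of_range_eq j' hj'
  have hfB'' : Module.finrank F B' = Module.finrank F K * Module.finrank K L' := by
    rw [← hfB', Module.finrank_mul_finrank]
  -- The image of `K` lies in `L'`, so its value group is that of `F`.
  have hKur : IsUnramifiedExt R F K := hΔ.isUnramifiedExt hϖ hOΔ (IsScalarTower.toAlgHom F K Δ)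
    fun c hc => hLur' _ (L'.algebraMap_mem c)
      ((map_ne_zero_iff _ (algebraMap K Δ).injective).2 hc)
  -- `K` is contained in `E_D`
  have hKD : K ≤ E_D := by
    obtain ⟨g⟩ := hKur.nonempty_algHom hBur (by rw [hfB, hdeg]; exact dvd_mul_right _ _) F
    exact hED.2 ⟨j.comp g, fun x => hjL _⟩
  obtain ⟨g, hg⟩ := hED.1
  obtain ⟨g', hg'⟩ := hEΔ.1
  have hEDur : IsUnramifiedExt R F E_D := hD.isUnramifiedExt hϖ hOD g fun b hb =>
    hLur _ (hg b) ((map_ne_zero_iff g g.toRingHom.injective).2 hb)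
  have hEDfin : FiniteDimensional F E_D :=
    FiniteDimensional.of_injective g.toLinearMap g.toRingHom.injective
  have hEΔfin : FiniteDimensional K E_Δ :=
    FiniteDimensional.of_injective g'.toLinearMap g'.toRingHom.injective
  have : Module.Free K E_Δ := Module.Free.of_divisionRing K E_Δ
  have hfE : Module.finrank F E_Δ = Module.finrank F K * Module.finrank K E_Δ :=
    (Module.finrank_mul_finrank F K E_Δ).symm
  -- `E_D` is contained in `E_Δ`
  have hle : (E_D : Set E) ⊆ E_Δ := by
    let M := IntermediateField.extendScalars hKD
    let : Algebra R M := ((algebraMap F M).comp (algebraMap R F)).toAlgebra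
    have : IsScalarTower R F M := IsScalarTower.of_algebraMap_eq' rfl
    let i : M ≃ₐ[F] E_D :=
      { toFun := fun x => ⟨x, x.2⟩
        invFun := fun x => ⟨x, x.2⟩
        left_inv := fun _ => rfl
        right_inv := fun _ => rfl
        map_mul' := fun _ _ => rfl
        map_add' := fun _ _ => rfl
        commutes' := fun _ => rfl }
    have : FiniteDimensional F M := Module.Finite.equiv i.symm.toLinearEquiv
    have hMur : IsUnramifiedExt R F M := hD.isUnramifiedExt hϖ hOD (g.comp i.toAlgHom)
      fun b hb => hLur _ (hg _) ((map_ne_zero_iff _ (g.comp i.toAlgHom).toRingHom.injective).2 hb)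
    obtain ⟨g₁, -⟩ := exists_algHom_comp_eq j g fun x => hj ▸ hg x
    -- The degree of `E_D` divides that of `L`, which is the degree of `L'` over `F`; so `E_D`
    -- embeds into `L'`, and over `K` because it contains `K`.
    obtain ⟨e⟩ := hMur.nonempty_algHom hBur' (by
      rw [i.toLinearEquiv.finrank_eq, hfB'', ← hdeg, ← hfB]
      exact finrank_dvd_of_algHom g₁) K
    have hM : M ≤ E_Δ := hEΔ.2 ⟨j'.comp e, fun x => hjL' _⟩
    exact hM
  have hle' : (E_Δ : Set E) ⊆ E_D := by
    let M := IntermediateField.restrictScalars F E_Δ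
    have : FiniteDimensional F E_Δ := Module.Finite.trans K E_Δ
    let i : M ≃ₐ[F] E_Δ :=
      { toFun := fun x => ⟨x, x.2⟩
        invFun := fun x => ⟨x, x.2⟩
        left_inv := fun _ => rfl
        right_inv := fun _ => rfl
        map_mul' := fun _ _ => rfl
        map_add' := fun _ _ => rfl
        commutes' := fun _ => rfl }
    have : FiniteDimensional F M := Module.Finite.equiv i.symm.toLinearEquiv
    let g₂ : M →ₐ[F] Δ := (g'.restrictScalars F).comp i.toAlgHom
    have hMur : IsUnramifiedExt R F M := hΔ.isUnramifiedExt hϖ hOΔ g₂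
      fun b hb => hLur' _ (hg' _) ((map_ne_zero_iff _ g₂.toRingHom.injective).2 hb)
    obtain ⟨g₁, -⟩ := exists_algHom_comp_eq j' g' fun x => hj' ▸ hg' x
    obtain ⟨e⟩ := hMur.nonempty_algHom hBur (by
      rw [i.toLinearEquiv.finrank_eq, hfB, hdeg, hfE, ← hfB']
      exact mul_dvd_mul_left _ (finrank_dvd_of_algHom g₁)) F
    have hM : M ≤ E_D := hED.2 ⟨j.comp e, fun x => hjL _⟩
    exact hM
  exact ⟨hEDur, hEDfin, hle.antisymm hle'⟩

end LargestEmbeddable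

/-! ## Multiplicities -/

section Multiplicities

open MulOpposite Matrix

/-- The entries of `row lam` as multiplicities. -/
theorem card_pearlIndex_dvd {f r : ℕ} (lam : Matrix (Fin f) (Fin r) ℕ) (m : Fin (f * r)) {k : ℤ}
    (hk : ((f * r : ℕ) : ℤ) ∣ m - k) :
    Nat.card {q : PearlIndex lam // ((f * r : ℕ) : ℤ) ∣ r * (q.2.1 : ℕ) + (q.1 : ℕ) - k} =
      lam m.divNat m.modNat := by
  have hval : ∀ (i : Fin f) (j : Fin r), (r * (i : ℕ) + (j : ℕ) : ℕ) < f * r := fun i j =>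
    calc (r * (i : ℕ) + j : ℕ) < r * i + r := Nat.add_lt_add_left j.2 _
      _ = (i + 1) * r := by ring
      _ ≤ f * r := Nat.mul_le_mul_right r i.2
  have hm : r * (m.divNat : ℕ) + (m.modNat : ℕ) = m := by
    rw [Fin.coe_divNat, Fin.coe_modNat]
    exact Nat.div_add_mod _ _
  -- The numbers `r i + j` lie between `0` and `f r - 1` and determine `i` and `j`, so a congruence
  -- modulo `f r` selects one entry.
  have hiff : ∀ (i : Fin f) (j : Fin r), ((f * r : ℕ) : ℤ) ∣ r * (i : ℕ) + (j : ℕ) - k ↔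
      i = m.divNat ∧ j = m.modNat := by
    intro i j
    constructor
    · intro h
      have h1 : ((f * r : ℕ) : ℤ) ∣ ((r * (i : ℕ) + (j : ℕ) : ℕ) : ℤ) - (m : ℕ) := by
        have := dvd_sub h hk
        rw [sub_sub_sub_cancel_right] at this
        push_cast at this ⊢
        exact this
      have h2 : (r * (i : ℕ) + (j : ℕ) : ℕ) = m := by
        have h3 := hval i j
        have h4 := m.2
        generalize (r * (i : ℕ) + (j : ℕ) : ℕ) = x at h1 h3 ⊢
        generalize (m : ℕ) = y at h1 h4 ⊢
        generalize f * r = n at h1 h3 h4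
        have h5 := Int.eq_zero_of_abs_lt_dvd h1 (by rw [abs_lt]; lia)
        lia
      have hr : 0 < r := j.pos
      constructor
      · apply Fin.ext
        rw [Fin.coe_divNat, ← h2, Nat.mul_add_div hr, Nat.div_eq_of_lt j.2, add_zero]
      · apply Fin.ext
        rw [Fin.coe_modNat, ← h2, Nat.mul_add_mod, Nat.mod_eq_of_lt j.2]
    · rintro ⟨rfl, rfl⟩
      have : ((r * (m.divNat : ℕ) + (m.modNat : ℕ) : ℕ) : ℤ) = (m : ℕ) := by rw [hm]
      push_cast at this
      rwa [this]
  let g : Fin (lam m.divNat m.modNat) → {q : PearlIndex lam //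
      ((f * r : ℕ) : ℤ) ∣ r * (q.2.1 : ℕ) + (q.1 : ℕ) - k} := fun x =>
    ⟨⟨m.modNat, m.divNat, x⟩, (hiff _ _).2 ⟨rfl, rfl⟩⟩
  have hg : Function.Bijective g := by
    constructor
    · intro x y hxy
      have := congrArg Subtype.val hxy
      simpa [g] using this
    · rintro ⟨⟨j, i, x⟩, hq⟩
      obtain ⟨rfl, rfl⟩ := (hiff i j).1 hq
      exact ⟨x, rfl⟩
  rw [← Nat.card_congr (Equiv.ofBijective g hg), Nat.card_eq_fintype_card, Fintype.card_fin]

/-- Equal multiplicities up to a shift mean that the rows are rotated. -/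
theorem isRotated_row_of_card_eq {f r f' r' : ℕ} (lam : Matrix (Fin f) (Fin r) ℕ)
    (lam' : Matrix (Fin f') (Fin r') ℕ) (hf : f * r = f' * r') (hpos : 0 < f * r) (C : ℤ)
    (h : ∀ k : ℤ, Nat.card {p : PearlIndex lam //
        ((f * r : ℕ) : ℤ) ∣ r * (p.2.1 : ℕ) + (p.1 : ℕ) - k} =
      Nat.card {q : PearlIndex lam' //
        ((f * r : ℕ) : ℤ) ∣ r' * (q.2.1 : ℕ) + (q.1 : ℕ) - (k - C)}) :
    (_root_.row lam).IsRotated (_root_.row lam') := by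
  have hpos' : (0 : ℤ) < ((f * r : ℕ) : ℤ) := by exact_mod_cast hpos
  -- The number of rotations is the shift reduced modulo the common length.
  obtain ⟨n, hn⟩ : ∃ n : ℕ, (n : ℤ) = C % ((f * r : ℕ) : ℤ) :=
    ⟨_, Int.toNat_of_nonneg (Int.emod_nonneg _ hpos'.ne')⟩
  refine ⟨n, List.ext_getElem (by simp [_root_.row, hf]) fun m h1 h2 => ?_⟩
  have hlen : (_root_.row lam).length = f * r := by simp [_root_.row]
  have hm : m < f' * r' := by simpa [_root_.row] using h2
  rw [List.getElem_rotate]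
  simp only [hlen]
  have hk : (m + n) % (f * r) < f * r := Nat.mod_lt _ hpos
  simp only [_root_.row, List.getElem_ofFn]
  have e1 := card_pearlIndex_dvd lam ⟨_, hk⟩ (k := m + C) (by
    have : (((m + n) % (f * r) : ℕ) : ℤ) = (m + n : ℤ) % ((f * r : ℕ) : ℤ) := by push_cast; rfl
    rw [this, hn, Int.dvd_iff_emod_eq_zero]
    simp [Int.sub_emod])
  have e2 := card_pearlIndex_dvd lam' ⟨m, hm⟩ (k := m + C - C) (by simp)
  rw [← e1, ← e2, h, hf]

variable {R : Type*} [CommRing R] {F : Type*} [Field F]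
variable {D : Type*} [DivisionRing D] [Algebra F D] [Algebra R D]
variable {O : Subalgebra R D} {ord : D → ℤ} (hD : IsOrd O ord)
variable {κ : Type*} [Field κ] {red : O →+* κ} (hker : ∀ x : O, red x = 0 ↔ (x : D) ∈ hD.ball 1)
variable {V : Type*} [AddCommGroup V] [Module Dᵐᵒᵖ V] [Module F V] [IsScalarTower F Dᵐᵒᵖ V]
variable {Δ : Type*} [DivisionRing Δ] [Algebra F Δ] {ordΔ : Δ → ℤ}

include hD in
theorem IsOrd.mem_of_pow_eq_one {x : D} {n : ℕ} (hn : n ≠ 0) (hx : x ^ n = 1) :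
    x ∈ O := by
  have hx0 : x ≠ 0 := by
    rintro rfl
    rw [zero_pow hn] at hx
    exact zero_ne_one hx
  have h1 := hD.map_pow hx0 n
  rw [hx, hD.map_one] at h1
  rw [hD.mem_iff hx0]
  have h2 : (n : ℤ) ≠ 0 := by exact_mod_cast hn
  rcases mul_eq_zero.1 h1.symm with h3 | h3
  · exact absurd h3 h2
  · exact h3.ge

include hker in
/-- The embedding types are determined by the action of a root of unity on the reduction of the
lattice. -/
theorem isRotated_row_of_pearlMatrix {f r f' r' : ℕ} {lam : Matrix (Fin f) (Fin r) ℕ}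
    {lam' : Matrix (Fin f') (Fin r') ℕ} (hf : f * r = f' * r') (hpos : 0 < f * r)
    {w : Module.Basis (PearlIndex lam) Dᵐᵒᵖ V} {w' : Module.Basis (PearlIndex lam') Dᵐᵒᵖ V}
    {c₀ c₁ : ℤ}
    (hc : hD.lattice w (fun p => c₀ - (p.1 : ℕ)) = hD.lattice w' (fun p => c₁ - (p.1 : ℕ)))
    {ρ : Matrix (PearlIndex lam) (PearlIndex lam) D →ₐ[F] Module.End Dᵐᵒᵖ V}
    {ρ' : Matrix (PearlIndex lam') (PearlIndex lam') Δ →ₐ[F] Module.End Dᵐᵒᵖ V}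
    {θ : D →ₐ[F] D} {θ' : Δ →ₐ[F] D}
    (hw : ∀ N q, ρ N (w q) = ∑ p, op (θ (N p q)) • w p)
    (hw' : ∀ N q, ρ' N (w' q) = ∑ p, op (θ' (N p q)) • w' p)
    {π : D} (hπ0 : π ≠ 0) (hπ : ord (θ π) = r) {π₁ : D} (hπ₁0 : π₁ ≠ 0) (hπ₁ : ord π₁ = 1)
    {π' : Δ} (hπ'0 : π' ≠ 0) (hπ' : ord (θ' π') = r')
    {B : Type*} [Field B] [Algebra F B] [FiniteDimensional F B] (j : B →ₐ[F] D)
    (hnorm : ∀ x, ∃ y, j y = π₁ * j x * π₁⁻¹)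
    (hgen : ∀ x, π₁ * j x * π₁⁻¹ = j x → x ∈ (algebraMap F B).range)
    {z : D} {b : B} (hz : θ z = j b) {n : ℕ} (hn0 : n ≠ 0) (hb : b ^ n = 1) (hn : (n : κ) ≠ 0)
    (hdeg : (minpoly F b).natDegree = f * r) {z' : Δ} (hz'n : z' ^ n = 1)
    (hz' : Polynomial.aeval z' (minpoly F b) = 0)
    (hzz' : ρ (pearlMatrix π lam z) = ρ' (pearlMatrix π' lam' z')) :
    (_root_.row lam).IsRotated (_root_.row lam') := by
  have hinj : ∀ {X : Type _} [DivisionRing X] [Algebra F X] (g : X →ₐ[F] D) {x : X}, x ≠ 0 →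
    g x ≠ 0 := fun g _ hx => (map_ne_zero_iff g g.toRingHom.injective).2 hx
  let u : Dˣ := Units.mk0 π₁ hπ₁0
  have hu : ord u = 1 := hπ₁
  have hou : ∀ k : ℤ, ord ((u ^ k : Dˣ) : D) = k := fun k => by
    rw [Units.val_zpow_eq_zpow_val, hD.map_zpow u.ne_zero, hu, mul_one]
  have hθzn : (θ z) ^ n = 1 := by rw [hz, ← map_pow, hb, map_one]
  have hθzn' : (θ' z') ^ n = 1 := by rw [← map_pow, hz'n, map_one]
  let a : O := ⟨θ z, hD.mem_of_pow_eq_one hn0 hθzn⟩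
  let a' : O := ⟨θ' z', hD.mem_of_pow_eq_one hn0 hθzn'⟩
  let v : Dˣ := Units.mk0 (θ π) (hinj θ hπ0)
  let v' : Dˣ := Units.mk0 (θ' π') ((map_ne_zero_iff θ' θ'.toRingHom.injective).2 hπ'0)
  have hnorm' : ∀ x, ∃ y, j y = u * j x * (u⁻¹ : Dˣ) := by
    simpa [u] using hnorm
  have hgen' : ∀ x, u * j x * (u⁻¹ : Dˣ) = j x → x ∈ (algebraMap F B).range := by
    simpa [u] using hgen
  -- `θ z` and `θ' z'` are roots of the same minimal polynomial, but their reductions may differ by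
  -- a power `t` of the residue automorphism.
  obtain ⟨t, ht⟩ := exists_red_eq_red_conjHom hD (red := red) j hnorm' hgen' (b := b) (a := a) hz
    (a' := a') (by
      change Polynomial.aeval (θ' z') (minpoly F b) = 0
      rw [Polynomial.aeval_algHom_apply, hz', map_zero])
  have hiff := red_conjHom_zpow_eq_iff hD hker j hnorm' hgen' (b := b) (a := a) hz hn0 hb hn
  rw [hdeg] at hiff
  have hα : ∀ p, ρ (pearlMatrix π lam z) (w p) =
      op (hD.conjHom (v ^ (p.2.1 : ℕ)) a : D) • w p := by
    intro p
    rw [hw, Finset.sum_eq_single p]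
    · simp [pearlMatrix, hD.coe_conjHom, v, a]
    · intro q _ hq
      simp [pearlMatrix, diagonal_apply_ne _ hq]
    · simp
  have hα' : ∀ p, ρ (pearlMatrix π lam z) (w' p) =
      op (hD.conjHom (v' ^ (p.2.1 : ℕ)) a' : D) • w' p := by
    intro p
    rw [hzz', hw', Finset.sum_eq_single p]
    · simp [pearlMatrix, hD.coe_conjHom, v', a']
    · intro q _ hq
      simp [pearlMatrix, diagonal_apply_ne _ hq]
    · simp
  -- The uniformizer of the pearl embedding has order `r`, so piece `i` of block `j` contributes `r
  -- i`, and the exponent of the basis vector contributes `j - c₀`.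
  have hcol : ∀ p : PearlIndex lam,
      red (hD.conjHom (u ^ (-(c₀ - ((p.1 : ℕ) : ℤ)))) (hD.conjHom (v ^ (p.2.1 : ℕ)) a)) =
      red (hD.conjHom (u ^ (r * ((p.2.1 : ℕ) : ℤ) + ((p.1 : ℕ) : ℤ) - c₀)) a) := by
    intro p
    rw [← hD.conjHom_mul]
    refine hD.red_conjHom_eq_of_ord_eq ?_ _
    rw [Units.val_mul, hD.map_mul (Units.ne_zero _) (Units.ne_zero _), hou, hou,
      Units.val_pow_eq_pow_val, hD.map_pow v.ne_zero]
    change -(c₀ - _) + _ * ord (θ π) = _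
    rw [hπ]
    ring
  have hcol' : ∀ p : PearlIndex lam',
      red (hD.conjHom (u ^ (-(c₁ - ((p.1 : ℕ) : ℤ)))) (hD.conjHom (v' ^ (p.2.1 : ℕ)) a')) =
      red (hD.conjHom (u ^ (r' * ((p.2.1 : ℕ) : ℤ) + ((p.1 : ℕ) : ℤ) - c₁ + t)) a) := by
    intro p
    rw [← hD.conjHom_mul, hD.red_conjHom_congr hker _ ht, ← hD.conjHom_mul]
    refine hD.red_conjHom_eq_of_ord_eq ?_ _
    rw [Units.val_mul, Units.val_mul,
      hD.map_mul (mul_ne_zero (Units.ne_zero _) (Units.ne_zero _)) (Units.ne_zero _),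
      hD.map_mul (Units.ne_zero _) (Units.ne_zero _), hou, hou, hou,
      Units.val_pow_eq_pow_val, hD.map_pow v'.ne_zero]
    change -(c₁ - _) + _ * ord (θ' π') + t = _
    rw [hπ']
    ring
  refine isRotated_row_of_card_eq lam lam' hf hpos (c₀ - c₁ + t) fun k => ?_
  have e1 : ∀ p : PearlIndex lam, ((f * r : ℕ) : ℤ) ∣ r * (p.2.1 : ℕ) + (p.1 : ℕ) - k ↔
      red (hD.conjHom (u ^ (-(c₀ - ((p.1 : ℕ) : ℤ)))) (hD.conjHom (v ^ (p.2.1 : ℕ)) a)) =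
        red (hD.conjHom (u ^ (k - c₀)) a) := by
    intro p
    rw [hcol, hiff]
    ring_nf
  have e2 : ∀ p : PearlIndex lam', ((f * r : ℕ) : ℤ) ∣
        r' * (p.2.1 : ℕ) + (p.1 : ℕ) - (k - (c₀ - c₁ + t)) ↔
      red (hD.conjHom (u ^ (-(c₁ - ((p.1 : ℕ) : ℤ)))) (hD.conjHom (v' ^ (p.2.1 : ℕ)) a')) =
        red (hD.conjHom (u ^ (k - c₀)) a) := by
    intro p
    rw [hcol', hiff]
    ring_nf
  simp only [e1, e2]
  exact le_antisymm (hD.card_eigenvalue_le hc hu hα hα' _)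
    (hD.card_eigenvalue_le hc.symm hu hα' hα _)

end Multiplicities

/-! ## The rank reduction over a complete discrete valuation ring -/

section RankReduction

open MulOpposite Matrix IsLocalRing

/-- A strictly increasing sequence of integers grows by at least one at each step. -/
theorem sub_le_sub_of_strictMono {r : ℕ} {g : Fin r → ℤ} (hg : StrictMono g) {i j : Fin r}
    (hij : i ≤ j) : ((j : ℕ) : ℤ) - (i : ℕ) ≤ g j - g i := by
  obtain ⟨j, hj⟩ := j
  induction j with
  | zero =>
    have : i = ⟨0, hj⟩ := le_antisymm hij (Fin.mk_le_of_le_val (Nat.zero_le _))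
    rw [this]
    lia
  | succ j ih =>
    rcases eq_or_lt_of_le hij with h | h
    · rw [h]
      lia
    · have h1 : i ≤ ⟨j, by lia⟩ := Fin.le_def.2 (Nat.lt_succ_iff.1 (Fin.lt_def.1 h))
      have h2 := ih (by lia) h1
      have h3 := hg (show (⟨j, by lia⟩ : Fin r) < ⟨j + 1, hj⟩ from Fin.mk_lt_mk.2 (by lia))
      have h4 : (((⟨j, by lia⟩ : Fin r) : ℕ) : ℤ) = j := rfl
      have h5 : (((⟨j + 1, hj⟩ : Fin r) : ℕ) : ℤ) = j + 1 := by push_cast; rfl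
      lia

/-- The exponents of an adapted basis. -/
theorem blocks_of_strict {I : Type*} {r : ℕ} {b : I → Fin r} (hb : Function.Surjective b)
    {c : I → ℤ} {e : ℕ} (heq : ∀ p q, b p = b q → c p = c q) (hlt : ∀ p q, b p < b q → c q < c p)
    (hce : ∀ p q, c p - c q < e) (hr : 0 < r) :
    r ≤ e ∧ (r = e → ∃ C : ℤ, ∀ p, c p = C - (b p : ℕ)) := by
  obtain ⟨g, hg⟩ := hb.hasRightInverse
  -- The `r` blocks have distinct exponents in a range of spread less than `e`, so `r ≤ e`; if `r =
  -- e` there are no gaps.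
  have hmono : StrictMono fun i => -c (g i) := fun i j hij => by
    have := hlt (g i) (g j) (by rwa [hg, hg])
    lia
  have h0 : ∀ i : Fin r, (⟨0, hr⟩ : Fin r) ≤ i := fun i => Fin.mk_le_of_le_val (Nat.zero_le _)
  have hl : ∀ i : Fin r, i ≤ (⟨r - 1, by lia⟩ : Fin r) := fun i => Fin.le_def.2 (by
    have := i.2
    change (i : ℕ) ≤ r - 1
    lia)
  have v0 : (((⟨0, hr⟩ : Fin r) : ℕ) : ℤ) = 0 := rfl
  have vl : (((⟨r - 1, by lia⟩ : Fin r) : ℕ) : ℤ) = r - 1 := by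
    change ((r - 1 : ℕ) : ℤ) = r - 1
    lia
  have key := hce (g ⟨0, hr⟩) (g ⟨r - 1, by lia⟩)
  constructor
  · have h1 := sub_le_sub_of_strictMono hmono (h0 ⟨r - 1, by lia⟩)
    simp only [v0, vl] at h1
    lia
  · intro hre
    refine ⟨c (g ⟨0, hr⟩), fun p => ?_⟩
    have h1 := sub_le_sub_of_strictMono hmono (h0 (b p))
    have h2 := sub_le_sub_of_strictMono hmono (hl (b p))
    simp only [v0, vl] at h1 h2
    have h3 : c (g (b p)) = c p := heq _ _ (hg _)
    lia

/-- The pearl embedding as a homomorphism of algebras. -/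
def pearlHom (F : Type*) [Field F] {D : Type*} [DivisionRing D] [Algebra F D] {π : D} (hπ : π ≠ 0)
    {f r : ℕ} (lam : Matrix (Fin f) (Fin r) ℕ) :
    D →ₐ[F] Matrix (PearlIndex lam) (PearlIndex lam) D where
  toFun := pearlMatrix π lam
  map_one' := by simp [pearlMatrix, hπ]
  map_mul' x y := by
    simp only [pearlMatrix, diagonal_mul_diagonal]
    congr 1
    ext p
    have := pow_ne_zero (p.2.1 : ℕ) hπ
    simp only [mul_assoc]
    rw [inv_mul_cancel_left₀ this]
  map_zero' := by simp [pearlMatrix]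
  map_add' x y := by simp [pearlMatrix, mul_add, add_mul]
  commutes' c := by
    rw [pearlMatrix, Matrix.algebraMap_eq_diagonal]
    congr 1
    ext p
    have := pow_ne_zero (p.2.1 : ℕ) hπ
    rw [← Algebra.commutes, mul_assoc, mul_inv_cancel₀ this, mul_one]
    rfl

theorem finrank_eq_of_image_eq {F A E X : Type*} [Field F] [AddCommGroup A] [Module F A]
    [AddCommGroup E] [Module F E] [AddCommGroup X] [Module F X] {i : E →ₗ[F] A} {g : X →ₗ[F] A}
    (hi : Function.Injective i) (hg : Function.Injective g) {M : Submodule F E}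
    {N : Submodule F X} (h : i '' (M : Set E) = g '' (N : Set X)) :
    Module.finrank F M = Module.finrank F N := by
  have h1 : M.map i = N.map g := SetLike.coe_injective h
  rw [(Submodule.equivMapOfInjective i hi M).finrank_eq, h1,
    ← (Submodule.equivMapOfInjective g hg N).finrank_eq]

variable {R : Type*} [CommRing R] [IsDomain R] [IsDiscreteValuationRing R]
variable [IsAdicComplete (maximalIdeal R) R] [Finite (ResidueField R)]
variable {F : Type*} [Field F] [Algebra R F] [IsFractionRing R F]
variable {E : Type*} [Field E] [Algebra F E] [Algebra R E] [IsScalarTower R F E]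
variable {D : Type*} [DivisionRing D] [Algebra F D] [Algebra R D] [IsScalarTower R F D]
variable [FiniteDimensional F D] [Algebra.IsCentral F D]
variable {OD : Subalgebra R D} {ordD : D → ℤ} (hD : IsOrd OD ordD)
variable {ϖ : R} (hϖ : Irreducible ϖ) (hOD : (Subalgebra.toSubmodule OD).FG)
variable {K : IntermediateField F E} [FiniteDimensional F K]
variable {Δ : Type*} [DivisionRing Δ] [Algebra F Δ] [Algebra K Δ] [IsScalarTower F K Δ]
variable [FiniteDimensional K Δ] [Algebra R Δ] [IsScalarTower R F Δ] [Algebra.IsCentral K Δ]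
variable {OΔ : Subalgebra R Δ} {ordΔ : Δ → ℤ} (hΔ : IsOrd OΔ ordΔ)
variable (hOΔ : (Subalgebra.toSubmodule OΔ).FG)
variable {V : Type*} [AddCommGroup V] [Module Dᵐᵒᵖ V] [Module F V] [IsScalarTower F Dᵐᵒᵖ V]
variable [FiniteDimensional Dᵐᵒᵖ V] [Nontrivial V] [Module R V] [IsScalarTower R F V]

include hϖ hOD hOΔ in
/-- The rank reduction lemma in terms of the action of matrix algebras on a lattice: `ρ`, `ρs` and
`ρ'` belong to the pearl embedding of `E_D`, to the order of rank `s` in the centraliser of `K`, and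
to the pearl embedding of `E_Δ`. -/
theorem rank_reduction {I₁ : Type*} [Fintype I₁] [DecidableEq I₁]
    (v : Module.Basis I₁ Dᵐᵒᵖ V) (ι : E →ₐ[F] Module.End Dᵐᵒᵖ V)
    {s : ℕ} (hs : Module.finrank F K = s) {f r f' r' : ℕ} (lam : Matrix (Fin f) (Fin r) ℕ)
    (lam' : Matrix (Fin f') (Fin r') ℕ) (hcol : ∀ j, ∃ i, 0 < lam i j)
    (hcol' : ∀ j, ∃ i, 0 < lam' i j)
    {ρ : Matrix (PearlIndex lam) (PearlIndex lam) D →ₐ[F] Module.End Dᵐᵒᵖ V}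
    (hρbij : Function.Bijective ρ)
    (hρ : ∀ N, (∀ x ∈ hD.lattice v 0, ρ N x ∈ hD.lattice v 0) ↔
      ∀ p q, N p q ∈ hD.ball (if p.1 < q.1 then 1 else 0))
    {n : Fin s → ℕ} (hn : ∀ j, 0 < n j)
    {ρs : Matrix (Σ j, Fin (n j)) (Σ j, Fin (n j)) Δ →ₐ[F] Module.End Dᵐᵒᵖ V}
    (hρs_inj : Function.Injective ρs)
    (hρs_range : ∀ a, a ∈ ρs.range ↔ ∀ c : K, ι c * a = a * ι c)
    (hρs : ∀ N, (∀ x ∈ hD.lattice v 0, ρs N x ∈ hD.lattice v 0) ↔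
      ∀ p q, N p q ∈ hΔ.ball (if p.1 < q.1 then 1 else 0))
    {ρ' : Matrix (PearlIndex lam') (PearlIndex lam') Δ →ₐ[F] Module.End Dᵐᵒᵖ V}
    (hρ'_inj : Function.Injective ρ')
    (hρ'_range : ∀ a, a ∈ ρ'.range ↔ ∀ c : K, ι c * a = a * ι c)
    (hρ' : ∀ N, (∀ x ∈ hD.lattice v 0, ρ' N x ∈ hD.lattice v 0) ↔
      ∀ p q, N p q ∈ hΔ.ball (if p.1 < q.1 then 1 else 0))
    {L Lf : Subalgebra F D} (hLcomm : ∀ x ∈ L, ∀ y ∈ L, x * y = y * x)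
    (hLdeg : Module.finrank F L ^ 2 = Module.finrank F D)
    (hLur : ∀ x ∈ L, x ≠ 0 → ∃ n : ℤ, ordD x = n * ordD (algebraMap R D ϖ))
    {π : D} (hπ0 : π ≠ 0) (hπ : ordD π = 1) (hπL : ∀ x ∈ L, π * x * π⁻¹ ∈ L)
    (hπgen : ∀ x ∈ L, π * x * π⁻¹ = x → x ∈ (algebraMap F D).range)
    {L' Lf' : Subalgebra K Δ} (hLcomm' : ∀ x ∈ L', ∀ y ∈ L', x * y = y * x)
    (hLdeg' : Module.finrank K L' ^ 2 = Module.finrank K Δ)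
    (hLur' : ∀ x ∈ L', x ≠ 0 → ∃ c : K, c ≠ 0 ∧ ordΔ x = ordΔ (algebraMap K Δ c))
    {π' : Δ} (hπ'0 : π' ≠ 0) (hπ' : ordΔ π' = 1)
    {E_D : IntermediateField F E} (hED : IsLargestEmbeddable L E_D)
    {E_Δ : IntermediateField K E} (hEΔ : IsLargestEmbeddable L' E_Δ)
    (hLf : Lf ≤ L) (hLff : Module.finrank F Lf = f) (hLff' : Module.finrank K Lf' = f')
    (himg : ι '' (E_D : Set E) = (fun z => ρ (pearlMatrix π lam z)) '' (Lf : Set D))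
    (himg' : ι '' (E_Δ : Set E) = (fun z => ρ' (pearlMatrix π' lam' z)) '' (Lf' : Set Δ)) :
    r = 1 ∧ f = f' * r' ∧ (_root_.row lam).IsRotated (_root_.row lam') := by
  have hq := Finite.one_lt_card (α := ResidueField R)
  have : FiniteDimensional F Δ := Module.Finite.trans K Δ
  have hspos : 0 < s := hs ▸ Module.finrank_pos
  have hVpos : 0 < Module.finrank Dᵐᵒᵖ V := Module.finrank_pos
  -- the invariants of `D` and `Δ`
  set d := Module.finrank F L with hd
  set δ := Module.finrank K L' with hδ
  obtain ⟨hQD, hoD⟩ := hD.residue_card_eq (F := F) hϖ hOD hLdeg.symm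
    (Subalgebra.toSubmodule L) rfl hLur
  obtain ⟨t, rfl⟩ : ∃ t, s = t + 1 := ⟨s - 1, by lia⟩
  let p₀ : Fin (t + 1) → Σ j, Fin (n j) := fun j => ⟨j, 0, hn j⟩
  obtain ⟨hdδ, hoΔ, hQΔ⟩ := index_eq_of_chain (ι.comp K.val) ρs hD hϖ hOD hΔ hOΔ hρs_inj
    hρs_range hLdeg.symm hLdeg'.symm hs hQD v p₀ (fun i j x => by
      rw [hρs]
      constructor
      · intro h
        simpa using h (p₀ j) (p₀ i)
      · intro h p q
        rw [single_apply]
        by_cases h1 : p₀ j = p ∧ p₀ i = q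
        · rw [if_pos h1, ← h1.1, ← h1.2]
          exact h
        · rw [if_neg h1]
          exact zero_mem _)
  have hdpos : 0 < d := by
    rcases Nat.eq_zero_or_pos d with h | h
    · have := Module.finrank_pos (R := F) (M := D)
      rw [← hLdeg, h] at this
      simp at this
    · exact h
  -- The residue degree is the largest possible, so `K` is unramified over `F`; thus `L'`, which is
  -- unramified over `K`, is unramified over `F`.
  have hKur := (hΔ.residue_card_le F hϖ hOΔ K hLdeg'.symm).2 (by rw [hQΔ, hs])
  have hLur'' : ∀ x ∈ L', x ≠ 0 → ∃ n : ℤ, ordΔ x = n * ordΔ (algebraMap R Δ ϖ) := by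
    intro x hx hx0
    obtain ⟨c, hc, hxc⟩ := hLur' x hx hx0
    obtain ⟨k, hk⟩ := hKur c hc
    exact ⟨k, hxc.trans hk⟩
  -- the sizes of the matrix algebras
  have hcards := card_mul_eq_of_range_eq_centralizer (ι.comp K.val) ρs hρs_inj hρs_range
    hLdeg.symm hLdeg'.symm
  have hcard' := card_mul_eq_of_range_eq_centralizer (ι.comp K.val) ρ' hρ'_inj hρ'_range
    hLdeg.symm hLdeg'.symm
  rw [hs, ← hdδ] at hcards hcard'
  replace hcards := (Nat.eq_of_mul_eq_mul_right hdpos hcards).symm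
  replace hcard' := (Nat.eq_of_mul_eq_mul_right hdpos hcard').symm
  have hne : Nonempty (PearlIndex lam) := by
    by_contra hcon
    rw [not_nonempty_iff] at hcon
    obtain ⟨a, b, hab⟩ := exists_pair_ne (Module.End Dᵐᵒᵖ V)
    obtain ⟨M, rfl⟩ := hρbij.2 a
    obtain ⟨N, rfl⟩ := hρbij.2 b
    exact hab (congrArg ρ (Subsingleton.elim M N))
  have hnes : Nonempty (Σ j, Fin (n j)) := ⟨p₀ 0⟩
  have hne' : Nonempty (PearlIndex lam') := Fintype.card_pos_iff.1 (hcard' ▸ hVpos)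
  have hcard := finrank_eq_card_of_surjective ρ hρbij
  -- adapted bases
  obtain ⟨w, θ, c, hw, hwρ, hθ, hceq, hclt, hcspan⟩ := exists_adapted_basis hD hD hϖ hOD v ρ hcard
    (fun p => p.1) hρ (e := (1 : ℕ)) (by simp)
  have hos : ordD (algebraMap R D ϖ) = (t + 1 : ℕ) * ordΔ (algebraMap R Δ ϖ) := by
    rw [hoD, hoΔ, hdδ]
    push_cast
    ring
  obtain ⟨ws, θs, cs, hws, hwsρ, hθs, hceqs, hclts, hcspans⟩ := exists_adapted_basis hD hΔ hϖ hOΔ v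
    ρs hcards (fun p => p.1) hρs hos
  obtain ⟨w', θ', c', hw', hwρ', hθ', hceq', hclt', hcspan'⟩ := exists_adapted_basis hD hΔ hϖ hOΔ v
    ρ' hcard' (fun p => p.1) hρ' hos
  have hbsurj : Function.Surjective fun p : PearlIndex lam => p.1 := fun j => by
    obtain ⟨i, hi⟩ := hcol j
    exact ⟨⟨j, i, 0, hi⟩, rfl⟩
  have hbsurj' : Function.Surjective fun p : PearlIndex lam' => p.1 := fun j => by
    obtain ⟨i, hi⟩ := hcol' j
    exact ⟨⟨j, i, 0, hi⟩, rfl⟩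
  have hbsurjs : Function.Surjective fun p : Σ j, Fin (n j) => p.1 := fun j => ⟨p₀ j, rfl⟩
  have hrpos : 0 < r := Fin.pos hne.some.1
  have hrpos' : 0 < r' := Fin.pos hne'.some.1
  obtain ⟨hr1, hc₀⟩ := blocks_of_strict hbsurj hceq hclt hcspan hrpos
  obtain ⟨hr', hc₁⟩ := blocks_of_strict hbsurj' hceq' hclt' hcspan' hrpos'
  -- For `D` acting through `θ` the relative ramification index is one, so there is room for only
  -- one block.
  have hr : r = 1 := by lia
  obtain ⟨c₀, hc₀⟩ := hc₀ hr
  have hrs : t + 1 ≤ r' := card_blocks_le hD (ρ := ρs) (ρ' := ρ')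
    (fun N' => (hρs_range _).2 ((hρ'_range _).1 ⟨N', rfl⟩)) (hws.symm.trans hw') hwsρ hwρ' hθs
    _ _ hbsurjs hclts hcspans hceq'
  have hr's : r' = t + 1 := le_antisymm hr' hrs
  obtain ⟨c₁, hc₁⟩ := hc₁ hr's
  have hlat : hD.lattice w (fun p => c₀ - ((p.1 : ℕ) : ℤ)) =
      hD.lattice w' (fun p => c₁ - ((p.1 : ℕ) : ℤ)) := by
    rw [← funext hc₀, ← funext hc₁, ← hw, hw']
  -- the field `E_D`
  obtain ⟨hur, hfin, hEE⟩ := largestEmbeddable_eq hD hϖ hOD hΔ hOΔ hLcomm hLur hLcomm' hLur''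
    (by rw [hs]; exact hdδ) hED hEΔ
  have hG : Function.Injective (ρ.comp (pearlHom F hπ0 lam)) := RingHom.injective
    (ρ.comp (pearlHom F hπ0 lam)).toRingHom
  have hG' : Function.Injective (ρ'.comp (pearlHom F hπ'0 lam')) := RingHom.injective
    (ρ'.comp (pearlHom F hπ'0 lam')).toRingHom
  have hι : Function.Injective ι := ι.toRingHom.injective
  have hfE : Module.finrank F E_D = f := by
    rw [← hLff]
    exact finrank_eq_of_image_eq (i := ι.toLinearMap)
      (g := (ρ.comp (pearlHom F hπ0 lam)).toLinearMap) hι hG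
      (M := Subalgebra.toSubmodule E_D.toSubalgebra) (N := Subalgebra.toSubmodule Lf) himg
  -- The same set `E_D`, seen through the second pearl embedding, has degree `f'` over `K`.
  have hfE' : Module.finrank F E_D = (t + 1) * f' := by
    rw [← hLff', ← hs, Module.finrank_mul_finrank F K Lf']
    exact finrank_eq_of_image_eq (i := ι.toLinearMap)
      (g := (ρ'.comp (pearlHom F hπ'0 lam')).toLinearMap) hι hG'
      (M := Subalgebra.toSubmodule E_D.toSubalgebra)
      (N := (Subalgebra.toSubmodule Lf').restrictScalars F) (by
        refine Eq.trans ?_ himg'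
        rw [← hEE]
        rfl)
  have hff' : f = f' * r' := by
    rw [hr's, mul_comm, ← hfE', hfE]
  refine ⟨hr, hff', ?_⟩
  -- the root of unity
  obtain ⟨ζ, hζ, hζadj⟩ := hur.exists_isPrimitiveRoot
  have hfpos : 0 < f := hfE ▸ Module.finrank_pos
  rw [hfE] at hζ
  set N := Nat.card (ResidueField R) ^ f - 1 with hN
  have hqf : 1 < Nat.card (ResidueField R) ^ f := Nat.one_lt_pow hfpos.ne' hq
  have hN0 : N ≠ 0 := by lia
  obtain ⟨z, hzLf, hz⟩ : ι ζ ∈ (fun z => ρ (pearlMatrix π lam z)) '' (Lf : Set D) :=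
    himg ▸ ⟨ζ, ζ.2, rfl⟩
  obtain ⟨z', hzLf', hz'⟩ : ι ζ ∈ (fun z => ρ' (pearlMatrix π' lam' z)) '' (Lf' : Set Δ) :=
    himg' ▸ ⟨ζ, hEE ▸ ζ.2, rfl⟩
  replace hz : ρ.comp (pearlHom F hπ0 lam) z = ι ζ := hz
  replace hz' : ρ'.comp (pearlHom F hπ'0 lam') z' = ι ζ := hz'
  have hιζ : ι ζ ^ N = 1 := by
    rw [← map_pow, ← IntermediateField.coe_pow, hζ.pow_eq_one, IntermediateField.coe_one, map_one]
  obtain ⟨B, _, _, j, hj⟩ := exists_field_range_eq L hLcomm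
  have : FiniteDimensional F B :=
    FiniteDimensional.of_injective j.toLinearMap j.toRingHom.injective
  obtain ⟨b, hb⟩ : z ∈ j.range := hj ▸ hLf hzLf
  replace hb : j b = z := hb
  -- Both pearl embeddings are injective homomorphisms of `F`-algebras, so the entries `z` and `z'`
  -- inherit the minimal polynomial of `ζ`.
  have hminz : minpoly F z = minpoly F ζ := by
    rw [← minpoly.algHom_eq _ hG, hz, minpoly.algHom_eq _ hι]
    exact minpoly.algHom_eq E_D.val E_D.val.toRingHom.injective ζ
  have hminz' : minpoly F z' = minpoly F ζ := by
    rw [← minpoly.algHom_eq _ hG', hz', minpoly.algHom_eq _ hι]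
    exact minpoly.algHom_eq E_D.val E_D.val.toRingHom.injective ζ
  have hminb : minpoly F b = minpoly F ζ := by
    rw [← minpoly.algHom_eq j j.toRingHom.injective, hb, hminz]
  obtain ⟨κ, _, _, red, -, hker, hκ⟩ := hD.exists_residueField
    (hD.relIndex_ball_ne_zero F hϖ hOD)
  -- `q` vanishes in `κ`, so `q ^ f - 1` becomes `-1`.
  have hNκ : (N : κ) ≠ 0 := by
    have h1 : (Nat.card (ResidueField R) : κ) = 0 := by
      have h2 : ((Nat.card κ : ℕ) : κ) = 0 := by
        let := Fintype.ofFinite κ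
        rw [Nat.card_eq_fintype_card]
        exact Nat.cast_card_eq_zero κ
      rw [hκ, hQD, Nat.cast_pow] at h2
      exact eq_zero_of_pow_eq_zero h2
    rw [hN, Nat.cast_sub hqf.le, Nat.cast_pow, h1, zero_pow hfpos.ne']
    simp
  have hθ0 : θ π ≠ 0 := (map_ne_zero_iff θ θ.toRingHom.injective).2 hπ0
  have hjL : ∀ x, j x ∈ L := fun x => hj ▸ j.mem_range_self x
  -- The reference uniformizer is `θ π`: it normalises the image of `L` under `θ`, and its fixed
  -- elements there come from `F`.
  refine isRotated_row_of_pearlMatrix hD hker (by rw [hr, mul_one, hff']) (by positivity) hlat hwρ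
    hwρ' hπ0 (by rw [hθ π hπ0, hπ, hr]; simp) hθ0 (by rw [hθ π hπ0, hπ]; simp) hπ'0
    (by rw [hθ' π' hπ'0, hπ', hr's]; simp) (θ.comp j) ?_ ?_ (z := z) (b := b)
    (by rw [← hb]; rfl) hN0 ?_ hNκ ?_ (z' := z') ?_ ?_ (hz.trans hz'.symm)
  · intro x
    obtain ⟨y, hy⟩ : π * j x * π⁻¹ ∈ j.range := hj ▸ hπL _ (hjL x)
    refine ⟨y, ?_⟩
    change θ (j y) = θ π * θ (j x) * (θ π)⁻¹
    rw [← map_inv₀, ← map_mul, ← map_mul]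
    exact congrArg θ hy
  · intro x hx
    change θ π * θ (j x) * (θ π)⁻¹ = θ (j x) at hx
    rw [← map_inv₀, ← map_mul, ← map_mul] at hx
    obtain ⟨y, hy⟩ := hπgen _ (hjL x) (θ.toRingHom.injective hx)
    refine ⟨y, j.toRingHom.injective ?_⟩
    change j (algebraMap F B y) = j x
    rw [j.commutes, hy]
  · apply j.toRingHom.injective
    change j (b ^ N) = j 1
    rw [map_pow, hb, map_one]
    apply hG
    rw [map_pow, hz, hιζ, map_one]
  · rw [hminb, hr, mul_one, ← hfE]
    exact (Field.primitive_element_iff_minpoly_natDegree_eq F ζ).1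
      (IntermediateField.adjoin_eq_top_of_algebra F _ hζadj)
  · apply hG'
    rw [map_pow, hz', hιζ, map_one]
  · rw [hminb, ← hminz', minpoly.aeval]

end RankReduction

/-! ## Orders in standard form over a local field -/

section StandardOrder

open ValuativeRel Matrix

/-- Every nonzero element of `F` is a unit of `R` times a power of `ϖ`, and units of `R` have order
zero. -/
theorem IsOrd.exists_ord_algebraMap_eq {R : Type*} [CommRing R] [IsDomain R]
    [IsDiscreteValuationRing R] {F : Type*} [Field F] [Algebra R F] [IsFractionRing R F]
    {X : Type*} [DivisionRing X] [Algebra F X] [Algebra R X] [IsScalarTower R F X]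
    {O : Subalgebra R X} {ord : X → ℤ} (h : IsOrd O ord) {ϖ : R} (hϖ : Irreducible ϖ) {c : F}
    (hc : c ≠ 0) : ∃ n : ℤ, ord (algebraMap F X c) = n * ord (algebraMap R X ϖ) := by
  have key : ∀ a : R, a ≠ 0 → algebraMap R X a ≠ 0 ∧
      ∃ n : ℤ, ord (algebraMap R X a) = n * ord (algebraMap R X ϖ) := by
    intro a ha
    obtain ⟨n, u, hu⟩ := IsDiscreteValuationRing.associated_pow_irreducible ha hϖ
    have ha0 : algebraMap R X a ≠ 0 := by
      rw [IsScalarTower.algebraMap_apply R F X]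
      simpa using ha
    have hϖ0 : algebraMap R X ϖ ≠ 0 := IsOrd.algebraMap_uniformizer_ne_zero F hϖ
    have huv : algebraMap R X u * algebraMap R X (u⁻¹ : Rˣ) = 1 := by
      rw [← _root_.map_mul, Units.mul_inv, _root_.map_one]
    have hu0 : algebraMap R X u ≠ 0 := left_ne_zero_of_mul_eq_one huv
    have hv0 : algebraMap R X (u⁻¹ : Rˣ) ≠ 0 := right_ne_zero_of_mul_eq_one huv
    have h1 := h.map_mul hu0 hv0
    rw [huv, h.map_one] at h1
    have h2 := (h.mem_iff hu0).1 (O.algebraMap_mem _)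
    have h3 := (h.mem_iff hv0).1 (O.algebraMap_mem _)
    refine ⟨ha0, n, ?_⟩
    have h4 := h.map_mul ha0 hu0
    rw [← _root_.map_mul, hu, _root_.map_pow, h.map_pow hϖ0] at h4
    lia
  obtain ⟨a, b, hb, rfl⟩ := IsFractionRing.div_surjective R c
  have hb0 : b ≠ 0 := nonZeroDivisors.ne_zero hb
  have ha0 : a ≠ 0 := by
    rintro rfl
    simp at hc
  obtain ⟨ha, m, hm⟩ := key a ha0
  obtain ⟨hb', n, hn⟩ := key b hb0
  refine ⟨m - n, ?_⟩
  rw [map_div₀, ← IsScalarTower.algebraMap_apply, ← IsScalarTower.algebraMap_apply, div_eq_mul_inv,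
    h.map_mul ha (inv_ne_zero hb'), h.map_inv hb', hm, hn]
  ring

variable {F : Type*} [Field F] [ValuativeRel F]
variable {X : Type*} [DivisionRing X] [Algebra F X] [FiniteDimensional F X]
variable {I : Type*} [DecidableEq I] {r : ℕ} {b : I → Fin r}

theorem single_mem_standardOrder {p : I} {x : X} :
    single p p x ∈ standardOrder F X b ↔ normVal F X x ≤ 1 := by
  constructor
  · intro h
    simpa using (h p p).1 le_rfl
  · intro h p' q'
    rw [single_apply]
    by_cases h1 : p = p' ∧ p = q'
    · rw [if_pos h1]
      refine ⟨fun _ => h, fun h2 => ?_⟩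
      rw [← h1.1, ← h1.2] at h2
      exact absurd h2 (lt_irrefl _)
    · rw [if_neg h1, normVal_zero]
      exact ⟨fun _ => zero_le_one, fun _ => zero_lt_one⟩

variable [Fintype I]

/-- The integral elements form a ring since the elements of an order do. -/
theorem normVal_add_le_one {k A : Type*} [Field k] [Algebra k X] [Ring A] [Algebra k A]
    {𝔞 : Subring A} (φ : A ≃ₐ[k] Matrix I I X) (hφ : ∀ a, a ∈ 𝔞 ↔ φ a ∈ standardOrder F X b) (p : I)
    (x y : X) (hx : normVal F X x ≤ 1) (hy : normVal F X y ≤ 1) : normVal F X (x + y) ≤ 1 := by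
  have key : ∀ x, φ.symm (single p p x) ∈ 𝔞 ↔ normVal F X x ≤ 1 := fun x => by
    rw [hφ, AlgEquiv.apply_symm_apply, single_mem_standardOrder]
  rw [← key] at hx hy ⊢
  rw [single_add, map_add]
  exact 𝔞.add_mem hx hy

omit [DecidableEq I] [Fintype I] [FiniteDimensional F X] in
theorem mem_standardOrder_iff {O : Subalgebra 𝒪[F] X} {ord : X → ℤ} (h : IsOrd O ord)
    (h0 : ∀ x, x ∈ h.ball 0 ↔ normVal F X x ≤ 1) (h1 : ∀ x, x ∈ h.ball 1 ↔ normVal F X x < 1)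
    {N : Matrix I I X} : N ∈ standardOrder F X b ↔
      ∀ p q, N p q ∈ h.ball (if b p < b q then 1 else 0) := by
  refine forall₂_congr fun p q => ?_
  rcases lt_or_ge (b p) (b q) with hb | hb
  · rw [if_pos hb, h1]
    exact ⟨fun hN => hN.2 hb, fun hN => ⟨fun hb' => absurd hb (not_lt.2 hb'), fun _ => hN⟩⟩
  · rw [if_neg (not_lt.2 hb), h0]
    exact ⟨fun hN => hN.1 hb, fun hN => ⟨fun _ => hN, fun hb' => absurd hb' (not_lt.2 hb)⟩⟩

end StandardOrder

instance centralizer_isScalarTower {F A E : Type*} [Field F] [Ring A] [Algebra F A] [Field E]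
    [Algebra F E] (ι : E →ₐ[F] A) (K : IntermediateField F E) :
    IsScalarTower F K (fieldCentralizer ι K) :=
  IsScalarTower.of_algebraMap_eq fun _ => Subtype.ext (ι.commutes _).symm

/-! ### Matrix algebras identified with the centraliser -/

section CentralizerFrame

open MulOpposite Matrix

variable {F : Type*} [Field F] {D : Type*} [DivisionRing D] [Algebra F D]
variable {V : Type*} [AddCommGroup V] [Module Dᵐᵒᵖ V] [Module F V] [IsScalarTower F Dᵐᵒᵖ V]
variable {E : Type*} [Field E] [Algebra F E] {ι : E →ₐ[F] Module.End Dᵐᵒᵖ V}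
variable {K : IntermediateField F E}
variable {Δ : Type*} [DivisionRing Δ] [Algebra F Δ] [Algebra K Δ] [IsScalarTower F K Δ]
variable {I : Type*} [Fintype I] [DecidableEq I]

/-- The action of a matrix algebra which is identified with the centraliser of `K`. -/
def centralizerAction (φ : fieldCentralizer ι K ≃ₐ[K] Matrix I I Δ) :
    Matrix I I Δ →ₐ[F] Module.End Dᵐᵒᵖ V :=
  (fieldCentralizer ι K).val.comp (φ.symm.restrictScalars F).toAlgHom

theorem centralizerAction_injective (φ : fieldCentralizer ι K ≃ₐ[K] Matrix I I Δ) :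
    Function.Injective (centralizerAction φ) := fun _ _ h => φ.symm.injective (Subtype.ext h)

theorem mem_range_centralizerAction (φ : fieldCentralizer ι K ≃ₐ[K] Matrix I I Δ)
    (a : Module.End Dᵐᵒᵖ V) :
    a ∈ (centralizerAction φ).range ↔ ∀ c : K, ι c * a = a * ι c := by
  constructor
  · rintro ⟨N, rfl⟩ c
    exact Subalgebra.mem_centralizer_iff F |>.1 (φ.symm N).2 _ ⟨c, c.2, rfl⟩
  · intro h
    have ha : a ∈ fieldCentralizer ι K := by
      rw [Subalgebra.mem_centralizer_iff]
      rintro _ ⟨c, hc, rfl⟩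
      exact h ⟨c, hc⟩
    refine ⟨φ ⟨a, ha⟩, ?_⟩
    change (φ.symm (φ ⟨a, ha⟩) : Module.End Dᵐᵒᵖ V) = a
    rw [AlgEquiv.symm_apply_apply]

end CentralizerFrame

theorem row_rowTranspose {f r : ℕ} (M : Matrix (Fin f) (Fin r) ℕ) :
    row (rowTranspose M) = row M := by
  refine List.ext_getElem (by simp [row]) fun m h1 h2 => ?_
  simp only [row, rowTranspose, List.getElem_ofFn]
  congr 1 <;> exact Fin.ext (by simp [Fin.coe_divNat, Fin.coe_modNat])

open ValuativeRel in
theorem mainTheorem11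
    -- `F` is a non-archimedean local field, `D` a central skewfield of finite degree over `F`
    {F : Type*} [Field F] [ValuativeRel F] [TopologicalSpace F] [IsNonarchimedeanLocalField F]
    {D : Type*} [DivisionRing D] [Algebra F D] [Algebra.IsCentral F D] [FiniteDimensional F D]
    -- `V` is a right `D`-vector space of finite dimension `m`, and `A = End_D(V)`
    {V : Type*} [AddCommGroup V] [Module Dᵐᵒᵖ V] [Module F V] [IsScalarTower F Dᵐᵒᵖ V]
    [FiniteDimensional Dᵐᵒᵖ V]
    -- `E` is a field extension of `F` in `A`, and `K` an intermediate field of degree `s`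
    {E : Type*} [Field E] [Algebra F E] (ι : E →ₐ[F] Module.End Dᵐᵒᵖ V)
    (K : IntermediateField F E) (s : ℕ) (hs : Module.finrank F K = s)
    (hs2 : 2 ≤ s) (hsm : s ≤ Module.finrank Dᵐᵒᵖ V)
    -- `Δ` is the skewfield of the central simple `K`-algebra `Z_A(K)`
    {Δ : Type*} [DivisionRing Δ] [Algebra F Δ] [Algebra K Δ] [IsScalarTower F K Δ]
    [Algebra.IsCentral K Δ] [FiniteDimensional K Δ]
    -- `𝔞` is an `Eˣ`-stable vertex
    (𝔞 : Subring (Module.End Dᵐᵒᵖ V)) (h𝔞 : IsEmbeddingPair F F ι 𝔞)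
    (h𝔞1 : HasRank F F D 𝔞 1)
    -- `𝔞 ∩ Z_A(K)` is an `Eˣ`-stable face of rank `s`
    (h𝔟 : IsEmbeddingPair F K (centralizerEmbedding ι K) (interCentralizer ι K 𝔞))
    (h𝔟s : HasRank F K Δ (interCentralizer ι K 𝔞) s)
    -- the embedding types of `(E, 𝔞)` and of `(E, 𝔞 ∩ Z_A(K))`
    {f r f' r' : ℕ} (lam : Matrix (Fin f) (Fin r) ℕ) (lam' : Matrix (Fin f') (Fin r') ℕ)
    (hlam : HasEmbeddingType F F D ι 𝔞 lam)
    (hlam' : HasEmbeddingType F K Δ (centralizerEmbedding ι K) (interCentralizer ι K 𝔞) lam') :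
    (row lam).IsRotated (row lam') ∧ MatEquiv lam (rowTranspose lam') := by
  have : Nontrivial V := Module.nontrivial_of_finrank_pos (R := Dᵐᵒᵖ) (by lia)
  have : FiniteDimensional F K := FiniteDimensional.of_finrank_pos (by lia)
  have : FiniteDimensional F Δ := Module.Finite.trans K Δ
  have : IsAdicComplete (IsLocalRing.maximalIdeal 𝒪[F]) 𝒪[F] := by
    let := IsTopologicalAddGroup.rightUniformSpace F
    have := isUniformAddGroup_of_addCommGroup (G := F)
    infer_instance
  obtain ⟨ϖ, hϖ⟩ := IsDiscreteValuationRing.exists_irreducible 𝒪[F]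
  obtain ⟨n₁, φ₁, hn₁, hφ₁⟩ := h𝔞1
  obtain ⟨n, φs, hn, hφs⟩ := h𝔟s
  obtain ⟨hcol, L, Lf, π, E_D, φ, hL, hπ, hED, hLf, hLff, himg, hφ⟩ := hlam
  obtain ⟨hcol', L', Lf', π', E_Δ, φ', hL', hπ', hEΔ, -, hLff', himg', hφ'⟩ := hlam'
  let p₁ : Σ j : Fin 1, Fin (n₁ j) := ⟨0, 0, hn₁ 0⟩
  let ps : Σ j : Fin s, Fin (n j) := ⟨⟨0, by lia⟩, 0, hn _⟩
  -- the valuations of `D` and `Δ`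
  obtain ⟨OD, ordD, hD, hD0, hD1, hDeq, hDπ⟩ := exists_isOrd (normVal_add_le_one φ₁ hφ₁ p₁)
    hπ.uniformizer
  obtain ⟨OΔ, ordΔ, hΔ, hΔ0, hΔ1, hΔeq, hΔπ⟩ := exists_isOrd (normVal_add_le_one φs hφs ps)
    hπ'.uniformizer
  have hOD : (Subalgebra.toSubmodule OD).FG := by
    refine h𝔞.hereditary.1.fg_of_injective
      (φ₁.symm.toLinearMap.comp (Matrix.singleLinearMap F p₁ p₁)) ?_ _ fun x hx => ?_
    · exact φ₁.symm.injective.comp fun x y hxy => by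
        simpa using congrFun (congrFun hxy p₁) p₁
    · rw [hφ₁]
      change φ₁ (φ₁.symm (Matrix.single p₁ p₁ x)) ∈ _
      rw [AlgEquiv.apply_symm_apply, single_mem_standardOrder, ← hD0, hD.mem_ball_zero]
      exact hx
  have hOΔ : (Subalgebra.toSubmodule OΔ).FG := by
    refine h𝔞.hereditary.1.fg_of_injective
      ((centralizerAction φs).toLinearMap.comp (Matrix.singleLinearMap F ps ps)) ?_ _ fun x hx => ?_
    · exact (centralizerAction_injective φs).comp fun x y hxy => by
        simpa using congrFun (congrFun hxy ps) ps
    · change φs.symm (Matrix.single ps ps x) ∈ interCentralizer ι K 𝔞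
      rw [hφs, AlgEquiv.apply_symm_apply, single_mem_standardOrder, ← hΔ0, hΔ.mem_ball_zero]
      exact hx
  -- the lattice
  have hbij₁ : Function.Bijective φ₁.symm.toAlgHom := φ₁.symm.bijective
  have : Nonempty (Σ j : Fin 1, Fin (n₁ j)) := ⟨p₁⟩
  obtain ⟨v, θ, hv⟩ := exists_basis_of_card_eq φ₁.symm.toAlgHom
    (finrank_eq_card_of_surjective φ₁.symm.toAlgHom hbij₁)
  -- By dimension `θ` is an `F`-automorphism of `D`, and it preserves the norm.
  have hθ : ∀ x, normVal F D (θ x) = normVal F D x := fun x => by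
    have := Algebra.norm_eq_of_algEquiv (AlgEquiv.ofBijective θ (by
      have h1 : Function.Injective θ := θ.toRingHom.injective
      exact ⟨h1, (LinearMap.injective_iff_surjective (f := θ.toLinearMap)).1 h1⟩)) x
    exact congrArg (valuation F) this
  -- Rank one means a single block, so `𝔞` consists of the matrices with integral entries and is the
  -- stabiliser of the lattice spanned by `v`.
  have hstab : ∀ a, a ∈ 𝔞 ↔ ∀ x ∈ hD.lattice v 0, a x ∈ hD.lattice v 0 := by
    intro a
    rw [hφ₁, mem_standardOrder_iff hD hD0 hD1, hD.map_lattice_le_iff (m := fun p q => θ (φ₁ a p q))]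
    · refine forall₂_congr fun p q => ?_
      rw [if_neg (by rw [Subsingleton.elim p.1 q.1]; exact lt_irrefl _), Pi.zero_apply,
        Pi.zero_apply, sub_self, hD0, hD0, hθ]
    · intro q
      have := hv (φ₁ a) q
      rw [← this]
      change a (v q) = φ₁.symm (φ₁ a) (v q)
      rw [AlgEquiv.symm_apply_apply]
  have hne : ∀ {X : Type _} [DivisionRing X] [Algebra F X] [FiniteDimensional F X] {x y : X},
      x ≠ 0 → normVal F X x = normVal F X y → y ≠ 0 := fun hx hxy h0 => by
    rw [h0, normVal_zero] at hxy
    exact normVal_ne_zero hx hxy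
  obtain ⟨hr, hff', hrot⟩ := rank_reduction hD hϖ hOD hΔ hOΔ v ι hs lam lam' hcol hcol'
    (ρ := φ.symm.toAlgHom) φ.symm.bijective
    (fun N => by
      rw [← hstab, ← mem_standardOrder_iff hD hD0 hD1, hφ]
      change φ (φ.symm N) ∈ _ ↔ _
      rw [AlgEquiv.apply_symm_apply])
    hn (ρs := centralizerAction φs) (centralizerAction_injective φs)
    (mem_range_centralizerAction φs)
    (fun N => by
      rw [← hstab, ← mem_standardOrder_iff hΔ hΔ0 hΔ1]
      change φs.symm N ∈ interCentralizer ι K 𝔞 ↔ _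
      rw [hφs, AlgEquiv.apply_symm_apply])
    (ρ' := centralizerAction φ') (centralizerAction_injective φ')
    (mem_range_centralizerAction φ')
    (fun N => by
      rw [← hstab, ← mem_standardOrder_iff hΔ hΔ0 hΔ1]
      change φ'.symm N ∈ interCentralizer ι K 𝔞 ↔ _
      rw [hφ', AlgEquiv.apply_symm_apply])
    hL.comm hL.degree
    (fun x hx hx0 => by
      obtain ⟨c, hc⟩ := hL.unramified x hx
      have hc0 : algebraMap F D c ≠ 0 := hne hx0 hc
      obtain ⟨k, hk⟩ := hD.exists_ord_algebraMap_eq hϖ (c := c) (by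
        rintro rfl
        exact hc0 (map_zero _))
      exact ⟨k, ((hDeq _ _ hx0 hc0).2 hc).trans hk⟩)
    hπ.uniformizer.1 (hDπ π hπ.uniformizer) hπ.normalizes hπ.generates
    hL'.comm hL'.degree
    (fun x hx hx0 => by
      obtain ⟨c, hc⟩ := hL'.unramified x hx
      have hc0 : algebraMap K Δ c ≠ 0 := fun h0 => by
        rw [h0, normVal_zero] at hc
        exact normVal_ne_zero hx0 hc
      exact ⟨c, fun h0 => hc0 (by rw [h0, map_zero]), (hΔeq _ _ hx0 hc0).2 hc⟩)
    hπ'.uniformizer.1 (hΔπ π' hπ'.uniformizer) hED hEΔ hLf hLff hLff'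
    (by
      have := congrArg (fun S => φ.symm '' S) himg
      simpa [Set.image_image] using this)
    (by
      have := congrArg (fun S => (fun N => (φ'.symm N : Module.End Dᵐᵒᵖ V)) '' S) himg'
      simp only [Set.image_image, AlgEquiv.symm_apply_apply] at this
      exact this)
  exact ⟨hrot, hff', hr, by rwa [row_rowTranspose]⟩
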